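/- **Setting.** An indexing category $\mathbf G$ is a finite partially ordered set, regarded as a category in which an arrow $i\to j$ means that $i$ is an ancestor of $j$, such that any two objects have a least common ancestor and there is an initial object $\hat\imath$ (an ancestor of all objects). A $\mathbf G$-diagram $\mathcal Z=\{Z_i\}$ is a functor from $\mathbf G$ to the category of finite probability spaces and measure-preserving maps (up to null sets); its tensor product is taken entry by entry. For a fan $\mathcal X\leftarrow\mathcal Z\to\mathcal Y$ of $\mathbf G$-diagrams put $\mathrm{kd}=\sum_i|H(Z_i)-H(X_i)|+\sum_i|H(Z_i)-H(Y_i)|$, where $H$ is Shannon entropy, and let $\mathrm{ikd}(\mathcal X,\mathcal Y)$ be the infimum of $\mathrm{kd}$ over all such fans. A sequence $(\mathcal Z(n))_n$ is quasi-linear if $\mathrm{ikd}(\mathcal Z(m+n),\mathcal Z(m)\otimes\mathcal Z(n))\le\varphi(m+n)$ for all $m,n\ge1$ and some non-negative, non-decreasing $\varphi$ with $\sum_n\varphi(n)/n^2<\infty$. A tropical $\mathbf G$-diagram $[\mathcal Z]$ is a class of quasi-linear sequences modulo asymptotic entropy distance $\lim_n\frac1n\mathrm{ikd}(\cdot,\cdot)=0$.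 For spaces $[A]\to[B]$ of $[\mathcal Z]$, $[A|B]=\lim_n\frac1n\big(H(A(n))-H(B(n))\big)$. For a space $[X]$ of $[\mathcal Z]$, $\lceil X\rceil$ is the tropical sub-diagram of all descendants of $X$. If $[\mathcal X]=\lceil X\rceil$ and $[U]$ is a space of $[\mathcal Z]$, the conditioned diagram is the tropical diagram $[\mathcal X|U]=\lim_n\frac1n\sum_{a\in U(n)}p_{U(n)}(a)\,[\mathcal X(n)|a]$, where $\mathcal X(n)|a$ is $\mathcal X(n)$ conditioned on the atom $a$ of $U(n)$ and the sum is a conic combination of the tropical diagrams of the sequences of tensor powers $\big((\mathcal X(n)|a)^{\otimes m}\big)_m$. A fan $([X]\leftarrow[Z]\to[U])$ in $[\mathcal Z]$ is *admissible* if $Z$ is the initial space of $[\mathcal Z]$, the fan is minimal (that is, $[Z]$ is the joint space of $[X]$ and $[U]$: the conditional entropy of $[Z]$ given $[X]$ and $[U]$ jointly is $0$), every space of $[\mathcal Z]$ is a descendant of $X$ or an ancestor of $U$, and $U$ is not itself a descendant of $X$. It is *reduced* if $[Z]\to[X]$ is an isomorphism, i.e. $[Z|X]=0$. **Theorem (Arrow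 expansion).** Let $([X]\leftarrow[Z']\to[U'])$ be a reduced admissible fan in a tropical $\mathbf G$-diagram $[\mathcal Z']$, let $[\mathcal X]=\lceil X\rceil$ and let $\lambda>0$. Then there is a tropical $\mathbf G$-diagram $[\mathcal Z]$ whose sub-diagram at the same indices is $[\mathcal X]$ as well, such that the fan $([X]\leftarrow[Z]\to[U])$ at the same three indices is admissible and satisfies $$[Z|X]=\lambda\qquad\text{and}\qquad[\mathcal X|U]=[\mathcal X|U'],$$ both conditioned diagrams being well defined. -/

import Mathlib

open CategoryTheory Filter Topology
open scoped ENNReal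

noncomputable section

/-! ### Finite probability spaces -/

/-- A finite probability space, given by its finite set of atoms, all of positive weight.
Points of weight zero are discarded: since morphisms only matter up to null sets, every
probability space of finite support is isomorphic to one of this form, and between spaces of
this form an almost-everywhere class of maps is just a map. -/
structure FinProb : Type 1 where
  carrier : Type
  [fintypeCarrier : Fintype carrier]
  weight : carrier → ℝ
  weight_pos : ∀ a, 0 < weight a
  sum_weight : ∑ a, weight a = 1

attribute [instance] FinProb.fintypeCarrier

namespace FinProb

theorem nonempty (X : FinProb) : Nonempty X.carrier := by
  by_contra h
  rw [not_nonempty_iff] at h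
  have := X.sum_weight
  simp at this

open Classical in
/-- A map is measure preserving if the weight of each atom of the target is the total weight
of its fibre. -/
def IsMeasurePreserving (X Y : FinProb) (f : X.carrier → Y.carrier) : Prop :=
  ∀ b, ∑ a with f a = b, X.weight a = Y.weight b

/-- Morphisms of finite probability spaces: measure-preserving maps. -/
@[ext]
structure Hom (X Y : FinProb) : Type where
  toFun : X.carrier → Y.carrier
  preserving : IsMeasurePreserving X Y toFun

theorem IsMeasurePreserving.id (X : FinProb) : IsMeasurePreserving X X (fun a => a) := by
  classical
  intro b
  simp [Finset.sum_filter]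

theorem IsMeasurePreserving.comp {X Y T : FinProb} {f : X.carrier → Y.carrier}
    {g : Y.carrier → T.carrier} (hf : IsMeasurePreserving X Y f)
    (hg : IsMeasurePreserving Y T g) : IsMeasurePreserving X T (fun a => g (f a)) := by
  classical
  intro c
  rw [← hg c, Finset.sum_congr rfl (fun b _ => (hf b).symm), Finset.sum_filter,
    Finset.sum_filter]
  simp only [Finset.sum_filter]
  have h : ∀ b, (if g b = c then ∑ a, (if f a = b then X.weight a else 0) else 0)
      = ∑ a, (if f a = b then (if g (f a) = c then X.weight a else 0) else 0) := by
    intro b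
    split_ifs with hb
    · refine Finset.sum_congr rfl fun a _ => ?_
      by_cases h1 : f a = b
      · simp [h1, hb]
      · simp [h1]
    · symm
      refine Finset.sum_eq_zero fun a _ => ?_
      by_cases h1 : f a = b
      · simp [h1, hb]
      · simp [h1]
  simp only [h]
  rw [Finset.sum_comm]
  simp

instance : Category FinProb where
  Hom := Hom
  id X := ⟨fun a => a, IsMeasurePreserving.id X⟩
  comp f g := ⟨fun a => g.toFun (f.toFun a), f.preserving.comp g.preserving⟩

theorem id_toFun (X : FinProb) (a : X.carrier) : Hom.toFun (𝟙 X) a = a := rfl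

theorem comp_toFun {X Y T : FinProb} (f : X ⟶ Y) (g : Y ⟶ T) (a : X.carrier) :
    Hom.toFun (f ≫ g) a = Hom.toFun g (Hom.toFun f a) := rfl

/-- The entropy `- ∑ p log p` (natural logarithm). -/
def entropy (X : FinProb) : ℝ := ∑ a, Real.negMulLog (X.weight a)

open Classical in
/-- The image of a probability space under an arbitrary map `f`: the set of values of `f`, with
the push-forward distribution. -/
def image (X : FinProb) {S : Type} (f : X.carrier → S) : FinProb where
  carrier := Set.range f
  fintypeCarrier := Fintype.ofFinite _
  weight b := ∑ a with f a = b.1, X.weight a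
  weight_pos := by
    rintro ⟨_, a, rfl⟩
    exact Finset.sum_pos (fun a _ => X.weight_pos a) ⟨a, by simp⟩
  sum_weight := by
    let : Fintype (Set.range f) := Fintype.ofFinite _
    rw [← X.sum_weight]
    rw [← Finset.sum_fiberwise (s := Finset.univ)
      (g := fun a => (⟨f a, a, rfl⟩ : Set.range f)) (f := X.weight)]
    refine Finset.sum_congr rfl fun b _ => ?_
    refine Finset.sum_congr ?_ fun _ _ => rfl
    ext a
    simp [Subtype.ext_iff]

theorem isMeasurePreserving_image (X : FinProb) {S T : Type} (f : X.carrier → S)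
    (g : S → T) (k : X.carrier → T) (h : ∀ a, g (f a) = k a) :
    IsMeasurePreserving (X.image f) (X.image k)
      (fun b => ⟨g b.1, by obtain ⟨a, ha⟩ := b.2; exact ⟨a, by rw [← ha, h]⟩⟩) := by
  classical
  rintro ⟨c, hc⟩
  let : Fintype (Set.range f) := Fintype.ofFinite _
  change ∑ b : Set.range f with _, ∑ a with f a = b.1, X.weight a =
    ∑ a with k a = c, X.weight a
  rw [← Finset.sum_fiberwise_of_maps_to (s := Finset.univ.filter fun a => k a = c)
      (t := Finset.univ.filter fun b : Set.range f => g b.1 = c)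
      (g := fun a => (⟨f a, a, rfl⟩ : Set.range f)) (f := X.weight)]
  · refine Finset.sum_congr (Finset.ext fun b =>
      ⟨fun hb => Finset.mem_filter.2
          ⟨Finset.mem_univ _, congrArg Subtype.val (Finset.mem_filter.1 hb).2⟩,
        fun hb => Finset.mem_filter.2
          ⟨Finset.mem_univ _, Subtype.ext (Finset.mem_filter.1 hb).2⟩⟩) fun b hb => ?_
    have hb' : g b.1 = c := (Finset.mem_filter.1 hb).2
    refine Finset.sum_congr ?_ fun _ _ => rfl
    ext a
    simp only [Finset.mem_filter, Finset.mem_univ, true_and, Subtype.ext_iff]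
    constructor
    · intro ha
      exact ⟨by rw [← h, ha, hb'], ha⟩
    · exact fun ha => ha.2
  · intro a ha
    simp only [Finset.mem_filter, Finset.mem_univ, true_and] at ha ⊢
    rw [h, ha]

open Classical in
/-- The probability space `X` conditioned on a non-empty event `s`. -/
def condition (X : FinProb) (s : Set X.carrier) (hs : s.Nonempty) : FinProb where
  carrier := s
  fintypeCarrier := Fintype.ofFinite _
  weight a := X.weight a.1 / ∑ b with b ∈ s, X.weight b
  weight_pos := by
    intro a
    refine div_pos (X.weight_pos _) (Finset.sum_pos (fun a _ => X.weight_pos a) ?_)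
    exact ⟨a.1, by simp⟩
  sum_weight := by
    let : Fintype s := Fintype.ofFinite _
    have hpos : 0 < ∑ b with b ∈ s, X.weight b := by
      obtain ⟨a, ha⟩ := hs
      exact Finset.sum_pos (fun a _ => X.weight_pos a) ⟨a, by simpa using ha⟩
    rw [← Finset.sum_div, div_eq_one_iff_eq hpos.ne']
    exact (Finset.sum_subtype _ (by simp) _).symm

/-- The tensor (independent) product of two probability spaces. -/
def tensor (X Y : FinProb) : FinProb where
  carrier := X.carrier × Y.carrier
  weight a := X.weight a.1 * Y.weight a.2
  weight_pos a := mul_pos (X.weight_pos _) (Y.weight_pos _)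
  sum_weight := by
    rw [Fintype.sum_prod_type, ← Finset.sum_mul_sum, X.sum_weight, Y.sum_weight, one_mul]

theorem IsMeasurePreserving.tensor {X Y X' Y' : FinProb} {f : X.carrier → X'.carrier}
    {g : Y.carrier → Y'.carrier} (hf : IsMeasurePreserving X X' f)
    (hg : IsMeasurePreserving Y Y' g) :
    IsMeasurePreserving (X.tensor Y) (X'.tensor Y') (fun a => (f a.1, g a.2)) := by
  classical
  rintro ⟨b, c⟩
  change ∑ a : X.carrier × Y.carrier with _, X.weight a.1 * Y.weight a.2 =
    X'.weight b * Y'.weight c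
  rw [← hf b, ← hg c, Finset.sum_mul_sum, ← Finset.sum_product']
  refine Finset.sum_congr ?_ fun _ _ => rfl
  ext a
  simp only [Finset.mem_product, Finset.mem_filter, Finset.mem_univ, true_and]
  exact ⟨fun h => Prod.ext_iff.1 (Finset.mem_filter.1 h).2,
    fun h => Finset.mem_filter.2 ⟨Finset.mem_univ _, Prod.ext_iff.2 h⟩⟩

open Classical in
/-- The tensor (independent) product of a finite family of probability spaces. -/
def pi {ι : Type} [Fintype ι] (X : ι → FinProb) : FinProb where
  carrier := ∀ k, (X k).carrier
  weight a := ∏ k, (X k).weight (a k)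
  weight_pos a := Finset.prod_pos fun k _ => (X k).weight_pos _
  sum_weight := by
    rw [← Fintype.prod_sum]
    simp [sum_weight]

theorem IsMeasurePreserving.pi {ι : Type} [Fintype ι] {X Y : ι → FinProb}
    {f : ∀ k, (X k).carrier → (Y k).carrier}
    (hf : ∀ k, IsMeasurePreserving (X k) (Y k) (f k)) :
    IsMeasurePreserving (FinProb.pi X) (FinProb.pi Y) (fun a k => f k (a k)) := by
  classical
  intro b
  change ∑ a : ((k : ι) → (X k).carrier) with _, ∏ k, (X k).weight (a k) =
    ∏ k, (Y k).weight (b k)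
  rw [Finset.prod_congr rfl (fun k _ => (hf k (b k)).symm), Finset.prod_univ_sum]
  refine Finset.sum_congr ?_ fun _ _ => rfl
  ext a
  simp only [Fintype.mem_piFinset, Finset.mem_filter, Finset.mem_univ, true_and]
  exact ⟨fun h => funext_iff.1 (Finset.mem_filter.1 h).2,
    fun h => Finset.mem_filter.2 ⟨Finset.mem_univ _, funext_iff.2 h⟩⟩

end FinProb

/-! ### Diagrams of probability spaces

An indexing category is a finite partially ordered set `G` with least common ancestors. We orient
the order as Mathlib does for the category attached to an order: there is an arrow `i ⟶ j` exactly
if `i ≤ j`, so `i ≤ j` says that `i` is an ancestor of `j`, least common ancestors are infima, and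
the initial object is `⊥`. The ancestors of `k` are `{i | i ≤ k}` and its descendants are
`Set.Ici k`. A `G`-diagram of probability spaces is a functor `G ⥤ FinProb`. -/

section Diagrams

variable {G : Type*} [SemilatticeInf G]

/-- The entry-wise tensor product of two diagrams. -/
def tensorDiagram (X Y : G ⥤ FinProb) : G ⥤ FinProb where
  obj i := (X.obj i).tensor (Y.obj i)
  map f := ⟨fun a => ((X.map f).toFun a.1, (Y.map f).toFun a.2),
    (X.map f).preserving.tensor (Y.map f).preserving⟩
  map_id i := by
    simp only [X.map_id, Y.map_id]
    rfl
  map_comp f g := by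
    simp only [X.map_comp, Y.map_comp]
    rfl

/-- The entry-wise tensor product of a finite family of diagrams. -/
def piDiagram {ι : Type} [Fintype ι] (X : ι → (G ⥤ FinProb)) : G ⥤ FinProb where
  obj i := FinProb.pi fun k => (X k).obj i
  map f := ⟨fun a k => ((X k).map f).toFun (a k),
    FinProb.IsMeasurePreserving.pi fun k => ((X k).map f).preserving⟩
  map_id i := by
    refine FinProb.Hom.ext (funext fun a => funext fun k => ?_)
    exact congrArg (fun h => FinProb.Hom.toFun h (a k)) ((X k).map_id i)
  map_comp f g := by
    refine FinProb.Hom.ext (funext fun a => funext fun k => ?_)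
    exact congrArg (fun h => FinProb.Hom.toFun h (a k)) ((X k).map_comp f g)

/-- The sub-diagram `⌈X⌉` of all descendants of the space `X = Z x`. -/
def restrictDiagram (x : G) (Z : G ⥤ FinProb) : Set.Ici x ⥤ FinProb where
  obj i := Z.obj i.1
  map f := Z.map (homOfLE (leOfHom f : _))
  map_id i := Z.map_id i.1
  map_comp f g := Z.map_comp (homOfLE (leOfHom f : _)) (homOfLE (leOfHom g : _))

/-- The entropy distance `kd` of a fan `X ⟵ Z ⟶ Y` of `G`-diagrams, in the `ℓ¹`-norm of `ℝ^G`. -/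
def fanDist {X Y Z : G ⥤ FinProb} (_f : Z ⟶ X) (_g : Z ⟶ Y) : ℝ :=
  ∑ᶠ i, |(Z.obj i).entropy - (X.obj i).entropy| + ∑ᶠ i, |(Z.obj i).entropy - (Y.obj i).entropy|

/-- The intrinsic entropy distance of two `G`-diagrams: the infimum of `kd` over all fans. -/
def ikd (X Y : G ⥤ FinProb) : ℝ≥0∞ :=
  ⨅ (Z : G ⥤ FinProb) (f : Z ⟶ X) (g : Z ⟶ Y), ENNReal.ofReal (fanDist f g)

/-- The asymptotic entropy distance of two sequences of diagrams. (For almost linear sequences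
the limit exists; a limit superior never takes a default value.) -/
def aikd (X Y : ℕ → (G ⥤ FinProb)) : ℝ≥0∞ :=
  limsup (fun n : ℕ => ikd (X n) (Y n) / (n : ℝ≥0∞)) atTop

/-- Admissible bounds: non-negative, non-decreasing and with `∑ φ(n)/n²` (equivalently
`∫₁^∞ φ(t)/t² dt`) finite. For example `φ(n) = C n^α` with `α < 1`. -/
structure IsAdmissibleBound (φ : ℕ → ℝ) : Prop where
  nonneg : ∀ n, 0 ≤ φ n
  mono : Monotone φ
  summable : Summable fun n : ℕ => φ n / (n : ℝ) ^ 2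

/-- Almost linear (quasi-linear) growth: the defect of additivity of the sequence is bounded by an
admissible function. -/
def IsQuasiLinear (X : ℕ → (G ⥤ FinProb)) : Prop :=
  ∃ φ : ℕ → ℝ, IsAdmissibleBound φ ∧ ∀ m n : ℕ, 1 ≤ m → 1 ≤ n →
    ikd (X (m + n)) (tensorDiagram (X m) (X n)) ≤ ENNReal.ofReal (φ (m + n))

variable (G) in
/-- Quasi-linear sequences of `G`-diagrams. -/
def QLSeq : Type _ := {X : ℕ → (G ⥤ FinProb) // IsQuasiLinear X}

variable (G) in
/-- Tropical `G`-diagrams: quasi-linear sequences of `G`-diagrams up to asymptotic entropy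
distance zero. (By the triangle inequality for `ikd` the relation divided out is already an
equivalence relation.) -/
def TropDiagram : Type _ := Quot fun X Y : QLSeq G => aikd X.1 Y.1 = 0

/-- The sequence `X` represents the tropical diagram `T`. -/
def Represents (X : QLSeq G) (T : TropDiagram G) : Prop := Quot.mk _ X = T

theorem restrictDiagram_tensorDiagram (x : G) (X Y : G ⥤ FinProb) :
    restrictDiagram x (tensorDiagram X Y) =
      tensorDiagram (restrictDiagram x X) (restrictDiagram x Y) := rfl

theorem ikd_restrictDiagram_le [Finite G] (x : G) (X Y : G ⥤ FinProb) :
    ikd (restrictDiagram x X) (restrictDiagram x Y) ≤ ikd X Y := by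
  refine le_iInf fun Z => le_iInf fun f => le_iInf fun g => ?_
  have key : ∀ h : G → ℝ, ∑ᶠ i : Set.Ici x, |h i.1| ≤ ∑ᶠ i, |h i| := by
    classical
    intro h
    let := Fintype.ofFinite G
    let := Fintype.ofFinite (Set.Ici x)
    rw [finsum_eq_sum_of_fintype, finsum_eq_sum_of_fintype,
      ← Finset.sum_subtype (Finset.univ.filter fun i => i ∈ Set.Ici x) (by simp)
        (fun i => |h i|)]
    exact Finset.sum_le_sum_of_subset_of_nonneg (Finset.filter_subset _ _)
      fun i _ _ => abs_nonneg _
  let f' : restrictDiagram x Z ⟶ restrictDiagram x X :=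
    { app := fun i => f.app i.1, naturality := fun _ _ k => f.naturality _ }
  let g' : restrictDiagram x Z ⟶ restrictDiagram x Y :=
    { app := fun i => g.app i.1, naturality := fun _ _ k => g.naturality _ }
  refine iInf_le_of_le (restrictDiagram x Z) (iInf_le_of_le f' (iInf_le_of_le g' ?_))
  refine ENNReal.ofReal_le_ofReal (add_le_add ?_ ?_)
  · exact key fun i => (Z.obj i).entropy - (X.obj i).entropy
  · exact key fun i => (Z.obj i).entropy - (Y.obj i).entropy

/-- The sub-diagram `⌈X⌉` of the descendants of the space `X` with index `x` in a tropical
diagram. -/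
def TropDiagram.restrict [Finite G] (x : G) : TropDiagram G → TropDiagram (Set.Ici x) :=
  Quot.map
    (fun X => ⟨fun n => restrictDiagram x (X.1 n), by
      obtain ⟨φ, hφ, h⟩ := X.2
      refine ⟨φ, hφ, fun m n hm hn => ?_⟩
      rw [← restrictDiagram_tensorDiagram]
      exact (ikd_restrictDiagram_le x _ _).trans (h m n hm hn)⟩)
    (by
      intro X Y h
      refine nonpos_iff_eq_zero.1 (le_trans ?_ h.le)
      exact limsup_le_limsup (Eventually.of_forall fun n =>
        ENNReal.div_le_div_right (ikd_restrictDiagram_le x _ _) _))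

variable [OrderBot G]

/-- The structure map from the initial space of a diagram to the space with index `i`. -/
def fromInitial (Z : G ⥤ FinProb) (i : G) : (Z.obj ⊥).carrier → (Z.obj i).carrier :=
  (Z.map (homOfLE bot_le : (⊥ : G) ⟶ i)).toFun

/-- The entropy of the pair of variables `X = Z x`, `U = Z u`, i.e. of their joint distribution,
induced from the initial space of the diagram `Z`. -/
def jointEntropy (Z : G ⥤ FinProb) (x u : G) : ℝ :=
  ((Z.obj ⊥).image fun z => (fromInitial Z x z, fromInitial Z u z)).entropy

/-! ### Conditioning -/

theorem fromInitial_surjective (Z : G ⥤ FinProb) (i : G) :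
    Function.Surjective (fromInitial Z i) := by
  classical
  intro b
  by_contra h
  have h1 := (Z.map (homOfLE bot_le : (⊥ : G) ⟶ i)).preserving b
  rw [Finset.sum_eq_zero] at h1
  · exact absurd h1 ((Z.obj i).weight_pos b).ne
  · intro a ha
    exact absurd ⟨a, (Finset.mem_filter.1 ha).2⟩ h

theorem map_fromInitial (Z : G ⥤ FinProb) {i j : G} (f : i ⟶ j) (z : (Z.obj ⊥).carrier) :
    (Z.map f).toFun (fromInitial Z i z) = fromInitial Z j z := by
  have h : Z.map (homOfLE bot_le : (⊥ : G) ⟶ j) =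
      Z.map (homOfLE bot_le : (⊥ : G) ⟶ i) ≫ Z.map f := by
    rw [← Z.map_comp]
    rfl
  unfold fromInitial
  rw [h]
  rfl

/-- The initial space of `Z`, conditioned on the event that `U = Z u` takes the value `a`. -/
def condInitial (Z : G ⥤ FinProb) (u : G) (a : (Z.obj u).carrier) : FinProb :=
  (Z.obj ⊥).condition {z | fromInitial Z u z = a} (fromInitial_surjective Z u a)

/-- The diagram `Z | a` of conditional distributions of the spaces in `Z`, given that `U = Z u`
takes the value `a`. -/
def condDiagram (Z : G ⥤ FinProb) (u : G) (a : (Z.obj u).carrier) : G ⥤ FinProb where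
  obj i := (condInitial Z u a).image
    fun z : {z | fromInitial Z u z = a} => fromInitial Z i z.1
  map {i j} f := ⟨fun b => ⟨(Z.map f).toFun b.1, by
      obtain ⟨z, hz⟩ := b.2
      exact ⟨z, by rw [← hz, map_fromInitial]⟩⟩,
    FinProb.isMeasurePreserving_image _ _ (Z.map f).toFun _
      fun z : {z | fromInitial Z u z = a} => map_fromInitial Z f z.1⟩
  map_id i := by
    simp only [Z.map_id]
    rfl
  map_comp f g := by
    simp only [Z.map_comp]
    rfl

/-- The sequence `m ↦ ⨂ₐ D(a)^{⊗ ⌊c(a) m⌋}`, which represents the tropical diagram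
`∑ₐ c(a) · [D(a)]`, where `[D(a)]` is the tropical diagram of the sequence of tensor powers
of `D(a)`. -/
def conicCombination {S : Type} [Fintype S] (c : S → ℝ) (D : S → (G ⥤ FinProb)) :
    ℕ → (G ⥤ FinProb) :=
  fun m => piDiagram fun k : Σ a : S, Fin ⌊c a * (m : ℝ)⌋₊ => D k.1

/-- The conditional entropy `[A | B]` of the spaces with indices `i` (for `A`) and `j` (for its
descendant `B`) in the tropical diagram `T` is equal to `h`. -/
def HasCondEntropy (T : TropDiagram G) (i j : G) (h : ℝ) : Prop :=
  ∀ Z : QLSeq G, Represents Z T →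
    Tendsto (fun n : ℕ => (((Z.1 n).obj i).entropy - ((Z.1 n).obj j).entropy) / (n : ℝ))
      atTop (𝓝 h)

/-- The fan `[X] ⟵ [Z] ⟶ [U]` of the spaces with indices `x`, `⊥`, `u` is minimal: `[Z]` is the
joint space of `[X]` and `[U]`, that is, `[Z | X U] = 0`. -/
def IsMinimalFan (T : TropDiagram G) (x u : G) : Prop :=
  ∀ Z : QLSeq G, Represents Z T →
    Tendsto (fun n : ℕ => (((Z.1 n).obj ⊥).entropy - jointEntropy (Z.1 n) x u) / (n : ℝ))
      atTop (𝓝 0)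

/-- The fan `[X] ⟵ [Z] ⟶ [U]` of the spaces with indices `x`, `⊥` (the initial space), `u` is
admissible: it is minimal, every space of the diagram is a descendant of `X` or an ancestor
of `U`, and the two parts are disjoint, i.e. `U` is not a descendant of `X`. (If `⊥` is the least
common ancestor of `x` and `u`, the last condition just says that `X` and `Z` are different
objects of the diagram.) -/
structure IsAdmissibleFan (T : TropDiagram G) (x u : G) : Prop where
  minimal : IsMinimalFan T x u
  cover : ∀ i : G, x ≤ i ∨ i ≤ u
  disjoint : ¬ x ≤ u

/-- An admissible fan is reduced if the arrow `[Z] ⟶ [X]` is an isomorphism of tropical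
probability spaces, i.e. if `[Z | X] = 0`. -/
def IsReducedFan (T : TropDiagram G) (x : G) : Prop := HasCondEntropy T ⊥ x 0

/-- `C` is the conditioned diagram `[𝒳 | U]`, where `𝒳 = ⌈X⌉` is the sub-diagram of the
descendants of the space with index `x`, and `U` is the space with index `u`, in the tropical
diagram `T`:
`[𝒳 | U] = lim (1/n) ∫ [𝒳(n) | a] dp(a)`, where `(Z(n))` is a sequence that represents `T`, the
integral over the atoms `a` of `U(n)` is a finite convex combination of tropical diagrams, and
the limit is taken with respect to the asymptotic entropy distance. If the diagrams `Z(n)` are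
homogeneous, all `𝒳(n) | a` are isomorphic and this is the limit of `(1/n) [𝒳(n) | aₙ]` for any
choice of atoms `aₙ`. -/
def IsConditioned (T : TropDiagram G) (x u : G) (C : TropDiagram (Set.Ici x)) : Prop :=
  ∀ Z : QLSeq G, Represents Z T → ∀ D : QLSeq (Set.Ici x), Represents D C →
    Tendsto (fun n : ℕ => aikd
        (conicCombination (fun a : ((Z.1 n).obj u).carrier => ((Z.1 n).obj u).weight a / (n : ℝ))
          (fun a => restrictDiagram x (condDiagram (Z.1 n) u a)))
        D.1)
      atTop (𝓝 0)

end Diagrams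

end

/-! The expansion adds independent noise that is invisible below `x`. Let `W` have entropy λ and let
`J` be the diagram with `W` at every index that is not a descendant of `x` and a point at every
descendant. If `X(n)` represents the given tropical diagram, take `X(n) ⊗ J^{⊗n}`. The restriction
to the descendants of `x` is unchanged up to isomorphism. The entropy of the initial space grows by
nλ and that of the space at `x` by nothing, so reducedness turns [Z'|X] = 0 into [Z|X] = λ. Since
`u` is not a descendant of `x`, the noise is fully visible at `u`: joint and initial entropy grow by
the same nλ and the fan stays minimal. Conditioning on the noise does nothing to the trivial part of
`J` below `x`, so the conditioned diagrams agree. All this is `theoremp`.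

Most of the work shows that conditioned diagrams exist and do not depend on representatives.
Diagrams modulo `kd`-distance zero form a commutative monoid with non-expansive addition. There,
conditioning on `u` yields a conic combination of classes, `condConic`. Three facts carry the
argument.

Conditioning is Lipschitz (`near_condConic`). For a morphism W → Z, the diagram conditioned on an
atom of Z is a mixture of diagrams conditioned on its preimages in W. A weak law of large numbers
(`near_conic_of_mixture`) replaces many copies of a mixture by a conic combination, at a cost linear
in the entropy loss of W → Z.

Conditioning is additive under tensor products (`near_condConic_tensor`). With the Lipschitz bound,
a quasi-linear sequence gives conditioned combinations that are additive up to an admissible defect.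

Such combinations, divided by n, form a Cauchy sequence, by a dyadic argument
(`near_nsmul_of_defect`). A slow diagonal choice gives a limit that is itself quasi-linear
(`exists_near_limit`). -/

noncomputable section

namespace FinProb

/-! ### Entropy of random variables on a finite probability space -/

open Classical in
/-- The probability that the random variable `f` takes the value `s`. -/
def mass (X : FinProb) {S : Type*} (f : X.carrier → S) (s : S) : ℝ :=
  ∑ a with f a = s, X.weight a

/-- The entropy of the random variable `f`. -/
def ent (X : FinProb) {S : Type*} (f : X.carrier → S) : ℝ :=
  ∑ a, X.weight a * -Real.log (X.mass f (f a))

section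
variable {X Y : FinProb} {S T R : Type*}

theorem mass_pos (f : X.carrier → S) (a : X.carrier) : 0 < X.mass f (f a) := by
  classical
  exact Finset.sum_pos (fun a _ => X.weight_pos a)
    ⟨a, Finset.mem_filter.2 ⟨Finset.mem_univ _, rfl⟩⟩

theorem mass_le_one (f : X.carrier → S) (s : S) : X.mass f s ≤ 1 := by
  classical
  rw [← X.sum_weight]
  exact Finset.sum_le_sum_of_subset_of_nonneg (Finset.filter_subset _ _)
    fun a _ _ => (X.weight_pos a).le

theorem mass_mono {f : X.carrier → S} {g : X.carrier → T}
    (h : ∀ a b, f a = f b → g a = g b) (a : X.carrier) :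
    X.mass f (f a) ≤ X.mass g (g a) := by
  classical
  refine Finset.sum_le_sum_of_subset_of_nonneg ?_ fun a _ _ => (X.weight_pos a).le
  intro b hb
  exact Finset.mem_filter.2 ⟨Finset.mem_univ _, h _ _ (Finset.mem_filter.1 hb).2⟩

/-- The inequality holds atom by atom: the fibre of `f` through an atom lies in the fibre of `g`,
hence carries less mass and more information. -/
theorem ent_mono {f : X.carrier → S} {g : X.carrier → T}
    (h : ∀ a b, f a = f b → g a = g b) : X.ent g ≤ X.ent f := by
  refine Finset.sum_le_sum fun a _ => mul_le_mul_of_nonneg_left ?_ (X.weight_pos a).le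
  exact neg_le_neg (Real.log_le_log (mass_pos f a) (mass_mono h a))

theorem ent_congr {f : X.carrier → S} {g : X.carrier → T}
    (h : ∀ a b, f a = f b ↔ g a = g b) : X.ent f = X.ent g :=
  le_antisymm (ent_mono fun a b => (h a b).2) (ent_mono fun a b => (h a b).1)

theorem ent_nonneg (f : X.carrier → S) : 0 ≤ X.ent f :=
  Finset.sum_nonneg fun a _ => mul_nonneg (X.weight_pos a).le
    (neg_nonneg.2 (Real.log_nonpos (mass_pos f a).le (mass_le_one f _)))

theorem IsMeasurePreserving.sum_comp {f : X.carrier → Y.carrier}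
    (hf : IsMeasurePreserving X Y f) (φ : Y.carrier → ℝ) :
    ∑ a, X.weight a * φ (f a) = ∑ b, Y.weight b * φ b := by
  classical
  rw [← Finset.sum_fiberwise (s := Finset.univ) (g := f)]
  refine Finset.sum_congr rfl fun b _ => ?_
  rw [← hf b, Finset.sum_mul]
  refine Finset.sum_congr (by ext; simp) fun a ha => ?_
  rw [(Finset.mem_filter.1 ha).2]

theorem mass_eq_sum_ite [DecidableEq S] (f : X.carrier → S) (s : S) :
    X.mass f s = ∑ a, X.weight a * if f a = s then 1 else 0 := by
  simp only [mass, Finset.sum_filter, mul_ite, mul_one, mul_zero]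
  refine Finset.sum_congr rfl fun a _ => ?_
  split_ifs <;> rfl

theorem IsMeasurePreserving.mass_comp {f : X.carrier → Y.carrier}
    (hf : IsMeasurePreserving X Y f) (g : Y.carrier → S) (s : S) :
    X.mass (fun a => g (f a)) s = Y.mass g s := by
  classical
  rw [mass_eq_sum_ite, mass_eq_sum_ite]
  exact hf.sum_comp fun b => if g b = s then 1 else 0

theorem IsMeasurePreserving.ent_comp {f : X.carrier → Y.carrier}
    (hf : IsMeasurePreserving X Y f) (g : Y.carrier → S) :
    X.ent (fun a => g (f a)) = Y.ent g := by
  simp only [ent, hf.mass_comp]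
  exact hf.sum_comp fun b => -Real.log (Y.mass g (g b))

theorem ent_eq_entropy_of_injective {f : X.carrier → S} (hf : Function.Injective f) :
    X.ent f = X.entropy := by
  refine Finset.sum_congr rfl fun a _ => ?_
  have : X.mass f (f a) = X.weight a := by
    classical
    rw [mass_eq_sum_ite]
    simp [hf.eq_iff]
  rw [this, Real.negMulLog]
  ring

theorem IsMeasurePreserving.ent_eq {f : X.carrier → Y.carrier}
    (hf : IsMeasurePreserving X Y f) : X.ent f = Y.entropy :=
  (hf.ent_comp fun b => b).trans (ent_eq_entropy_of_injective fun _ _ h => h)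

theorem ent_le_entropy (f : X.carrier → S) : X.ent f ≤ X.entropy := by
  rw [← ent_eq_entropy_of_injective (X := X) (f := fun a => a) fun _ _ h => h]
  exact ent_mono fun a b h => by rw [h]

theorem IsMeasurePreserving.entropy_le {f : X.carrier → Y.carrier}
    (hf : IsMeasurePreserving X Y f) : Y.entropy ≤ X.entropy :=
  hf.ent_eq ▸ ent_le_entropy f

theorem IsMeasurePreserving.entropy_eq_of_injective {f : X.carrier → Y.carrier}
    (hf : IsMeasurePreserving X Y f) (hi : Function.Injective f) : X.entropy = Y.entropy :=
  (ent_eq_entropy_of_injective hi).symm.trans hf.ent_eq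

theorem entropy_eq_zero_of_subsingleton [Subsingleton X.carrier] : X.entropy = 0 := by
  have h1 : ∀ a, X.weight a = 1 := fun a => by
    rw [← X.sum_weight, Fintype.sum_eq_single a fun b hb => absurd (Subsingleton.elim b a) hb]
  simp [entropy, h1]

theorem IsMeasurePreserving.of_bijective {f : X.carrier → Y.carrier}
    (hf : Function.Bijective f) (h : ∀ a, Y.weight (f a) = X.weight a) :
    IsMeasurePreserving X Y f := by
  classical
  intro b
  obtain ⟨a, rfl⟩ := hf.2 b
  rw [h, Finset.sum_eq_single a]
  · intro c hc hca
    exact absurd (hf.1 (Finset.mem_filter.1 hc).2) hca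
  · intro ha
    exact (ha (Finset.mem_filter.2 ⟨Finset.mem_univ _, rfl⟩)).elim

theorem isMeasurePreserving_toImage {S : Type} (f : X.carrier → S) :
    IsMeasurePreserving X (X.image f) (fun a => ⟨f a, a, rfl⟩) := by
  classical
  rintro ⟨b, hb⟩
  change _ = ∑ a with f a = b, X.weight a
  refine Finset.sum_congr ?_ fun _ _ => rfl
  ext a
  simp only [Finset.mem_filter, Finset.mem_univ, true_and]
  exact Subtype.ext_iff

theorem entropy_image {S : Type} (f : X.carrier → S) : (X.image f).entropy = X.ent f := by
  rw [← (isMeasurePreserving_toImage f).ent_eq]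
  exact ent_congr fun a b => Subtype.ext_iff

/-- Strong subadditivity of entropy. -/
theorem ent_submodular (f : X.carrier → S) (g : X.carrier → T) (h : X.carrier → R) :
    X.ent (fun a => (f a, g a, h a)) + X.ent h ≤
      X.ent (fun a => (f a, h a)) + X.ent (fun a => (g a, h a)) := by
  classical
  set q := fun a => X.mass (fun a => (f a, g a, h a)) (f a, g a, h a) with hq
  set r := fun a => X.mass h (h a) with hr
  set s := fun a => X.mass (fun a => (f a, h a)) (f a, h a) with hs
  set t := fun a => X.mass (fun a => (g a, h a)) (g a, h a) with ht
  have q0 : ∀ a, 0 < q a := fun a => mass_pos (fun a => (f a, g a, h a)) a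
  have r0 : ∀ a, 0 < r a := fun a => mass_pos h a
  have s0 : ∀ a, 0 < s a := fun a => mass_pos (fun a => (f a, h a)) a
  have t0 : ∀ a, 0 < t a := fun a => mass_pos (fun a => (g a, h a)) a
  -- The expectation of s t / (q r) is the mass which the conditionally independent law P(f,h)
  -- P(g,h) / P(h) gives to the values (f,g,h) that occur, hence at most 1.
  have key : ∑ a, X.weight a * (s a * t a / (q a * r a)) ≤ 1 := by
    have e1 : ∀ a, X.weight a * (s a * t a / (q a * r a)) = ∑ b, ∑ c,
        X.weight b * X.weight c * (if f b = f a ∧ h b = h a ∧ g c = g a ∧ h c = h a then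
          X.weight a / (q a * r a) else 0) := by
      intro a
      have : X.weight a * (s a * t a / (q a * r a)) = s a * t a * (X.weight a / (q a * r a)) := by
        ring
      rw [this, hs, ht]
      simp only [mass_eq_sum_ite]
      rw [Finset.sum_mul_sum, Finset.sum_mul]
      refine Finset.sum_congr rfl fun b _ => ?_
      rw [Finset.sum_mul]
      refine Finset.sum_congr rfl fun c _ => ?_
      -- The double sum has replaced `s a` and `t a` by sums over their fibres; the two indicators
      -- multiply to the indicator of the conjunction.
      by_cases h1 : f b = f a ∧ h b = h a <;> by_cases h2 : g c = g a ∧ h c = h a <;>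
        simp [h1, h2]
    -- For fixed `b` and `c`, the compatible `a` form one fibre of (f,g,h), or none. The mass of
    -- that fibre cancels against `q`.
    have e2 : ∀ b c, ∑ a, (if f b = f a ∧ h b = h a ∧ g c = g a ∧ h c = h a then
        X.weight a / (q a * r a) else 0) ≤ if h c = h b then 1 / r b else 0 := by
      intro b c
      by_cases hne : ∃ a, f b = f a ∧ h b = h a ∧ g c = g a ∧ h c = h a
      · obtain ⟨a₀, h1, h2, h3, h4⟩ := hne
        rw [if_pos (h4.trans h2.symm)]
        have : ∀ a, (if f b = f a ∧ h b = h a ∧ g c = g a ∧ h c = h a then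
            X.weight a / (q a * r a) else 0) =
            (X.weight a * if (f a, g a, h a) = (f a₀, g a₀, h a₀) then 1 else 0) *
              (1 / (q a₀ * r a₀)) := by
          intro a
          by_cases hc : (f a, g a, h a) = (f a₀, g a₀, h a₀)
          · obtain ⟨i1, i2, i3⟩ : f a = f a₀ ∧ g a = g a₀ ∧ h a = h a₀ := by simpa using hc
            have iq : q a = q a₀ := by simp only [hq, i1, i2, i3]
            have ir : r a = r a₀ := by simp only [hr, i3]
            rw [if_pos hc, if_pos ⟨h1.trans i1.symm, h2.trans i3.symm, h3.trans i2.symm,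
              h4.trans i3.symm⟩, iq, ir]
            ring
          · rw [if_neg hc, if_neg]
            · ring
            · rintro ⟨i1, i2, i3, i4⟩
              apply hc
              rw [← i1, ← i2, ← i3, h1, h2, h3]
        rw [Finset.sum_congr rfl fun a _ => this a, ← Finset.sum_mul, ← mass_eq_sum_ite]
        have ir : r a₀ = r b := by simp only [hr, h2]
        change q a₀ * _ ≤ _
        rw [ir]
        have := (q0 a₀).ne'
        have := (r0 b).ne'
        apply le_of_eq
        field_simp
      · rw [Finset.sum_eq_zero]
        · split_ifs
          · exact (div_pos one_pos (r0 b)).le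
          · exact le_rfl
        · intro a _
          rw [if_neg fun hc => hne ⟨a, hc⟩]
    calc ∑ a, X.weight a * (s a * t a / (q a * r a))
        = ∑ b, ∑ c, X.weight b * X.weight c *
          ∑ a, (if f b = f a ∧ h b = h a ∧ g c = g a ∧ h c = h a then
            X.weight a / (q a * r a) else 0) := by
          rw [Finset.sum_congr rfl fun a _ => e1 a, Finset.sum_comm]
          refine Finset.sum_congr rfl fun b _ => ?_
          rw [Finset.sum_comm]
          exact Finset.sum_congr rfl fun c _ => (Finset.mul_sum _ _ _).symm
      _ ≤ ∑ b, ∑ c, X.weight b * X.weight c * if h c = h b then 1 / r b else 0 :=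
          Finset.sum_le_sum fun b _ => Finset.sum_le_sum fun c _ =>
            mul_le_mul_of_nonneg_left (e2 b c) (mul_pos (X.weight_pos b) (X.weight_pos c)).le
      _ = ∑ b, X.weight b := by
          refine Finset.sum_congr rfl fun b _ => ?_
          have : ∀ c, X.weight b * X.weight c * (if h c = h b then 1 / r b else 0) =
              (X.weight c * if h c = h b then 1 else 0) * (X.weight b / r b) := by
            intro c
            split_ifs <;> ring
          rw [Finset.sum_congr rfl fun c _ => this c, ← Finset.sum_mul, ← mass_eq_sum_ite]
          exact mul_div_cancel₀ _ (r0 b).ne'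
      _ = 1 := X.sum_weight
  -- This is Gibbs' inequality, log y ≤ y - 1, at y = s t / (q r); by `key` the right-hand sides sum
  -- to at most 0.
  have hlog : ∀ a, X.weight a * -Real.log (q a) + X.weight a * -Real.log (r a) -
      X.weight a * -Real.log (s a) - X.weight a * -Real.log (t a) ≤
      X.weight a * (s a * t a / (q a * r a)) - X.weight a := by
    intro a
    have h1 := Real.log_le_sub_one_of_pos (div_pos (mul_pos (s0 a) (t0 a)) (mul_pos (q0 a) (r0 a)))
    rw [Real.log_div (mul_pos (s0 a) (t0 a)).ne' (mul_pos (q0 a) (r0 a)).ne',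
      Real.log_mul (s0 a).ne' (t0 a).ne', Real.log_mul (q0 a).ne' (r0 a).ne'] at h1
    nlinarith [X.weight_pos a]
  have := Finset.sum_le_sum fun a (_ : a ∈ Finset.univ) => hlog a
  simp only [Finset.sum_sub_distrib, Finset.sum_add_distrib, X.sum_weight] at this
  change (∑ a, X.weight a * -Real.log (q a)) + (∑ a, X.weight a * -Real.log (r a)) ≤
    (∑ a, X.weight a * -Real.log (s a)) + ∑ a, X.weight a * -Real.log (t a)
  linarith

/-- If `h` is a function of `f` and of `g`, then `H(f, g) + H(h) ≤ H(f) + H(g)`. -/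
theorem ent_pair_add_le {f : X.carrier → S} {g : X.carrier → T} {h : X.carrier → R}
    (hf : ∀ a b, f a = f b → h a = h b) (hg : ∀ a b, g a = g b → h a = h b) :
    X.ent (fun a => (f a, g a)) + X.ent h ≤ X.ent f + X.ent g := by
  have h1 := ent_submodular f g h
  have h2 : X.ent (fun a => (f a, g a)) ≤ X.ent (fun a => (f a, g a, h a)) :=
    ent_mono fun a b hab => by simp_all
  have h3 : X.ent (fun a => (f a, h a)) ≤ X.ent f :=
    ent_mono fun a b hab => by rw [hab, hf a b hab]
  have h4 : X.ent (fun a => (g a, h a)) ≤ X.ent g :=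
    ent_mono fun a b hab => by rw [hab, hg a b hab]
  linarith

/-- Replacing `f` by a coarser variable `f'` decreases `H(f, g)` by at most `H(f) - H(f')`. -/
theorem ent_pair_coarsen {f : X.carrier → S} {f' : X.carrier → R} (g : X.carrier → T)
    (hf : ∀ a b, f a = f b → f' a = f' b) :
    X.ent (fun a => (f a, g a)) + X.ent f' ≤ X.ent f + X.ent (fun a => (f' a, g a)) := by
  have h1 := ent_pair_add_le (X := X) (f := f) (g := fun a => (f' a, g a)) (h := f') hf
    (fun a b hab => (Prod.ext_iff.1 hab).1)
  have h2 : X.ent (fun a => (f a, g a)) ≤ X.ent (fun a => (f a, f' a, g a)) :=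
    ent_mono fun a b hab => by simp_all
  linarith

end

/-! ### Tensor products -/

theorem sum_tensor {X Y : FinProb} (φ : X.carrier → Y.carrier → ℝ) :
    ∑ a : (X.tensor Y).carrier, (X.tensor Y).weight a * φ a.1 a.2 =
      ∑ a, X.weight a * ∑ b, Y.weight b * φ a b := by
  change ∑ a : X.carrier × Y.carrier, X.weight a.1 * Y.weight a.2 * φ a.1 a.2 = _
  rw [Fintype.sum_prod_type]
  refine Finset.sum_congr rfl fun a _ => ?_
  rw [Finset.mul_sum]
  exact Finset.sum_congr rfl fun b _ => by ring

theorem mass_tensor {X Y : FinProb} {S T : Type*} (f : X.carrier → S) (g : Y.carrier → T)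
    (s : S) (t : T) :
    (X.tensor Y).mass (fun a => (f a.1, g a.2)) (s, t) = X.mass f s * Y.mass g t := by
  classical
  simp only [mass_eq_sum_ite]
  rw [sum_tensor fun a b => if (f a, g b) = (s, t) then 1 else 0, Finset.sum_mul]
  refine Finset.sum_congr rfl fun a _ => ?_
  rw [mul_assoc, Finset.mul_sum (a := if f a = s then (1 : ℝ) else 0)]
  congr 1
  refine Finset.sum_congr rfl fun b _ => ?_
  by_cases h1 : f a = s <;> by_cases h2 : g b = t <;> simp [h1, h2]

theorem ent_tensor {X Y : FinProb} {S T : Type*} (f : X.carrier → S) (g : Y.carrier → T) :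
    (X.tensor Y).ent (fun a => (f a.1, g a.2)) = X.ent f + Y.ent g := by
  have h : ∀ a : (X.tensor Y).carrier,
      -Real.log ((X.tensor Y).mass (fun a => (f a.1, g a.2)) (f a.1, g a.2)) =
        -Real.log (X.mass f (f a.1)) + -Real.log (Y.mass g (g a.2)) := by
    intro a
    rw [mass_tensor, Real.log_mul (mass_pos f a.1).ne' (mass_pos g a.2).ne']
    ring
  unfold ent
  rw [Finset.sum_congr rfl fun a _ => by rw [h a],
    sum_tensor fun a b => -Real.log (X.mass f (f a)) + -Real.log (Y.mass g (g b))]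
  simp only [mul_add, Finset.sum_add_distrib, ← Finset.sum_mul, Y.sum_weight, one_mul,
    X.sum_weight]

theorem entropy_tensor (X Y : FinProb) : (X.tensor Y).entropy = X.entropy + Y.entropy := by
  have h := ent_tensor (X := X) (Y := Y) (fun a => a) (fun a => a)
  rw [ent_eq_entropy_of_injective fun _ _ h => h, ent_eq_entropy_of_injective fun _ _ h => h,
    ent_eq_entropy_of_injective] at h
  · exact h
  · exact fun _ _ h => h

theorem isMeasurePreserving_fst (X Y : FinProb) :
    IsMeasurePreserving (X.tensor Y) X (fun a => a.1) := by
  classical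
  intro b
  change (X.tensor Y).mass (fun a => a.1) b = _
  rw [mass_eq_sum_ite, sum_tensor fun a _ => if a = b then 1 else 0]
  simp [Y.sum_weight]

theorem isMeasurePreserving_snd (X Y : FinProb) :
    IsMeasurePreserving (X.tensor Y) Y (fun a => a.2) := by
  classical
  intro b
  change (X.tensor Y).mass (fun a => a.2) b = _
  rw [mass_eq_sum_ite, sum_tensor fun _ c => if c = b then 1 else 0]
  simp [← Finset.sum_mul, X.sum_weight]

/-! ### Conditionally independent couplings -/

/-- The fibre product of two probability spaces over a third one: the coupling which is
independent conditionally on the values in `Y`. -/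
def fiberProduct {A B Y : FinProb} (f : A.carrier → Y.carrier) (g : B.carrier → Y.carrier)
    (_hf : IsMeasurePreserving A Y f) (hg : IsMeasurePreserving B Y g) : FinProb where
  carrier := {p : A.carrier × B.carrier // f p.1 = g p.2}
  fintypeCarrier := Fintype.ofFinite _
  weight p := A.weight p.1.1 * B.weight p.1.2 / Y.weight (f p.1.1)
  weight_pos p := div_pos (mul_pos (A.weight_pos _) (B.weight_pos _)) (Y.weight_pos _)
  sum_weight := by
    classical
    let : Fintype {p : A.carrier × B.carrier // f p.1 = g p.2} := Fintype.ofFinite _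
    rw [← Finset.sum_subtype (Finset.univ.filter fun p : A.carrier × B.carrier => f p.1 = g p.2)
      (by simp) (fun p => A.weight p.1 * B.weight p.2 / Y.weight (f p.1)), Finset.sum_filter,
      Fintype.sum_prod_type]
    rw [← A.sum_weight]
    refine Finset.sum_congr rfl fun a _ => ?_
    have h : ∀ b, (if f a = g b then A.weight a * B.weight b / Y.weight (f a) else 0) =
        (B.weight b * if g b = f a then 1 else 0) * (A.weight a / Y.weight (f a)) := by
      intro b
      by_cases h : f a = g b
      · rw [if_pos h, if_pos h.symm]; ring
      · rw [if_neg h, if_neg (Ne.symm h)]; ring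
    rw [Finset.sum_congr rfl fun b _ => h b, ← Finset.sum_mul, ← mass_eq_sum_ite]
    rw [show B.mass g (f a) = Y.weight (f a) from hg _]
    exact mul_div_cancel₀ _ (Y.weight_pos _).ne'

section
variable {A B Y : FinProb} {f : A.carrier → Y.carrier} {g : B.carrier → Y.carrier}
    (hf : IsMeasurePreserving A Y f) (hg : IsMeasurePreserving B Y g)

/-- Sorting the pairs by their common value in `Y` makes the formula symmetric in the two factors,
so both marginals can be read off from it. -/
theorem sum_fiberProduct (φ : A.carrier → B.carrier → ℝ) :
    ∑ p : (fiberProduct f g hf hg).carrier, (fiberProduct f g hf hg).weight p * φ p.1.1 p.1.2 =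
      ∑ y, (1 / Y.weight y) * ((∑ a, ∑ b, open Classical in if f a = y ∧ g b = y then
        A.weight a * B.weight b * φ a b else 0)) := by
  classical
  let : Fintype {p : A.carrier × B.carrier // f p.1 = g p.2} := Fintype.ofFinite _
  change ∑ p : {p : A.carrier × B.carrier // f p.1 = g p.2},
    A.weight p.1.1 * B.weight p.1.2 / Y.weight (f p.1.1) * φ p.1.1 p.1.2 = _
  rw [← Finset.sum_subtype (Finset.univ.filter fun p : A.carrier × B.carrier => f p.1 = g p.2)
    (by simp) (fun p => A.weight p.1 * B.weight p.2 / Y.weight (f p.1) * φ p.1 p.2),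
    Finset.sum_filter, Fintype.sum_prod_type]
  simp only [Finset.mul_sum]
  conv_rhs => rw [Finset.sum_comm]
  refine Finset.sum_congr rfl fun a _ => ?_
  conv_rhs => rw [Finset.sum_comm]
  refine Finset.sum_congr rfl fun b _ => ?_
  rw [Fintype.sum_eq_single (f a)]
  · by_cases h : f a = g b
    · rw [if_pos h, if_pos ⟨rfl, h.symm⟩]; ring
    · rw [if_neg h, if_neg fun h' => h h'.2.symm]; ring
  · intro y hy
    rw [if_neg fun h' => hy h'.1.symm, mul_zero]

theorem isMeasurePreserving_fiberProduct_fst :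
    IsMeasurePreserving (fiberProduct f g hf hg) A (fun p => p.1.1) := by
  classical
  intro a₀
  change (fiberProduct f g hf hg).mass (fun p => p.1.1) a₀ = _
  rw [mass_eq_sum_ite, sum_fiberProduct hf hg fun a _ => if a = a₀ then 1 else 0]
  have : ∀ y, ∑ a, ∑ b, (if f a = y ∧ g b = y then
      A.weight a * B.weight b * (if a = a₀ then 1 else 0) else 0) =
      if f a₀ = y then A.weight a₀ * Y.weight y else 0 := by
    intro y
    rw [Fintype.sum_eq_single a₀]
    · by_cases h : f a₀ = y
      · rw [if_pos h, ← show B.mass g y = Y.weight y from hg y, mass_eq_sum_ite, Finset.mul_sum]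
        refine Finset.sum_congr rfl fun b _ => ?_
        by_cases h' : g b = y <;> simp [h, h']
      · simp [h]
    · intro a ha
      simp [ha]
  simp only [this]
  rw [Fintype.sum_eq_single (f a₀)]
  · rw [if_pos rfl]
    have := (Y.weight_pos (f a₀)).ne'
    field_simp
  · intro y hy
    rw [if_neg hy.symm, mul_zero]

theorem isMeasurePreserving_fiberProduct_snd :
    IsMeasurePreserving (fiberProduct f g hf hg) B (fun p => p.1.2) := by
  classical
  intro b₀
  change (fiberProduct f g hf hg).mass (fun p => p.1.2) b₀ = _
  rw [mass_eq_sum_ite, sum_fiberProduct hf hg fun _ b => if b = b₀ then 1 else 0]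
  have : ∀ y, ∑ a, ∑ b, (if f a = y ∧ g b = y then
      A.weight a * B.weight b * (if b = b₀ then 1 else 0) else 0) =
      if g b₀ = y then B.weight b₀ * Y.weight y else 0 := by
    intro y
    rw [Finset.sum_comm, Fintype.sum_eq_single b₀]
    · by_cases h : g b₀ = y
      · rw [if_pos h, ← show A.mass f y = Y.weight y from hf y, mass_eq_sum_ite, Finset.mul_sum]
        refine Finset.sum_congr rfl fun b _ => ?_
        by_cases h' : f b = y <;> simp [h, h', mul_comm]
      · simp [h]
    · intro a ha
      simp [ha]
  simp only [this]
  rw [Fintype.sum_eq_single (g b₀)]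
  · rw [if_pos rfl]
    have := (Y.weight_pos (g b₀)).ne'
    field_simp
  · intro y hy
    rw [if_neg hy.symm, mul_zero]

end

/-! ### Mixtures -/

/-- The disjoint union of the spaces `D s`, with total weights given by `P`. -/
def mixture (P : FinProb) (D : P.carrier → FinProb) : FinProb where
  carrier := Σ s, (D s).carrier
  weight a := P.weight a.1 * (D a.1).weight a.2
  weight_pos a := mul_pos (P.weight_pos _) ((D a.1).weight_pos _)
  sum_weight := by
    rw [Fintype.sum_sigma]
    simp only [← Finset.mul_sum, sum_weight, mul_one]

theorem sum_mixture {P : FinProb} {D : P.carrier → FinProb} (φ : ∀ s, (D s).carrier → ℝ) :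
    ∑ a : (mixture P D).carrier, (mixture P D).weight a * φ a.1 a.2 =
      ∑ s, P.weight s * ∑ b, (D s).weight b * φ s b := by
  change ∑ a : (Σ s, (D s).carrier), P.weight a.1 * (D a.1).weight a.2 * φ a.1 a.2 = _
  rw [Fintype.sum_sigma]
  refine Finset.sum_congr rfl fun s _ => ?_
  rw [Finset.mul_sum]
  exact Finset.sum_congr rfl fun b _ => by ring

theorem mass_mixture {P : FinProb} {D : P.carrier → FinProb} {S : Type*}
    (f : ∀ s, (D s).carrier → S) (t : S) :
    (mixture P D).mass (fun a => f a.1 a.2) t = ∑ s, P.weight s * (D s).mass (f s) t := by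
  classical
  simp only [mass_eq_sum_ite]
  exact sum_mixture fun s b => if f s b = t then 1 else 0

/-- A value has mass at least P(s) times its mass in the component `s`. Taking -log and averaging
bounds the information by that of `s` plus that inside `D s`. -/
theorem ent_mixture_le {P : FinProb} {D : P.carrier → FinProb} {S : Type*}
    (f : ∀ s, (D s).carrier → S) :
    (mixture P D).ent (fun a => f a.1 a.2) ≤
      P.entropy + ∑ s, P.weight s * (D s).ent (f s) := by
  have h0 : ∀ s t, 0 ≤ (D s).mass (f s) t := fun s t =>
    Finset.sum_nonneg fun b _ => ((D s).weight_pos b).le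
  unfold ent
  rw [sum_mixture fun s b => -Real.log ((mixture P D).mass (fun a => f a.1 a.2) (f s b)), entropy,
    ← Finset.sum_add_distrib]
  refine Finset.sum_le_sum fun s _ => ?_
  have h1 : ∀ b, (D s).weight b *
      -Real.log ((mixture P D).mass (fun a => f a.1 a.2) (f s b)) ≤
      (D s).weight b * (-Real.log (P.weight s)) +
        (D s).weight b * -Real.log ((D s).mass (f s) (f s b)) := by
    intro b
    rw [← mul_add]
    refine mul_le_mul_of_nonneg_left ?_ ((D s).weight_pos b).le
    rw [← neg_add, ← Real.log_mul (P.weight_pos s).ne' (mass_pos _ b).ne']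
    refine neg_le_neg (Real.log_le_log (mul_pos (P.weight_pos s) (mass_pos _ b)) ?_)
    rw [mass_mixture]
    exact Finset.single_le_sum (f := fun s => P.weight s * (D s).mass (f s) _)
      (fun s _ => mul_nonneg (P.weight_pos s).le (h0 s _)) (Finset.mem_univ s)
  have h2 := Finset.sum_le_sum fun b (_ : b ∈ Finset.univ) => h1 b
  rw [Finset.sum_add_distrib, ← Finset.sum_mul, (D s).sum_weight] at h2
  have h3 := mul_le_mul_of_nonneg_left h2 (P.weight_pos s).le
  rw [Real.negMulLog]
  linarith

/-! ### Conditioning -/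

section
variable {X : FinProb}

theorem sum_condition (s : Set X.carrier) (hs : s.Nonempty) (φ : X.carrier → ℝ) :
    ∑ a : (X.condition s hs).carrier, (X.condition s hs).weight a * φ a.1 =
      (∑ a, open Classical in if a ∈ s then X.weight a * φ a else 0) /
        (∑ a, open Classical in if a ∈ s then X.weight a else 0) := by
  classical
  let : Fintype s := Fintype.ofFinite _
  change ∑ a : s, X.weight a.1 / (∑ b with b ∈ s, X.weight b) * φ a.1 = _
  rw [← Finset.sum_subtype (Finset.univ.filter fun a => a ∈ s)
    (by simp) (fun a => X.weight a / (∑ b with b ∈ s, X.weight b) * φ a), Finset.sum_div,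
    Finset.sum_filter, Finset.sum_filter]
  refine Finset.sum_congr rfl fun a _ => ?_
  by_cases h : a ∈ s
  · simp only [h, if_true]; ring
  · simp only [h, if_false]; ring

variable {Y : FinProb} {g : X.carrier → Y.carrier}

/-- Sums against the distribution conditioned on `g = y`. -/
theorem IsMeasurePreserving.sum_condition (hg : IsMeasurePreserving X Y g) (y : Y.carrier)
    (hs : {x | g x = y}.Nonempty) (φ : X.carrier → ℝ) :
    Y.weight y * ∑ a : (X.condition {x | g x = y} hs).carrier,
        (X.condition {x | g x = y} hs).weight a * φ a.1 =
      ∑ a, open Classical in if g a = y then X.weight a * φ a else 0 := by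
  classical
  rw [FinProb.sum_condition]
  have : (∑ a, if a ∈ {x | g x = y} then X.weight a else 0) = Y.weight y := by
    rw [← hg y, Finset.sum_filter]
    rfl
  rw [this]
  exact mul_div_cancel₀ _ (Y.weight_pos y).ne'

theorem IsMeasurePreserving.mass_condition (hg : IsMeasurePreserving X Y g) (y : Y.carrier)
    (hs : {x | g x = y}.Nonempty) {S : Type*} (f : X.carrier → S) (t : S) :
    Y.weight y * (X.condition {x | g x = y} hs).mass (fun a => f a.1) t =
      X.mass (fun a => (f a, g a)) (t, y) := by
  classical
  rw [mass_eq_sum_ite, hg.sum_condition y hs (fun a => if f a = t then 1 else 0), mass_eq_sum_ite]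
  refine Finset.sum_congr rfl fun a _ => ?_
  by_cases h1 : g a = y <;> by_cases h2 : f a = t <;> simp [h1, h2]

/-- The chain rule for entropy. -/
theorem IsMeasurePreserving.sum_ent_condition (hg : IsMeasurePreserving X Y g)
    (hs : ∀ y, {x | g x = y}.Nonempty) {S : Type*} (f : X.carrier → S) :
    ∑ y, Y.weight y * (X.condition {x | g x = y} (hs y)).ent (fun a => f a.1) =
      X.ent (fun a => (f a, g a)) - Y.entropy := by
  classical
  have h1 : ∀ y, Y.weight y * (X.condition {x | g x = y} (hs y)).ent (fun a => f a.1) =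
      ∑ a, if g a = y then X.weight a *
        (-Real.log (X.mass (fun a => (f a, g a)) (f a, g a)) + Real.log (Y.weight (g a)))
        else 0 := by
    intro y
    unfold ent
    rw [hg.sum_condition y (hs y) fun a =>
      -Real.log ((X.condition {x | g x = y} (hs y)).mass (fun a => f a.1) (f a))]
    refine Finset.sum_congr rfl fun a _ => ?_
    by_cases h : g a = y
    · rw [if_pos h, if_pos h]
      subst h
      have h2 := hg.mass_condition (g a) (hs _) f (f a)
      rw [← h2, Real.log_mul (Y.weight_pos _).ne'
        (mass_pos (X := X.condition {x | g x = g a} (hs _)) (fun a => f a.1) ⟨a, rfl⟩).ne']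
      ring
    · rw [if_neg h, if_neg h]
  rw [Finset.sum_congr rfl fun y _ => h1 y, Finset.sum_comm]
  simp only [Finset.sum_ite_eq, Finset.mem_univ, if_true, mul_add, Finset.sum_add_distrib]
  rw [hg.sum_comp fun b => Real.log (Y.weight b), sub_eq_add_neg]
  congr 1
  rw [entropy, ← Finset.sum_neg_distrib]
  exact Finset.sum_congr rfl fun y _ => by rw [Real.negMulLog]; ring

theorem IsMeasurePreserving.sum_entropy_condition (hg : IsMeasurePreserving X Y g)
    (hs : ∀ y, {x | g x = y}.Nonempty) :
    ∑ y, Y.weight y * (X.condition {x | g x = y} (hs y)).entropy = X.entropy - Y.entropy := by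
  have h := hg.sum_ent_condition hs (fun a => a)
  rw [ent_eq_entropy_of_injective (f := fun a => (a, g a)) fun a b h => (Prod.ext_iff.1 h).1] at h
  rw [← h]
  refine Finset.sum_congr rfl fun y _ => ?_
  rw [ent_eq_entropy_of_injective]
  exact fun a b h => Subtype.ext h

end

end FinProb

namespace FinProb

theorem IsMeasurePreserving.of_comp {X Y T : FinProb} {f : X.carrier → Y.carrier}
    {g : Y.carrier → T.carrier} (hf : IsMeasurePreserving X Y f)
    (hgf : IsMeasurePreserving X T (fun a => g (f a))) : IsMeasurePreserving Y T g := by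
  intro c
  change Y.mass g c = _
  rw [← hf.mass_comp]
  exact hgf c

/-- The one-point probability space. -/
def point : FinProb where
  carrier := Unit
  weight _ := 1
  weight_pos _ := one_pos
  sum_weight := by simp

theorem isMeasurePreserving_point (X : FinProb) :
    IsMeasurePreserving X point (fun _ => ()) := by
  classical
  intro b
  change X.mass (fun _ => ()) () = 1
  rw [mass_eq_sum_ite]
  simp [X.sum_weight]

end FinProb

open FinProb

/-! ### The intrinsic entropy distance as a pseudometric on diagrams -/

section Diagrams

variable {G : Type*} [SemilatticeInf G]

/-- The diagram of images of a single probability space under a compatible family of maps. -/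
def ofMaps (Ω : FinProb) {S : G → Type} (π : ∀ i, Ω.carrier → S i)
    (h : ∀ i j, i ≤ j → ∀ a b, π i a = π i b → π j a = π j b) : G ⥤ FinProb where
  obj i := Ω.image (π i)
  -- The arrow is evaluated on a chosen preimage; `h` makes the value independent of the choice.
  map {i j} f := ⟨fun b => ⟨π j b.2.choose, _, rfl⟩, by
    refine (isMeasurePreserving_toImage (π i)).of_comp ?_
    have : (fun a => (⟨π j (⟨a, rfl⟩ : π i a ∈ Set.range (π i)).choose, _, rfl⟩ :
        Set.range (π j))) = fun a => ⟨π j a, a, rfl⟩ := by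
      funext a
      exact Subtype.ext (h i j (leOfHom f) _ _ (⟨a, rfl⟩ : π i a ∈ Set.range (π i)).choose_spec)
    change IsMeasurePreserving Ω (Ω.image (π j)) (fun a =>
      ⟨π j (⟨a, rfl⟩ : π i a ∈ Set.range (π i)).choose, _, rfl⟩)
    rw [this]
    exact isMeasurePreserving_toImage (π j)⟩
  map_id i := Hom.ext (funext fun b => Subtype.ext b.2.choose_spec)
  map_comp {i j k} f g := Hom.ext (funext fun b => Subtype.ext
    (h j k (leOfHom g) _ _ (⟨b.2.choose, rfl⟩ : π j b.2.choose ∈ Set.range (π j)).choose_spec).symm)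

theorem ofMaps_map_toFun (Ω : FinProb) {S : G → Type} (π : ∀ i, Ω.carrier → S i)
    (h : ∀ i j, i ≤ j → ∀ a b, π i a = π i b → π j a = π j b) {i j : G} (f : i ⟶ j)
    (a : Ω.carrier) :
    Hom.toFun ((ofMaps Ω π h).map f) ⟨π i a, a, rfl⟩ = ⟨π j a, a, rfl⟩ :=
  Subtype.ext (h i j (leOfHom f) _ _ (⟨a, rfl⟩ : π i a ∈ Set.range (π i)).choose_spec)

/-- The intrinsic entropy distance as a real number. -/
def kd (X Y : G ⥤ FinProb) : ℝ := (ikd X Y).toReal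

theorem kd_nonneg (X Y : G ⥤ FinProb) : 0 ≤ kd X Y := ENNReal.toReal_nonneg

theorem naturality_toFun {X Y : G ⥤ FinProb} (f : X ⟶ Y) {i j : G} (k : i ⟶ j)
    (a : (X.obj i).carrier) :
    Hom.toFun (Y.map k) (Hom.toFun (f.app i) a) = Hom.toFun (f.app j) (Hom.toFun (X.map k) a) :=
  (congrArg (fun h => Hom.toFun h a) (f.naturality k)).symm

theorem ikd_comm (X Y : G ⥤ FinProb) : ikd X Y = ikd Y X := by
  have : ∀ X Y : G ⥤ FinProb, ikd X Y ≤ ikd Y X := by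
    intro X Y
    refine le_iInf fun Z => le_iInf fun f => le_iInf fun g => ?_
    refine iInf_le_of_le Z (iInf_le_of_le g (iInf_le_of_le f (le_of_eq ?_)))
    rw [fanDist, fanDist, add_comm]
  exact le_antisymm (this X Y) (this Y X)

theorem kd_comm (X Y : G ⥤ FinProb) : kd X Y = kd Y X := by rw [kd, kd, ikd_comm]

section Bot
variable [OrderBot G]

theorem fromInitial_app {X Y : G ⥤ FinProb} (f : X ⟶ Y) (i : G) (a : (X.obj ⊥).carrier) :
    fromInitial Y i (Hom.toFun (f.app ⊥) a) = Hom.toFun (f.app i) (fromInitial X i a) :=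
  naturality_toFun f _ a

theorem isMeasurePreserving_fromInitial (X : G ⥤ FinProb) (i : G) :
    IsMeasurePreserving (X.obj ⊥) (X.obj i) (fromInitial X i) :=
  Hom.preserving _

theorem jointEntropy_eq (X : G ⥤ FinProb) (x u : G) :
    jointEntropy X x u = (X.obj ⊥).ent (fun z => (fromInitial X x z, fromInitial X u z)) :=
  entropy_image _

/-- The two variables are coarsened one after the other, and each replacement costs at most the
entropy lost at its own index. -/
theorem jointEntropy_le_of_hom {X Y : G ⥤ FinProb} (f : X ⟶ Y) (x u : G) :
    jointEntropy X x u ≤ jointEntropy Y x u + ((X.obj x).entropy - (Y.obj x).entropy) +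
      ((X.obj u).entropy - (Y.obj u).entropy) := by
  have hp := Hom.preserving (f.app ⊥)
  rw [jointEntropy_eq, jointEntropy_eq, ← hp.ent_comp,
    ← (isMeasurePreserving_fromInitial X x).ent_eq, ← (isMeasurePreserving_fromInitial X u).ent_eq,
    ← (hp.comp (isMeasurePreserving_fromInitial Y x)).ent_eq,
    ← (hp.comp (isMeasurePreserving_fromInitial Y u)).ent_eq]
  simp only [fromInitial_app]
  have h1 := ent_pair_coarsen (X := X.obj ⊥) (f := fromInitial X x)
    (f' := fun a => Hom.toFun (f.app x) (fromInitial X x a)) (fromInitial X u)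
    (fun a b hab => by rw [hab])
  have h2 := ent_pair_coarsen (X := X.obj ⊥) (f := fromInitial X u)
    (f' := fun a => Hom.toFun (f.app u) (fromInitial X u a))
    (fun a => Hom.toFun (f.app x) (fromInitial X x a))
    (fun a b hab => by rw [hab])
  have h3 : ∀ {S T : Type} (s : (X.obj ⊥).carrier → S) (t : (X.obj ⊥).carrier → T),
      (X.obj ⊥).ent (fun a => (s a, t a)) = (X.obj ⊥).ent (fun a => (t a, s a)) :=
    fun s t => ent_congr fun a b => by simp [Prod.ext_iff, and_comm]
  rw [h3] at h2
  rw [h3 (fun a => Hom.toFun (f.app u) (fromInitial X u a))] at h2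
  linarith

theorem jointEntropy_ge_of_hom {X Y : G ⥤ FinProb} (f : X ⟶ Y) (x u : G) :
    jointEntropy Y x u ≤ jointEntropy X x u := by
  rw [jointEntropy_eq, jointEntropy_eq, ← (Hom.preserving (f.app ⊥)).ent_comp]
  simp only [fromInitial_app]
  exact ent_mono fun a b hab =>
    congrArg₂ Prod.mk (congrArg (Hom.toFun (f.app x)) (Prod.mk.inj hab).1)
      (congrArg (Hom.toFun (f.app u)) (Prod.mk.inj hab).2)

end Bot

section Fin
variable [Fintype G]

/-- The absolute values disappear because measure-preserving maps do not increase entropy. -/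
theorem fanDist_eq {X Y Z : G ⥤ FinProb} (f : Z ⟶ X) (g : Z ⟶ Y) :
    fanDist f g = ∑ i, (2 * (Z.obj i).entropy - (X.obj i).entropy - (Y.obj i).entropy) := by
  rw [fanDist, finsum_eq_sum_of_fintype, finsum_eq_sum_of_fintype, ← Finset.sum_add_distrib]
  refine Finset.sum_congr rfl fun i _ => ?_
  rw [abs_of_nonneg (sub_nonneg.2 (Hom.preserving (f.app i)).entropy_le),
    abs_of_nonneg (sub_nonneg.2 (Hom.preserving (g.app i)).entropy_le)]
  ring

theorem fanDist_nonneg {X Y Z : G ⥤ FinProb} (f : Z ⟶ X) (g : Z ⟶ Y) : 0 ≤ fanDist f g := by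
  rw [fanDist_eq]
  refine Finset.sum_nonneg fun i _ => ?_
  linarith [(Hom.preserving (f.app i)).entropy_le, (Hom.preserving (g.app i)).entropy_le]

theorem kd_le_of_fan {X Y Z : G ⥤ FinProb} (f : Z ⟶ X) (g : Z ⟶ Y) :
    kd X Y ≤ ∑ i, (2 * (Z.obj i).entropy - (X.obj i).entropy - (Y.obj i).entropy) := by
  rw [← fanDist_eq f g]
  refine ENNReal.toReal_le_of_le_ofReal (fanDist_nonneg f g) ?_
  exact iInf_le_of_le Z (iInf_le_of_le f (iInf_le _ g))

theorem kd_self (X : G ⥤ FinProb) : kd X X = 0 := by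
  refine le_antisymm ((kd_le_of_fan (𝟙 X) (𝟙 X)).trans_eq ?_) (kd_nonneg _ _)
  exact Finset.sum_eq_zero fun i _ => by ring

theorem kd_le_of_hom {X Y : G ⥤ FinProb} (f : X ⟶ Y) :
    kd X Y ≤ ∑ i, ((X.obj i).entropy - (Y.obj i).entropy) := by
  refine (kd_le_of_fan (𝟙 X) f).trans_eq ?_
  exact Finset.sum_congr rfl fun i _ => by ring

theorem kd_eq_zero_of_injective {X Y : G ⥤ FinProb} (f : X ⟶ Y)
    (hf : ∀ i, Function.Injective (Hom.toFun (f.app i))) : kd X Y = 0 := by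
  refine le_antisymm ((kd_le_of_hom f).trans_eq ?_) (kd_nonneg _ _)
  refine Finset.sum_eq_zero fun i _ => ?_
  rw [(Hom.preserving (f.app i)).entropy_eq_of_injective (hf i), sub_self]

end Fin

theorem entropy_tensorDiagram (X Y : G ⥤ FinProb) (i : G) :
    ((tensorDiagram X Y).obj i).entropy = (X.obj i).entropy + (Y.obj i).entropy :=
  entropy_tensor _ _

/-- The projection of a tensor product to its first factor. -/
def tensorFst (X Y : G ⥤ FinProb) : tensorDiagram X Y ⟶ X where
  app _ := ⟨fun a => a.1, isMeasurePreserving_fst _ _⟩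
  naturality _ _ _ := rfl

/-- The projection of a tensor product to its second factor. -/
def tensorSnd (X Y : G ⥤ FinProb) : tensorDiagram X Y ⟶ Y where
  app _ := ⟨fun a => a.2, isMeasurePreserving_snd _ _⟩
  naturality _ _ _ := rfl

/-- The tensor product of two morphisms of diagrams. -/
def tensorHom {X Y X' Y' : G ⥤ FinProb} (f : X ⟶ X') (g : Y ⟶ Y') :
    tensorDiagram X Y ⟶ tensorDiagram X' Y' where
  app i := ⟨fun a => (Hom.toFun (f.app i) a.1, Hom.toFun (g.app i) a.2),
    (Hom.preserving (f.app i)).tensor (Hom.preserving (g.app i))⟩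
  naturality _ _ k := Hom.ext (funext fun a =>
    Prod.ext (naturality_toFun f k a.1).symm (naturality_toFun g k a.2).symm)

/-- The tensor product with its projections is always a fan. Finiteness is what makes the real
number `kd` carry the same information as `ikd`. -/
theorem ikd_ne_top [Finite G] (X Y : G ⥤ FinProb) : ikd X Y ≠ ⊤ := by
  refine ne_top_of_le_ne_top ENNReal.ofReal_ne_top
    (iInf_le_of_le (tensorDiagram X Y) (iInf_le_of_le (tensorFst X Y) (iInf_le _ (tensorSnd X Y))))

theorem ikd_eq_ofReal [Finite G] (X Y : G ⥤ FinProb) : ikd X Y = ENNReal.ofReal (kd X Y) :=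
  (ENNReal.ofReal_toReal (ikd_ne_top X Y)).symm

theorem ikd_le_ofReal_iff [Finite G] {X Y : G ⥤ FinProb} {r : ℝ} (hr : 0 ≤ r) :
    ikd X Y ≤ ENNReal.ofReal r ↔ kd X Y ≤ r := by
  rw [ikd_eq_ofReal, ENNReal.ofReal_le_ofReal_iff hr]

section Fin
variable [Fintype G]

theorem exists_fan_lt (X Y : G ⥤ FinProb) {η : ℝ} (hη : 0 < η) :
    ∃ (Z : G ⥤ FinProb) (_ : Z ⟶ X) (_ : Z ⟶ Y),
      ∑ i, (2 * (Z.obj i).entropy - (X.obj i).entropy - (Y.obj i).entropy) < kd X Y + η := by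
  have h : ikd X Y < ENNReal.ofReal (kd X Y + η) := by
    rw [ikd_eq_ofReal]
    exact (ENNReal.ofReal_lt_ofReal_iff (by linarith [kd_nonneg X Y])).2 (by linarith)
  simp only [ikd, iInf_lt_iff] at h
  obtain ⟨Z, f, g, h⟩ := h
  refine ⟨Z, f, g, ?_⟩
  rw [← fanDist_eq f g]
  exact (ENNReal.ofReal_lt_ofReal_iff (by linarith [kd_nonneg X Y])).1 h

theorem kd_tensor_le (X Y X' Y' : G ⥤ FinProb) :
    kd (tensorDiagram X Y) (tensorDiagram X' Y') ≤ kd X X' + kd Y Y' := by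
  refine le_of_forall_pos_le_add fun η hη => ?_
  obtain ⟨A, f, f', hA⟩ := exists_fan_lt X X' (half_pos hη)
  obtain ⟨B, g, g', hB⟩ := exists_fan_lt Y Y' (half_pos hη)
  have h := kd_le_of_fan (tensorHom f g) (tensorHom f' g')
  simp only [entropy_tensorDiagram] at h
  have e : ∀ i, 2 * ((A.obj i).entropy + (B.obj i).entropy) -
      ((X.obj i).entropy + (Y.obj i).entropy) - ((X'.obj i).entropy + (Y'.obj i).entropy) =
      (2 * (A.obj i).entropy - (X.obj i).entropy - (X'.obj i).entropy) +
      (2 * (B.obj i).entropy - (Y.obj i).entropy - (Y'.obj i).entropy) := fun i => by ring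
  simp only [e, Finset.sum_add_distrib] at h
  linarith

theorem abs_entropy_sub_le (X Y : G ⥤ FinProb) (i : G) :
    |(X.obj i).entropy - (Y.obj i).entropy| ≤ kd X Y := by
  refine le_of_forall_pos_le_add fun η hη => ?_
  obtain ⟨A, f, g, hA⟩ := exists_fan_lt X Y hη
  have h1 := fun j => (Hom.preserving (f.app j)).entropy_le
  have h2 := fun j => (Hom.preserving (g.app j)).entropy_le
  have h3 := Finset.single_le_sum
    (f := fun i => 2 * (A.obj i).entropy - (X.obj i).entropy - (Y.obj i).entropy)
    (fun j _ => by linarith [h1 j, h2 j]) (Finset.mem_univ i)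
  rw [abs_le]
  constructor <;> linarith [h1 i, h2 i]

variable [OrderBot G]

/-- A coupling of the initial spaces bounds the intrinsic entropy distance of two diagrams. -/
theorem kd_le_of_coupling {X Y : G ⥤ FinProb} {Ω : FinProb}
    {α : Ω.carrier → (X.obj ⊥).carrier} {β : Ω.carrier → (Y.obj ⊥).carrier}
    (hα : IsMeasurePreserving Ω (X.obj ⊥) α) (hβ : IsMeasurePreserving Ω (Y.obj ⊥) β) :
    kd X Y ≤ ∑ i, (2 * Ω.ent (fun ω => (fromInitial X i (α ω), fromInitial Y i (β ω))) -
      (X.obj i).entropy - (Y.obj i).entropy) := by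
  let π : ∀ i, Ω.carrier → (X.obj i).carrier × (Y.obj i).carrier :=
    fun i ω => (fromInitial X i (α ω), fromInitial Y i (β ω))
  have hX : ∀ i j (h : i ≤ j) ω, (X.map (homOfLE h)).toFun (π i ω).1 = (π j ω).1 :=
    fun i j h ω => map_fromInitial X (homOfLE h) (α ω)
  have hY : ∀ i j (h : i ≤ j) ω, (Y.map (homOfLE h)).toFun (π i ω).2 = (π j ω).2 :=
    fun i j h ω => map_fromInitial Y (homOfLE h) (β ω)
  have hπ : ∀ i j, i ≤ j → ∀ a b, π i a = π i b → π j a = π j b := by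
    intro i j h a b hab
    refine Prod.ext ?_ ?_
    · rw [← hX i j h, ← hX i j h, hab]
    · rw [← hY i j h, ← hY i j h, hab]
  let f : ofMaps Ω π hπ ⟶ X :=
    { app := fun i => ⟨fun b => b.1.1, (isMeasurePreserving_toImage (π i)).of_comp
        (hα.comp (isMeasurePreserving_fromInitial X i))⟩
      naturality := by
        intro i j k
        refine Hom.ext (funext ?_)
        rintro ⟨_, ω, rfl⟩
        change (Hom.toFun ((ofMaps Ω π hπ).map k) ⟨π i ω, ω, rfl⟩).1.1 = _
        rw [ofMaps_map_toFun]
        exact (hX i j (leOfHom k) ω).symm }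
  let g : ofMaps Ω π hπ ⟶ Y :=
    { app := fun i => ⟨fun b => b.1.2, (isMeasurePreserving_toImage (π i)).of_comp
        (hβ.comp (isMeasurePreserving_fromInitial Y i))⟩
      naturality := by
        intro i j k
        refine Hom.ext (funext ?_)
        rintro ⟨_, ω, rfl⟩
        change (Hom.toFun ((ofMaps Ω π hπ).map k) ⟨π i ω, ω, rfl⟩).1.2 = _
        rw [ofMaps_map_toFun]
        exact (hY i j (leOfHom k) ω).symm }
  refine (kd_le_of_fan f g).trans_eq ?_
  refine Finset.sum_congr rfl fun i _ => ?_
  rw [show ((ofMaps Ω π hπ).obj i).entropy = Ω.ent (π i) from entropy_image (π i)]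

/-- Two nearly optimal fans with tops `A` and `B` are glued by the fibre product of their initial
spaces over that of `Y`. At each index the variables of `A` and `B` both determine that of `Y`, so
H(A, B) + H(Y) ≤ H(A) + H(B). -/
theorem kd_triangle (X Y Z : G ⥤ FinProb) : kd X Z ≤ kd X Y + kd Y Z := by
  refine le_of_forall_pos_le_add fun η hη => ?_
  obtain ⟨A, f, f', hA⟩ := exists_fan_lt X Y (half_pos hη)
  obtain ⟨B, g, g', hB⟩ := exists_fan_lt Y Z (half_pos hη)
  let hf := Hom.preserving (f'.app ⊥)
  let hg := Hom.preserving (g.app ⊥)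
  have hα := isMeasurePreserving_fiberProduct_fst hf hg
  have hβ := isMeasurePreserving_fiberProduct_snd hf hg
  have h := kd_le_of_coupling (hα.comp (Hom.preserving (f.app ⊥)))
    (hβ.comp (Hom.preserving (g'.app ⊥)))
  have key : ∀ i, (fiberProduct _ _ hf hg).ent (fun ω =>
      (fromInitial X i (Hom.toFun (f.app ⊥) ω.1.1), fromInitial Z i (Hom.toFun (g'.app ⊥) ω.1.2))) +
      (Y.obj i).entropy ≤ (A.obj i).entropy + (B.obj i).entropy := by
    intro i
    rw [← (hα.comp (isMeasurePreserving_fromInitial A i)).ent_eq,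
      ← (hβ.comp (isMeasurePreserving_fromInitial B i)).ent_eq,
      ← ((hα.comp hf).comp (isMeasurePreserving_fromInitial Y i)).ent_eq]
    refine le_trans (add_le_add_left (ent_mono ?_) _) (ent_pair_add_le ?_ ?_)
    · intro a b hab
      obtain ⟨h1, h2⟩ := Prod.mk.inj hab
      rw [fromInitial_app, fromInitial_app, fromInitial_app, fromInitial_app]
      exact congrArg₂ Prod.mk (congrArg (Hom.toFun (f.app i)) h1)
        (congrArg (Hom.toFun (g'.app i)) h2)
    · intro a b hab
      rw [fromInitial_app, fromInitial_app, hab]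
    · intro a b hab
      -- The defining equation of the fibre product allows the variable of `Y` to be computed from
      -- the `B` side as well.
      rw [a.2, b.2, fromInitial_app, fromInitial_app, hab]
  have h2 := h.trans (Finset.sum_le_sum fun i _ => (show _ ≤
      (2 * (A.obj i).entropy - (X.obj i).entropy - (Y.obj i).entropy) +
      (2 * (B.obj i).entropy - (Y.obj i).entropy - (Z.obj i).entropy) by linarith [key i]))
  rw [Finset.sum_add_distrib] at h2
  linarith

/-- The joint entropy need not be the entropy of a space in the diagram; the factor 2 accounts for
the losses at the two indices `x` and `u`. -/
theorem abs_jointEntropy_sub_le (X Y : G ⥤ FinProb) (x u : G) :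
    |jointEntropy X x u - jointEntropy Y x u| ≤ 2 * kd X Y := by
  refine le_of_forall_pos_le_add fun η hη => ?_
  obtain ⟨A, f, g, hA⟩ := exists_fan_lt X Y (half_pos hη)
  have h1 := fun j => (Hom.preserving (f.app j)).entropy_le
  have h2 := fun j => (Hom.preserving (g.app j)).entropy_le
  have h3 := fun i => Finset.single_le_sum
    (f := fun i => 2 * (A.obj i).entropy - (X.obj i).entropy - (Y.obj i).entropy)
    (fun j _ => by linarith [h1 j, h2 j]) (Finset.mem_univ i)
  have := jointEntropy_le_of_hom f x u
  have := jointEntropy_le_of_hom g x u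
  have := jointEntropy_ge_of_hom f x u
  have := jointEntropy_ge_of_hom g x u
  have := h3 x
  have := h3 u
  rw [abs_le]
  constructor <;> linarith [h1 x, h2 x, h1 u, h2 u]

end Fin

end Diagrams

section Near

variable {E : Type*} [PseudoMetricSpace E]

/-! ### Linear closeness of sequences -/

/-- The distance of the two sequences is at most `δ m + o(m)`. -/
def Near (x y : ℕ → E) (δ : ℝ) : Prop :=
  ∀ η : ℝ, 0 < η → ∃ C : ℝ, ∀ m : ℕ, dist (x m) (y m) ≤ (δ + η) * m + C

namespace Near

variable {x y z x' y' : ℕ → E} {δ δ' : ℝ}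

theorem of_bounded {C : ℝ} (h : ∀ m, dist (x m) (y m) ≤ C) : Near x y 0 := fun η hη =>
  ⟨C, fun m => (h m).trans (by have := mul_nonneg hη.le (Nat.cast_nonneg (α := ℝ) m); linarith)⟩

theorem refl (x : ℕ → E) : Near x x 0 := of_bounded (C := 0) fun m => by simp

theorem symm (h : Near x y δ) : Near y x δ := fun η hη =>
  (h η hη).imp fun _ hC m => dist_comm (x m) (y m) ▸ hC m

theorem trans (h : Near x y δ) (h' : Near y z δ') : Near x z (δ + δ') := by
  intro η hη
  obtain ⟨C, hC⟩ := h (η / 2) (half_pos hη)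
  obtain ⟨C', hC'⟩ := h' (η / 2) (half_pos hη)
  refine ⟨C + C', fun m => ?_⟩
  linarith [dist_triangle (x m) (y m) (z m), hC m, hC' m]

theorem mono (h : Near x y δ) (hδ : δ ≤ δ') : Near x y δ' := by
  intro η hη
  obtain ⟨C, hC⟩ := h η hη
  refine ⟨C, fun m => (hC m).trans ?_⟩
  have := mul_le_mul_of_nonneg_right hδ (Nat.cast_nonneg (α := ℝ) m)
  linarith

theorem of_forall_pos (h : ∀ η : ℝ, 0 < η → Near x y (δ + η)) : Near x y δ := by
  intro η hη
  obtain ⟨C, hC⟩ := h (η / 2) (half_pos hη) (η / 2) (half_pos hη)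
  refine ⟨C, fun m => (hC m).trans ?_⟩
  linarith

/-- Slowing down both sequences. -/
theorem comp_div (hδ : 0 ≤ δ) (h : Near x y δ) {N : ℕ} (hN : 0 < N) :
    Near (fun m => x (m / N)) (fun m => y (m / N)) (δ / N) := by
  intro η hη
  have hN' : (0 : ℝ) < N := Nat.cast_pos.2 hN
  obtain ⟨C, hC⟩ := h (η * N) (mul_pos hη hN')
  refine ⟨C, fun m => (hC _).trans ?_⟩
  have h1 : ((m / N : ℕ) : ℝ) ≤ m / N := Nat.cast_div_le
  have h2 := mul_le_mul_of_nonneg_left h1 (show 0 ≤ δ + η * N by positivity)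
  have h3 : (δ + η * N) * ((m : ℝ) / N) = (δ / N + η) * m := by field_simp
  linarith

/-- Speeding up both sequences along a function of bounded growth rate. -/
theorem comp_floor (hδ : 0 ≤ δ) (h : Near x y δ) {t : ℝ} (ht : 0 ≤ t) :
    Near (fun m => x ⌊t * m⌋₊) (fun m => y ⌊t * m⌋₊) (t * δ) := by
  intro η hη
  obtain ⟨C, hC⟩ := h (η / (t + 1)) (by positivity)
  refine ⟨C, fun m => (hC _).trans ?_⟩
  have h1 : ((⌊t * m⌋₊ : ℕ) : ℝ) ≤ t * m := Nat.floor_le (by positivity)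
  have h2 := mul_le_mul_of_nonneg_left h1 (show 0 ≤ δ + η / (t + 1) by positivity)
  have h3 : η / (t + 1) * t ≤ η := by
    rw [div_mul_eq_mul_div, div_le_iff₀ (by positivity)]
    nlinarith
  have h4 := mul_le_mul_of_nonneg_right h3 (Nat.cast_nonneg (α := ℝ) m)
  nlinarith

end Near

end Near

/-! ### Commutative monoids with a non-expansive addition -/

/-- Addition does not increase the distance. -/
class NonexpansiveAdd (E : Type*) [AddCommMonoid E] [PseudoMetricSpace E] : Prop where
  dist_add_add_le : ∀ a b c d : E, dist (a + b) (c + d) ≤ dist a c + dist b d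

section Monoid

variable {E : Type*} [AddCommMonoid E]

/-- The sequence representing the conic combination `∑ₛ c(s) · [x(s)]`. -/
def conic {S : Type*} [Fintype S] (c : S → ℝ) (x : S → E) (m : ℕ) : E :=
  ∑ s, ⌊c s * (m : ℝ)⌋₊ • x s

variable [PseudoMetricSpace E] [NonexpansiveAdd E]

theorem dist_add_le (a b c d : E) : dist (a + b) (c + d) ≤ dist a c + dist b d :=
  NonexpansiveAdd.dist_add_add_le a b c d

theorem dist_finsetSum_le {S : Type*} (s : Finset S) (f g : S → E) :
    dist (∑ a ∈ s, f a) (∑ a ∈ s, g a) ≤ ∑ a ∈ s, dist (f a) (g a) := by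
  classical
  induction s using Finset.induction_on with
  | empty => simp
  | insert a s ha ih =>
    rw [Finset.sum_insert ha, Finset.sum_insert ha, Finset.sum_insert ha]
    exact (dist_add_le _ _ _ _).trans (by linarith)

theorem dist_nsmul_nsmul_le (n : ℕ) (a b : E) : dist (n • a) (n • b) ≤ n * dist a b := by
  have h := dist_finsetSum_le (Finset.range n) (fun _ => a) (fun _ => b)
  simpa using h

theorem dist_nsmul_self_le (n m : ℕ) (a : E) :
    dist (n • a) (m • a) ≤ |(n : ℝ) - m| * dist a 0 := by
  have key : ∀ n m : ℕ, n ≤ m → dist (n • a) (m • a) ≤ |(n : ℝ) - m| * dist a 0 := by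
    intro n m h
    obtain ⟨k, rfl⟩ := Nat.exists_eq_add_of_le h
    have h1 := dist_add_le (n • a) 0 (n • a) (k • a)
    have h2 := dist_nsmul_nsmul_le k 0 a
    rw [nsmul_zero, dist_comm 0 a] at h2
    rw [add_zero, dist_self, zero_add, ← add_nsmul] at h1
    push_cast
    rw [show (n : ℝ) - (n + k) = -k by ring, abs_neg, abs_of_nonneg (Nat.cast_nonneg k)]
    exact h1.trans h2
  rcases le_total n m with h | h
  · exact key n m h
  · rw [dist_comm, abs_sub_comm]
    exact key m n h

theorem dist_sum_nsmul_le {S : Type*} [Fintype S] (n m : S → ℕ) (x : S → E) :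
    dist (∑ s, n s • x s) (∑ s, m s • x s) ≤ ∑ s, |(n s : ℝ) - m s| * dist (x s) 0 :=
  (dist_finsetSum_le _ _ _).trans (Finset.sum_le_sum fun _ _ => dist_nsmul_self_le _ _ _)

namespace Near

variable {x y z x' y' : ℕ → E} {δ δ' : ℝ}

theorem add (h : Near x y δ) (h' : Near x' y' δ') : Near (x + x') (y + y') (δ + δ') := by
  intro η hη
  obtain ⟨C, hC⟩ := h (η / 2) (half_pos hη)
  obtain ⟨C', hC'⟩ := h' (η / 2) (half_pos hη)
  refine ⟨C + C', fun m => ?_⟩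
  have := dist_add_le (x m) (x' m) (y m) (y' m)
  simp only [Pi.add_apply]
  linarith [hC m, hC' m]

theorem sum {S : Type*} (s : Finset S) {f g : S → ℕ → E} {δ : S → ℝ}
    (h : ∀ a ∈ s, Near (f a) (g a) (δ a)) :
    Near (∑ a ∈ s, f a) (∑ a ∈ s, g a) (∑ a ∈ s, δ a) := by
  classical
  induction s using Finset.induction_on with
  | empty => simpa using refl _
  | insert a s ha ih =>
    rw [Finset.sum_insert ha, Finset.sum_insert ha, Finset.sum_insert ha]
    exact (h a (Finset.mem_insert_self a s)).add
      (ih fun b hb => h b (Finset.mem_insert_of_mem hb))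

end Near

/-! ### Integer approximations of conic combinations -/

theorem abs_floor_sub_le {t : ℝ} (ht : 0 ≤ t) : |(⌊t⌋₊ : ℝ) - t| ≤ 1 := by
  rw [abs_le]
  constructor <;> linarith [Nat.floor_le ht, Nat.lt_floor_add_one t]

theorem conic_zero {E S : Type*} [AddCommMonoid E] [Fintype S] (c : S → ℝ) : conic c (fun _ => (0 : E)) = 0 := by
  funext m
  simp [conic]

theorem dist_sum_nsmul_le_of_abs_le {S : Type*} [Fintype S] {n m : S → ℕ} {C : ℝ}
    (h : ∀ s, |(n s : ℝ) - m s| ≤ C) (x : S → E) :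
    dist (∑ s, n s • x s) (∑ s, m s • x s) ≤ C * ∑ s, dist (x s) 0 := by
  rw [Finset.mul_sum]
  exact (dist_sum_nsmul_le n m x).trans
    (Finset.sum_le_sum fun s _ => mul_le_mul_of_nonneg_right (h s) dist_nonneg)

theorem conic_add_bounded {S : Type*} [Fintype S] {c : S → ℝ} (hc : ∀ s, 0 ≤ c s) (x : S → E) :
    ∃ C, ∀ m n, dist (conic c x (m + n)) (conic c x m + conic c x n) ≤ C := by
  -- Three floors occur, each with an error of at most 1.
  refine ⟨3 * ∑ s, dist (x s) 0, fun m n => ?_⟩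
  unfold conic
  rw [← Finset.sum_add_distrib]
  simp only [← add_nsmul]
  refine dist_sum_nsmul_le_of_abs_le (fun s => ?_) x
  have h1 := abs_le.1 (abs_floor_sub_le (mul_nonneg (hc s) (Nat.cast_nonneg (m + n))))
  have h2 := abs_le.1 (abs_floor_sub_le (mul_nonneg (hc s) (Nat.cast_nonneg m)))
  have h3 := abs_le.1 (abs_floor_sub_le (mul_nonneg (hc s) (Nat.cast_nonneg n)))
  push_cast at *
  rw [abs_le]
  constructor <;> linarith

theorem near_conic_div {S : Type*} [Fintype S] {c : S → ℝ} (hc : ∀ s, 0 ≤ c s) (x : S → E)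
    {N : ℕ} (hN : 0 < N) :
    Near (conic (fun s => c s / N) x) (fun m => conic c x (m / N)) 0 := by
  have hN' : (0 : ℝ) < N := Nat.cast_pos.2 hN
  -- The 2 covers the two real floors; the sum of the `c s` covers the integer division, which is
  -- off by less than 1 before it is multiplied by `c s`.
  refine Near.of_bounded (C := (2 + ∑ s, c s) * ∑ s, dist (x s) 0) fun m => ?_
  refine dist_sum_nsmul_le_of_abs_le (fun s => ?_) x
  have h1 := abs_le.1 (abs_floor_sub_le
    (mul_nonneg (div_nonneg (hc s) hN'.le) (Nat.cast_nonneg m)))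
  have h2 := abs_le.1 (abs_floor_sub_le (mul_nonneg (hc s) (Nat.cast_nonneg (m / N))))
  have h3 : ((m / N : ℕ) : ℝ) ≤ m / N := Nat.cast_div_le
  have h4 : (m : ℝ) / N - 1 ≤ (m / N : ℕ) := by
    have : (m : ℝ) < (m / N : ℕ) * N + N := by
      exact_mod_cast Nat.lt_div_mul_add hN
    rw [div_sub_one hN'.ne', div_le_iff₀ hN']
    linarith
  have h5 : c s / N * m = c s * (m / N) := by ring
  have h6 := mul_le_mul_of_nonneg_left h3 (hc s)
  have h7 := mul_le_mul_of_nonneg_left h4 (hc s)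
  have h8 := Finset.single_le_sum (fun s _ => hc s) (Finset.mem_univ s)
  rw [h5] at h1 ⊢
  have h9 : 0 ≤ c s := hc s
  rw [abs_le]
  constructor <;> nlinarith

theorem Near.conic_div {S T : Type*} [Fintype S] [Fintype T] {c : S → ℝ} (hc : ∀ s, 0 ≤ c s)
    {x : S → E} {d : T → ℝ} (hd : ∀ s, 0 ≤ d s) {y : T → E} {δ : ℝ} (hδ : 0 ≤ δ)
    (h : Near (conic c x) (conic d y) δ) {N : ℕ} (hN : 0 < N) :
    Near (conic (fun s => c s / N) x) (conic (fun s => d s / N) y) (δ / N) := by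
  have := ((near_conic_div hc x hN).trans (h.comp_div hδ hN)).trans (near_conic_div hd y hN).symm
  simpa using this

/-- Multiplying the coefficients by a natural number multiplies the conic combination. -/
theorem near_nsmul_conic {S : Type*} [Fintype S] {c : S → ℝ} (hc : ∀ s, 0 ≤ c s) (x : S → E)
    (M : ℕ) : Near (M • conic c x) (conic (fun s => M * c s) x) 0 := by
  refine Near.of_bounded (C := (M + 1) * ∑ s, dist (x s) 0) fun m => ?_
  simp only [Pi.smul_apply, conic, Finset.smul_sum, ← mul_nsmul']
  refine dist_sum_nsmul_le_of_abs_le (fun s => ?_) x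
  have h1 := abs_le.1 (abs_floor_sub_le (mul_nonneg (hc s) (Nat.cast_nonneg m)))
  have h2 := abs_le.1 (abs_floor_sub_le
    (mul_nonneg (mul_nonneg (Nat.cast_nonneg M) (hc s)) (Nat.cast_nonneg m)))
  have h3 : (0 : ℝ) ≤ M := Nat.cast_nonneg M
  push_cast
  rw [abs_le]
  constructor <;> nlinarith

theorem abs_sum_floor_sub_le {U : Type*} [Fintype U] {f : U → ℝ} (hf : ∀ u, 0 ≤ f u)
    (h1 : ∑ u, f u = 1) {t : ℝ} (ht : 0 ≤ t) (m : ℕ) :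
    |((∑ u, ⌊t * f u * m⌋₊ : ℕ) : ℝ) - (⌊t * m⌋₊ : ℝ)| ≤ Fintype.card U + 1 := by
  have h2 : |((∑ u, ⌊t * f u * m⌋₊ : ℕ) : ℝ) - t * m| ≤ Fintype.card U := by
    have : t * m = ∑ u, t * f u * m := by rw [← Finset.sum_mul, ← Finset.mul_sum, h1, mul_one]
    rw [this, Nat.cast_sum, ← Finset.sum_sub_distrib]
    refine (Finset.abs_sum_le_sum_abs _ _).trans ?_
    refine (Finset.sum_le_sum fun u _ => abs_floor_sub_le (by have := hf u; positivity)).trans ?_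
    simp
  have h3 := abs_floor_sub_le (t := t * m) (by positivity)
  rw [abs_le] at *
  constructor <;> linarith

/-- Families of sums, indexed by pairs. -/
theorem near_conic_prod {S T : Type*} [Fintype S] [Fintype T] {c : S → ℝ} (hc : ∀ s, 0 ≤ c s)
    (hc1 : ∑ s, c s = 1) {d : T → ℝ} (hd : ∀ t, 0 ≤ d t) (hd1 : ∑ t, d t = 1)
    (x : S → E) (y : T → E) :
    Near (conic (fun a : S × T => c a.1 * d a.2) (fun a => x a.1 + y a.2))
      (conic c x + conic d y) 0 := by
  refine Near.of_bounded (C := (Fintype.card T + 1) * ∑ s, dist (x s) 0 +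
    (Fintype.card S + 1) * ∑ s, dist (y s) 0) fun m => ?_
  have e : conic (fun a : S × T => c a.1 * d a.2) (fun a => x a.1 + y a.2) m =
      (∑ s, (∑ t, ⌊c s * d t * m⌋₊) • x s) + ∑ t, (∑ s, ⌊d t * c s * m⌋₊) • y t := by
    simp only [conic, nsmul_add, Finset.sum_add_distrib, Fintype.sum_prod_type, Finset.sum_smul]
    congr 1
    rw [Finset.sum_comm]
    simp only [mul_comm]
  rw [e]
  refine (dist_add_le _ _ _ _).trans (add_le_add ?_ ?_)
  · exact dist_sum_nsmul_le_of_abs_le (fun s => abs_sum_floor_sub_le hd hd1 (hc s) m) x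
  · exact dist_sum_nsmul_le_of_abs_le (fun s => abs_sum_floor_sub_le hc hc1 (hd s) m) y

/-! ### The weak law of large numbers -/

/-- If replacing `x` by a random element among the `xs s` costs at most `h`, then multiples of `x`
are approximated by the conic combination of the `xs s`, at a cost of `h` per copy. -/
theorem near_conic_of_mixture {S : Type*} [Fintype S] {p : S → ℝ} (hp : ∀ s, 0 ≤ p s)
    (hp1 : ∑ s, p s = 1) {x : E} {xs : S → E} {h : ℝ}
    (hmix : ∀ r y, dist (x + r) y ≤ h + ∑ s, p s * dist (xs s + r) y) :
    Near (fun m => m • x) (conic p xs) h := by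
  classical
  -- The copies of `x` are exchanged one at a time for random `xs s`. The squared term plus m p (1 -
  -- p) is the second moment of n + Bin(m, p) - t, the final deviation of the count of `xs s` from
  -- its target. At m = 0 the distance is linear in the deviation, and |a| ≤ a²/(4B) + B makes it
  -- quadratic.
  have claim : ∀ B : ℝ, 0 < B → ∀ t : S → ℕ, ∀ m : ℕ, ∀ n : S → ℕ,
      dist (m • x + ∑ s, n s • xs s) (∑ s, t s • xs s) ≤
        m * h + ∑ s, dist (xs s) 0 *
          (((n s + m * p s - t s) ^ 2 + m * (p s * (1 - p s))) / (4 * B) + B) := by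
    intro B hB t m
    induction m with
    | zero =>
      intro n
      simp only [zero_nsmul, zero_add, Nat.cast_zero, zero_mul, add_zero]
      refine (dist_sum_nsmul_le n t xs).trans (Finset.sum_le_sum fun s _ => ?_)
      rw [mul_comm]
      refine mul_le_mul_of_nonneg_left ?_ dist_nonneg
      have h1 : |(n s : ℝ) - t s| * (4 * B) ≤ ((n s : ℝ) - t s) ^ 2 + B * (4 * B) := by
        rw [← sq_abs]
        nlinarith [sq_nonneg (|(n s : ℝ) - t s| - 2 * B)]
      have h2 : ((n s : ℝ) - t s) ^ 2 / (4 * B) + B =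
          (((n s : ℝ) - t s) ^ 2 + B * (4 * B)) / (4 * B) := by field_simp
      rw [h2, le_div_iff₀ (by positivity)]
      exact h1
    | succ m ih =>
      intro n
      have e1 : (m + 1) • x + ∑ s, n s • xs s = x + (m • x + ∑ s, n s • xs s) := by
        rw [add_nsmul, one_nsmul, add_comm (m • x) x, add_assoc]
      have e2 : ∀ s, xs s + (m • x + ∑ s, n s • xs s) =
          m • x + ∑ s', (n s' + if s' = s then 1 else 0) • xs s' := by
        intro s
        simp only [add_nsmul, Finset.sum_add_distrib, ite_smul, one_nsmul, zero_nsmul,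
          Finset.sum_ite_eq', Finset.mem_univ, if_true]
        rw [add_comm (xs s), add_assoc]
      rw [e1]
      refine (hmix _ _).trans ?_
      simp only [e2]
      have h1 := Finset.sum_le_sum fun s (_ : s ∈ Finset.univ) =>
        mul_le_mul_of_nonneg_left (ih fun s' => n s' + if s' = s then 1 else 0) (hp s)
      refine (add_le_add_right h1 h).trans (le_of_eq ?_)
      simp only [mul_add (p _), Finset.sum_add_distrib, ← Finset.sum_mul, hp1, one_mul]
      simp only [Finset.mul_sum]
      rw [Finset.sum_comm]
      -- The second moment is preserved exactly when one more draw is averaged over, so the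
      -- induction loses only `h` per copy.
      have h3 : ∀ s', ∑ s, p s * (dist (xs s') 0 * (((((n s' + if s' = s then 1 else 0 : ℕ) : ℝ) +
          m * p s' - t s') ^ 2 + m * (p s' * (1 - p s'))) / (4 * B) + B)) =
          dist (xs s') 0 * (((n s' + ((m + 1 : ℕ) : ℝ) * p s' - t s') ^ 2 +
            ((m + 1 : ℕ) : ℝ) * (p s' * (1 - p s'))) / (4 * B) + B) := by
        intro s'
        have e3 : ∀ s, p s * (dist (xs s') 0 * (((((n s' + if s' = s then 1 else 0 : ℕ) : ℝ) +
            m * p s' - t s') ^ 2 + m * (p s' * (1 - p s'))) / (4 * B) + B)) =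
            p s * (dist (xs s') 0 * (((n s' + m * p s' - t s') ^ 2 +
              m * (p s' * (1 - p s'))) / (4 * B) + B)) +
            (if s' = s then p s * (dist (xs s') 0 * ((2 * (n s' + m * p s' - t s') + 1) /
              (4 * B))) else 0) := by
          intro s
          split_ifs
          · push_cast; ring
          · push_cast; ring
        rw [Finset.sum_congr rfl fun s _ => e3 s, Finset.sum_add_distrib, ← Finset.sum_mul, hp1,
          Finset.sum_ite_eq, if_pos (Finset.mem_univ _)]
        push_cast
        ring
      rw [Finset.sum_congr rfl fun s' _ => h3 s']
      push_cast
      ring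
  intro η hη
  set A := ∑ s, dist (xs s) 0 with hA
  have hA0 : 0 ≤ A := Finset.sum_nonneg fun s _ => dist_nonneg
  -- With B = θ m the variance, of order m, contributes only a constant after division by 4B, while
  -- the linear term is A θ m ≤ η m. The case m = 0 is separate because B must be positive.
  set θ := η / (A + 1) with hθ
  have hθ0 : 0 < θ := by positivity
  refine ⟨A * (1 / (2 * θ)), fun m => ?_⟩
  rcases Nat.eq_zero_or_pos m with rfl | hm
  · simp only [zero_nsmul, conic, Nat.cast_zero, mul_zero, Nat.floor_zero, Finset.sum_const_zero,
      dist_self, zero_add]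
    positivity
  have hm' : (1 : ℝ) ≤ m := by exact_mod_cast hm
  have h1 := claim (θ * m) (by positivity) (fun s => ⌊p s * m⌋₊) m 0
  simp only [Pi.zero_apply, zero_nsmul, Finset.sum_const_zero, add_zero, Nat.cast_zero,
    zero_add] at h1
  refine h1.trans ?_
  have h2 : ∀ s, (((m * p s - (⌊p s * m⌋₊ : ℝ)) ^ 2 + m * (p s * (1 - p s))) / (4 * (θ * m)) +
      θ * m) ≤ 1 / (2 * θ) + θ * m := by
    intro s
    have h3 := abs_floor_sub_le (t := p s * m) (mul_nonneg (hp s) (Nat.cast_nonneg m))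
    have h4 : (m * p s - (⌊p s * m⌋₊ : ℝ)) ^ 2 ≤ 1 := by
      rw [mul_comm (m : ℝ), ← neg_sub, neg_sq, ← sq_abs]
      exact pow_le_one₀ (abs_nonneg _) h3
    have h5 : p s * (1 - p s) ≤ 1 := by nlinarith [hp s, sq_nonneg (p s - 1)]
    have h6 : ((m * p s - (⌊p s * m⌋₊ : ℝ)) ^ 2 + m * (p s * (1 - p s))) ≤ 2 * m := by
      nlinarith
    have h7 : (2 * m : ℝ) / (4 * (θ * m)) = 1 / (2 * θ) := by field_simp; norm_num
    have := div_le_div_of_nonneg_right h6 (show 0 ≤ 4 * (θ * m) by positivity)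
    linarith
  have h3 := Finset.sum_le_sum fun s (_ : s ∈ Finset.univ) =>
    mul_le_mul_of_nonneg_left (h2 s) (dist_nonneg (x := xs s) (y := 0))
  rw [← Finset.sum_mul, ← hA] at h3
  have h4 : A * θ ≤ η := by
    rw [hθ, mul_div_assoc', div_le_iff₀ (by positivity)]
    nlinarith
  nlinarith

end Monoid

section Monoid

variable {E : Type*} [AddCommMonoid E] [PseudoMetricSpace E] [NonexpansiveAdd E]

/-! ### Completeness -/

/-- A jump of height T at T contributes at most 2 to ∑ φ(m)/m², uniformly in T. Hence summable
coefficients suffice for a step function, however fast its jump points grow. -/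
theorem sum_range_indicator_div_sq_le (T n : ℕ) (hT : 1 ≤ T) :
    ∑ m ∈ Finset.range n, (if T ≤ m then (T : ℝ) / (m : ℝ) ^ 2 else 0) ≤ 2 := by
  have h0 : (0 : ℝ) < T := by exact_mod_cast hT
  have h := sum_Ioo_inv_sq_le (α := ℝ) (T - 1) n
  rw [show (((T - 1 : ℕ) : ℝ) + 1) = T by rw [Nat.cast_sub hT]; simp] at h
  have e : ∑ m ∈ Finset.range n, (if T ≤ m then (T : ℝ) / (m : ℝ) ^ 2 else 0) =
      T * ∑ i ∈ Finset.Ioo (T - 1) n, ((i : ℝ) ^ 2)⁻¹ := by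
    rw [← Finset.sum_filter, Finset.mul_sum]
    refine Finset.sum_congr ?_ fun m _ => div_eq_mul_inv _ _
    ext m
    simp only [Finset.mem_filter, Finset.mem_range, Finset.mem_Ioo]
    omega
  rw [e]
  calc (T : ℝ) * ∑ i ∈ Finset.Ioo (T - 1) n, ((i : ℝ) ^ 2)⁻¹ ≤ T * (2 / T) :=
        mul_le_mul_of_nonneg_left h h0.le
    _ = 2 := by field_simp

/-- A step function with jumps `β j * T (j + 1)` at `T (j + 1)` is an admissible bound, if `β` is
summable. -/
theorem isAdmissibleBound_step {T : ℕ → ℕ} (hT : ∀ j, 1 ≤ T (j + 1)) {κ : ℕ → ℕ}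
    (hκ : ∀ m j, j < κ m → T (j + 1) ≤ m) (hκm : Monotone κ) {β : ℕ → ℝ} (hβ : ∀ j, 0 ≤ β j)
    (hβs : Summable β) {b : ℝ} (hb : 0 ≤ b) :
    IsAdmissibleBound fun m => b + ∑ j ∈ Finset.range (κ m), β j * T (j + 1) where
  nonneg m := add_nonneg hb
    (Finset.sum_nonneg fun j _ => mul_nonneg (hβ j) (Nat.cast_nonneg _))
  mono m n h := by
    refine add_le_add_right (Finset.sum_le_sum_of_subset_of_nonneg ?_ ?_) b
    · exact Finset.range_mono (hκm h)
    · exact fun j _ _ => mul_nonneg (hβ j) (Nat.cast_nonneg _)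
  summable := by
    simp only [add_div]
    refine Summable.add ?_ ?_
    · simp only [div_eq_mul_inv]
      exact (Real.summable_nat_pow_inv.2 one_lt_two).mul_left b
    · refine summable_of_sum_range_le (c := (∑' j, β j) * 2) (fun m => div_nonneg
        (Finset.sum_nonneg fun j _ => mul_nonneg (hβ j) (Nat.cast_nonneg _)) (sq_nonneg _)) ?_
      intro n
      -- The inner range is enlarged to one that does not depend on `m`, so that the two sums can be
      -- exchanged.
      have h1 : ∀ m ∈ Finset.range n, (∑ j ∈ Finset.range (κ m), β j * (T (j + 1) : ℝ)) /
          (m : ℝ) ^ 2 ≤ ∑ j ∈ Finset.range (∑ m ∈ Finset.range n, κ m),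
            β j * (if T (j + 1) ≤ m then (T (j + 1) : ℝ) / (m : ℝ) ^ 2 else 0) := by
        intro m hm
        rw [Finset.sum_div]
        have h2 : Finset.range (κ m) ⊆ Finset.range (∑ m ∈ Finset.range n, κ m) :=
          Finset.range_mono (Finset.single_le_sum (f := κ) (fun _ _ => Nat.zero_le _) hm)
        refine le_trans (Finset.sum_le_sum fun j hj => ?_)
          (Finset.sum_le_sum_of_subset_of_nonneg h2 fun j _ _ => mul_nonneg (hβ j) ?_)
        · rw [if_pos (hκ m j (Finset.mem_range.1 hj)), mul_div_assoc]
        · split_ifs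
          · positivity
          · exact le_rfl
      refine (Finset.sum_le_sum h1).trans ?_
      rw [Finset.sum_comm]
      simp only [← Finset.mul_sum]
      refine (Finset.sum_le_sum fun j _ => mul_le_mul_of_nonneg_left
        (sum_range_indicator_div_sq_le _ n (hT j)) (hβ j)).trans ?_
      rw [← Finset.sum_mul]
      exact mul_le_mul_of_nonneg_right (hβs.sum_le_tsum _ fun j _ => hβ j) two_pos.le

/-- A Cauchy sequence of sequences that are additive up to bounded errors has a limit, which is
almost linear. -/
theorem exists_near_limit (y : ℕ → ℕ → E)
    (hadd : ∀ k, ∃ C, ∀ m n, dist (y k (m + n)) (y k m + y k n) ≤ C)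
    {ε : ℕ → ℝ} (hε0 : ∀ k, 0 ≤ ε k) (hε : Summable ε)
    (hnear : ∀ j k, j ≤ k → Near (y j) (y k) (ε j)) :
    ∃ (z : ℕ → E) (φ : ℕ → ℝ), IsAdmissibleBound φ ∧
      (∀ m n, dist (z (m + n)) (z m + z n) ≤ φ (m + n)) ∧
      ∀ k, Near (y k) z (ε k + (1 / 2) ^ k) := by
  choose E0 hE0 using hadd
  set e : ℕ → ℝ := fun j => ε j + (1 / 2) ^ j with he
  have he0 : ∀ j, 0 ≤ e j := fun j => add_nonneg (hε0 j) (by positivity)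
  have hes : Summable e := hε.add (summable_geometric_of_lt_one (by norm_num) (by norm_num))
  have hc' : ∀ j k, ∃ C, j ≤ k → ∀ m : ℕ, dist (y j m) (y k m) ≤ e j * m + C := by
    intro j k
    by_cases h : j ≤ k
    · obtain ⟨C, hC⟩ := hnear j k h ((1 / 2) ^ j) (by positivity)
      exact ⟨C, fun _ => hC⟩
    · exact ⟨0, fun h' => absurd h' h⟩
  choose c hc using hc'
  -- `B k` dominates all additive constants that involve only the sequences up to `k`, and is
  -- monotone.
  set B : ℕ → ℝ := fun k =>
    ∑ j ∈ Finset.range (k + 1), (|E0 j| + ∑ i ∈ Finset.range (j + 1), |c i j|) with hB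
  have hBnn : ∀ j, 0 ≤ |E0 j| + ∑ i ∈ Finset.range (j + 1), |c i j| := fun j =>
    add_nonneg (abs_nonneg _) (Finset.sum_nonneg fun _ _ => abs_nonneg _)
  have hB0 : ∀ k, 0 ≤ B k := fun k => Finset.sum_nonneg fun j _ => hBnn j
  have hBm : Monotone B := fun k l h => Finset.sum_le_sum_of_subset_of_nonneg
    (Finset.range_mono (by omega)) fun j _ _ => hBnn j
  have hBs : ∀ k, |E0 k| + ∑ i ∈ Finset.range (k + 1), |c i k| ≤ B k := fun k =>
    Finset.single_le_sum (f := fun j => |E0 j| + ∑ i ∈ Finset.range (j + 1), |c i j|)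
      (fun j _ => hBnn j) (Finset.mem_range.2 (Nat.lt_succ_self k))
  have hBE : ∀ k, E0 k ≤ B k := fun k => (le_abs_self _).trans
    ((le_add_of_nonneg_right (Finset.sum_nonneg fun _ _ => abs_nonneg _)).trans (hBs k))
  have hBc : ∀ j k, j ≤ k → c j k ≤ B k := fun j k h => (le_abs_self _).trans
    ((Finset.single_le_sum (f := fun i => |c i k|) (fun i _ => abs_nonneg _)
      (Finset.mem_range.2 (Nat.lt_succ_of_le h))).trans
        ((le_add_of_nonneg_left (abs_nonneg _)).trans (hBs k)))
  -- From time `T k` on, the constant `B k` is at most 2^{-k} m. The limit is the diagonal sequence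
  -- that uses `y k` between `T k` and `T (k + 1)`.
  set T : ℕ → ℕ := fun k => k + ⌈2 ^ k * B k⌉₊ with hT
  have hTk : ∀ k, k ≤ T k := fun k => Nat.le_add_right _ _
  have hTm : Monotone T := fun k l h => add_le_add h (Nat.ceil_mono
    (mul_le_mul (pow_le_pow_right₀ one_le_two h) (hBm h) (hB0 k) (by positivity)))
  have hTB : ∀ k, B k ≤ (1 / 2) ^ k * T k := by
    intro k
    have h1 : 2 ^ k * B k ≤ T k := by
      have := Nat.le_ceil (2 ^ k * B k)
      simp only [hT, Nat.cast_add]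
      have := Nat.cast_nonneg (α := ℝ) k
      linarith
    have h2 : (1 / 2 : ℝ) ^ k * (2 ^ k * B k) = B k := by
      rw [← mul_assoc, ← mul_pow]; norm_num
    rw [← h2]
    exact mul_le_mul_of_nonneg_left h1 (by positivity)
  -- The default value 0 is also taken when even `T 0` exceeds `m`; therefore `T (κ m) ≤ m` is
  -- claimed only for `κ m ≠ 0`.
  set κ : ℕ → ℕ := fun m => Nat.findGreatest (fun k => T k ≤ m) m with hκ
  have hκ1 : ∀ k m, T k ≤ m → k ≤ κ m := fun k m h =>
    Nat.le_findGreatest ((hTk k).trans h) h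
  have hκ2 : ∀ m, κ m ≠ 0 → T (κ m) ≤ m := fun m h =>
    Nat.findGreatest_of_ne_zero (P := fun k => T k ≤ m) rfl h
  have hκm : Monotone κ := by
    intro m n h
    by_cases h0 : κ m = 0
    · rw [h0]; exact Nat.zero_le _
    · exact hκ1 _ _ ((hκ2 m h0).trans h)
  have hκlt : ∀ m, m < T (κ m + 1) := fun m => by
    by_contra h
    have := hκ1 _ m (not_lt.1 h)
    omega
  -- When `κ m < K`, the linear error e m is below e T(κ m + 1), since `m` has not reached the next
  -- threshold. It is thus a single term of the step function.
  have hcmp : ∀ m K, κ m ≤ K → dist (y K m) (y (κ m) m) ≤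
      ∑ j ∈ Finset.range K, e j * T (j + 1) + B K := by
    intro m K h
    have h0 : ∀ j, 0 ≤ e j * (T (j + 1) : ℝ) := fun j => mul_nonneg (he0 j) (Nat.cast_nonneg _)
    rcases h.eq_or_lt with h | h
    · rw [h, dist_self]
      exact add_nonneg (Finset.sum_nonneg fun j _ => h0 j) (hB0 K)
    · rw [dist_comm]
      refine (hc _ K h.le m).trans (add_le_add ?_ (hBc _ _ h.le))
      refine le_trans ?_ (Finset.single_le_sum (f := fun j => e j * (T (j + 1) : ℝ))
        (fun j _ => h0 j) (Finset.mem_range.2 h))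
      exact mul_le_mul_of_nonneg_left (Nat.cast_le.2 (hκlt m).le) (he0 _)
  have hBsum : ∀ K, B K ≤ B 0 + ∑ j ∈ Finset.range K, (1 / 2 : ℝ) ^ (j + 1) * T (j + 1) := by
    intro K
    have h0 : ∀ j, 0 ≤ (1 / 2 : ℝ) ^ (j + 1) * (T (j + 1) : ℝ) := fun j => by positivity
    cases K with
    | zero => simp
    | succ K =>
      rw [Finset.sum_range_succ]
      have := Finset.sum_nonneg fun j (_ : j ∈ Finset.range K) => h0 j
      linarith [hTB (K + 1), hB0 0]
  -- The defect at m + n meets `B K` three times, from near-additivity of `y K` and from the two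
  -- comparisons at `m` and `n`, and the sum of the `e j T (j + 1)` twice.
  have hβs : Summable fun j => 3 * (1 / 2 : ℝ) ^ (j + 1) + 2 * e j :=
    (((summable_nat_add_iff 1).2
      (summable_geometric_of_lt_one (r := (1 / 2 : ℝ)) (by norm_num) (by norm_num))).mul_left
        3).add (hes.mul_left 2)
  refine ⟨fun m => y (κ m) m, _, isAdmissibleBound_step (T := T) (κ := κ)
    (fun j => (Nat.succ_le_succ (Nat.zero_le j)).trans (hTk _)) (fun m j hj => ?_) hκm
    (fun j => ?_) hβs (b := 3 * B 0) (mul_nonneg (by norm_num) (hB0 0)), fun m n => ?_, fun k => ?_⟩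
  · exact (hTm hj).trans (hκ2 m (by omega))
  · have := he0 j
    positivity
  · set K := κ (m + n)
    have h1 := (hE0 K m n).trans (hBE K)
    have h2 := hcmp m K (hκm (Nat.le_add_right _ _))
    have h3 := hcmp n K (hκm (Nat.le_add_left _ _))
    have h4 := dist_add_le (y K m) (y K n) (y (κ m) m) (y (κ n) n)
    have h5 := dist_triangle (y K (m + n)) (y K m + y K n) (y (κ m) m + y (κ n) n)
    have h6 := hBsum K
    have h7 : ∑ j ∈ Finset.range K, (3 * (1 / 2 : ℝ) ^ (j + 1) + 2 * e j) * T (j + 1) =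
        3 * ∑ j ∈ Finset.range K, (1 / 2 : ℝ) ^ (j + 1) * T (j + 1) +
        2 * ∑ j ∈ Finset.range K, e j * T (j + 1) := by
      rw [Finset.mul_sum, Finset.mul_sum, ← Finset.sum_add_distrib]
      exact Finset.sum_congr rfl fun j _ => by ring
    rw [h7]
    linarith
  · intro η hη
    -- Beyond stage `K₀` the constant `B (κ m)` is at most η m; the earlier stages are absorbed in
    -- `B (K₀ + 1)`.
    obtain ⟨K₀, hK₀⟩ := exists_pow_lt_of_lt_one hη (show (1 / 2 : ℝ) < 1 by norm_num)
    set Q := ∑ j ∈ Finset.range k, e j * T (j + 1) + B k with hQ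
    have hQ0 : 0 ≤ Q := add_nonneg
      (Finset.sum_nonneg fun j _ => mul_nonneg (he0 j) (Nat.cast_nonneg _)) (hB0 k)
    refine ⟨Q + B (K₀ + 1), fun m => ?_⟩
    have hη' : 0 ≤ η * m := mul_nonneg hη.le (Nat.cast_nonneg m)
    have he' : 0 ≤ e k * m := mul_nonneg (he0 k) (Nat.cast_nonneg m)
    rw [add_mul]
    rcases le_total (κ m) k with h | h
    · linarith [hcmp m k h, hB0 (K₀ + 1)]
    · have h1 := (hc k (κ m) h m).trans (add_le_add_right (hBc k _ h) _)
      rcases le_total (κ m) (K₀ + 1) with h2 | h2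
      · linarith [hBm h2]
      · have h3 := hTB (κ m)
        have h4 : (1 / 2 : ℝ) ^ (κ m) * T (κ m) ≤ η * m := by
          refine mul_le_mul ?_ (Nat.cast_le.2 (hκ2 m (by omega))) (Nat.cast_nonneg _) hη.le
          exact (pow_le_pow_of_le_one (by norm_num) (by norm_num) (by omega)).trans hK₀.le
        linarith [hB0 (K₀ + 1)]

/-! ### Almost additive families -/

/-- If `z` is additive up to errors controlled by an admissible bound, then `z (M N)` is close
to `M` times `z N`. -/
theorem near_nsmul_of_defect (z : ℕ → ℕ → E) {φ : ℕ → ℝ} (hφ : IsAdmissibleBound φ) {L : ℝ}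
    (hL : 0 ≤ L)
    (h : ∀ a b, 1 ≤ a → 1 ≤ b → Near (z (a + b)) (z a + z b) (L * φ (a + b)))
    {ε : ℝ} (hε : 0 < ε) :
    ∃ N₀, ∀ N, N₀ ≤ N → ∀ M, 1 ≤ M → Near (z (M * N)) (M • z N) (ε * (M * N)) := by
  have hc := hφ.summable.hasSum.tendsto_sum_nat.cauchySeq
  -- Of the 8, a factor 4 is lost in comparing dyadic terms with the series and a factor 2 in
  -- rounding `M` up to a power of 2; `L + 1` absorbs `L` and is positive.
  obtain ⟨N₁, hN₁⟩ := Metric.cauchySeq_iff.1 hc (ε / (8 * (L + 1))) (by positivity)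
  refine ⟨N₁ + 1, fun N hN M hM => ?_⟩
  have hN0 : (0 : ℝ) < N := by exact_mod_cast (show 0 < N by omega)
  set s : ℕ → ℝ := fun k => ∑ j ∈ Finset.range k,
    φ (2 ^ (j + 1) * N) / (2 ^ (j + 1) * N) with hs
  have hs0 : ∀ k, 0 ≤ s k := fun k => Finset.sum_nonneg fun j _ =>
    div_nonneg (hφ.nonneg _) (by positivity)
  -- `M` is halved repeatedly. The splittings at each dyadic level contribute one term of `s`, the
  -- defect relative to the length.
  have claim : ∀ k M, 1 ≤ M → M ≤ 2 ^ k → Near (z (M * N)) (M • z N) (L * 2 ^ k * N * s k) := by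
    intro k
    have h1 : ∀ k, Near (z (1 * N)) (1 • z N) (L * 2 ^ k * N * s k) := by
      intro k
      rw [one_mul, one_nsmul]
      exact (Near.refl _).mono (by have := hs0 k; positivity)
    induction k with
    | zero =>
      intro M hM hM'
      obtain rfl : M = 1 := by simp at hM'; omega
      exact h1 0
    | succ k ih =>
      intro M hM hM'
      rcases hM.eq_or_lt with h2 | h2
      · rw [← h2]; exact h1 (k + 1)
      obtain ⟨a, b, rfl, ha, hb, ha', hb'⟩ : ∃ a b, M = a + b ∧ 1 ≤ a ∧ 1 ≤ b ∧ a ≤ 2 ^ k ∧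
          b ≤ 2 ^ k := by
        rw [pow_succ] at hM'
        exact ⟨M / 2, M - M / 2, by omega, by omega, by omega, by omega, by omega⟩
      have h3 := h (a * N) (b * N) (Nat.mul_pos ha (by omega)) (Nat.mul_pos hb (by omega))
      have h4 := h3.trans ((ih a ha ha').add (ih b hb hb'))
      rw [add_mul, add_nsmul]
      refine h4.mono ?_
      rw [← add_mul]
      have h5 : φ ((a + b) * N) ≤ φ (2 ^ (k + 1) * N) := hφ.mono (Nat.mul_le_mul_right N hM')
      have h6 : s (k + 1) = s k + φ (2 ^ (k + 1) * N) / (2 ^ (k + 1) * N) :=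
        Finset.sum_range_succ _ _
      have h7 : L * 2 ^ (k + 1) * N * s (k + 1) =
          L * 2 ^ k * N * s k + L * 2 ^ k * N * s k + L * φ (2 ^ (k + 1) * N) := by
        rw [h6]
        field_simp
        ring
      rw [h7]
      linarith [mul_le_mul_of_nonneg_left h5 hL]
  -- This is Cauchy condensation: by monotonicity the block from R to 2R contributes at least R ·
  -- φ(R)/(4R²) = φ(R)/(4R) to the series.
  have hdy : ∀ k, s k ≤ 4 * ∑ n ∈ Finset.Ico (2 * N) (2 ^ (k + 1) * N), φ n / (n : ℝ) ^ 2 := by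
    intro k
    induction k with
    | zero => simp [hs]
    | succ k ih =>
      have e1 : 2 * N ≤ 2 ^ (k + 1) * N :=
        Nat.mul_le_mul_right N (Nat.le_self_pow (Nat.succ_ne_zero k) 2)
      have e2 : 2 ^ (k + 1) * N ≤ 2 ^ (k + 1 + 1) * N :=
        Nat.mul_le_mul_right N (Nat.pow_le_pow_right two_pos (Nat.le_succ _))
      rw [← Finset.sum_Ico_consecutive _ e1 e2, mul_add]
      have h6 : s (k + 1) = s k + φ (2 ^ (k + 1) * N) / (2 ^ (k + 1) * N) :=
        Finset.sum_range_succ _ _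
      rw [h6]
      refine add_le_add ih ?_
      set R : ℕ := 2 ^ (k + 1) * N with hR
      have hR' : ((2 : ℝ) ^ (k + 1) * N) = R := by rw [hR]; push_cast; ring
      have hR2 : 2 ^ (k + 1 + 1) * N = 2 * R := by rw [hR]; ring
      have hR0 : (0 : ℝ) < R := by rw [← hR']; positivity
      rw [hR', hR2]
      have h8 : ∀ n ∈ Finset.Ico R (2 * R), φ R / (4 * (R : ℝ) ^ 2) ≤ φ n / (n : ℝ) ^ 2 := by
        intro n hn
        rw [Finset.mem_Ico] at hn
        have hn1 : (R : ℝ) ≤ n := by exact_mod_cast hn.1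
        have hn2 : (n : ℝ) ≤ 2 * R := by exact_mod_cast hn.2.le
        refine div_le_div₀ (hφ.nonneg _) (hφ.mono hn.1) (pow_pos (hR0.trans_le hn1) 2) ?_
        nlinarith
      have h9 := Finset.card_nsmul_le_sum _ _ _ h8
      rw [Nat.card_Ico, nsmul_eq_mul, show 2 * R - R = R by omega] at h9
      have h10 : φ R / R = 4 * (R * (φ R / (4 * (R : ℝ) ^ 2))) := by field_simp
      rw [h10]
      linarith
  have hsk : ∀ k, s k ≤ ε / (2 * (L + 1)) := by
    intro k
    refine (hdy k).trans ?_
    have e1 : 2 * N ≤ 2 ^ (k + 1) * N :=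
      Nat.mul_le_mul_right N (Nat.le_self_pow (Nat.succ_ne_zero k) 2)
    rw [Finset.sum_Ico_eq_sub _ e1]
    have h1 := hN₁ (2 ^ (k + 1) * N) (by show N₁ ≤ _; omega) (2 * N) (by show N₁ ≤ _; omega)
    rw [Real.dist_eq] at h1
    have h2 := (le_abs_self _).trans h1.le
    have h3 : ε / (2 * (L + 1)) = 4 * (ε / (8 * (L + 1))) := by field_simp; norm_num
    rw [h3]
    linarith
  have hk1 : M ≤ 2 ^ (Nat.log 2 M + 1) := (Nat.lt_pow_succ_log_self one_lt_two M).le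
  have hk2 : (2 : ℝ) ^ (Nat.log 2 M + 1) ≤ 2 * M := by
    rw [pow_succ, mul_comm]
    have := Nat.pow_log_le_self 2 (show M ≠ 0 by omega)
    have : ((2 ^ Nat.log 2 M : ℕ) : ℝ) ≤ M := by exact_mod_cast this
    push_cast at this
    linarith
  refine (claim _ M hM hk1).mono ?_
  calc L * 2 ^ (Nat.log 2 M + 1) * N * s (Nat.log 2 M + 1)
      ≤ L * (2 * M) * N * (ε / (2 * (L + 1))) := by
        have := hs0 (Nat.log 2 M + 1)
        gcongr
        exact hsk _
    _ = (L / (L + 1)) * (ε * (M * N)) := by field_simp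
    _ ≤ 1 * (ε * (M * N)) := by
        refine mul_le_mul_of_nonneg_right ?_ (by positivity)
        rw [div_le_one (by positivity)]
        linarith
    _ = ε * (M * N) := one_mul _

/-- Normalized conic combinations that are almost additive converge to an almost linear
sequence. -/
theorem exists_conic_limit {S : ℕ → Type*} [∀ n, Fintype (S n)] (c : ∀ n, S n → ℝ)
    (hc : ∀ n s, 0 ≤ c n s) (x : ∀ n, S n → E) {φ : ℕ → ℝ} (hφ : IsAdmissibleBound φ) {L : ℝ}
    (hL : 0 ≤ L)
    (h : ∀ a b, 1 ≤ a → 1 ≤ b → Near (conic (c (a + b)) (x (a + b)))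
      (conic (c a) (x a) + conic (c b) (x b)) (L * φ (a + b))) :
    ∃ (w : ℕ → E) (ψ : ℕ → ℝ), IsAdmissibleBound ψ ∧
      (∀ m n, dist (w (m + n)) (w m + w n) ≤ ψ (m + n)) ∧
      ∀ ε : ℝ, 0 < ε → ∃ N₀, ∀ N, N₀ ≤ N → Near (conic (fun s => c N s / N) (x N)) w ε := by
  set y : ℕ → ℕ → E := fun N => conic (fun s => c N s / N) (x N) with hy
  have hstep : ∀ ε : ℝ, 0 < ε → ∃ N₀, ∀ N, N₀ ≤ N → ∀ M, 1 ≤ M → Near (y (M * N)) (y N) ε := by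
    intro ε hε
    obtain ⟨N₀, hN₀⟩ := near_nsmul_of_defect (fun n => conic (c n) (x n)) hφ hL h hε
    refine ⟨N₀ + 1, fun N hN M hM => ?_⟩
    have hN0 : (0 : ℝ) < N := by exact_mod_cast (show 0 < N by omega)
    have hM0 : (0 : ℝ) < M := by exact_mod_cast (show 0 < M by omega)
    have h1 := (hN₀ N (by omega) M hM).trans (near_nsmul_conic (hc N) (x N) M)
    have h2 := h1.conic_div (hc _) (fun s => mul_nonneg hM0.le (hc N s)) (by positivity)
      (N := M * N) (Nat.mul_pos hM (by omega))
    have h3 : (fun s => (M : ℝ) * c N s / ((M * N : ℕ) : ℝ)) = fun s => c N s / N := by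
      funext s
      push_cast
      field_simp
    rw [h3] at h2
    refine h2.mono (le_of_eq ?_)
    push_cast
    field_simp
    ring
  -- `y N` and `y N'` are both compared with the term at the common multiple N N'.
  have hcauchy : ∀ ε : ℝ, 0 < ε → ∃ N₀, ∀ N N', N₀ ≤ N → N₀ ≤ N' → Near (y N) (y N') ε := by
    intro ε hε
    obtain ⟨N₀, hN₀⟩ := hstep (ε / 2) (half_pos hε)
    refine ⟨N₀ + 1, fun N N' hN hN' => ?_⟩
    have h1 := hN₀ N (by omega) N' (by omega)
    have h2 := hN₀ N' (by omega) N (by omega)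
    rw [mul_comm] at h2
    exact (h1.symm.trans h2).mono (by linarith)
  have hpow : ∀ k : ℕ, (0 : ℝ) < (1 / 2) ^ k := fun k => by positivity
  choose N₀ hN₀ using fun k : ℕ => hcauchy ((1 / 2) ^ k) (hpow k)
  -- Summing the thresholds makes `n k` exceed all `N₀ j` with j ≤ k, which yields a subsequence
  -- with summable Cauchy errors.
  set n : ℕ → ℕ := fun k => ∑ j ∈ Finset.range (k + 1), N₀ j with hn
  have hn' : ∀ j k, j ≤ k → N₀ j ≤ n k := fun j k hjk =>
    Finset.single_le_sum (f := N₀) (fun _ _ => Nat.zero_le _) (Finset.mem_range.2 (by omega))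
  obtain ⟨w, ψ, hψ, hw, hlim⟩ := exists_near_limit (fun k => y (n k))
    (fun k => conic_add_bounded (fun s => div_nonneg (hc _ s) (Nat.cast_nonneg _)) _)
    (ε := fun k => (1 / 2) ^ k) (fun k => (hpow k).le)
    (summable_geometric_of_lt_one (by norm_num) (by norm_num))
    (fun j k hjk => hN₀ j _ _ (hn' j j le_rfl) (hn' j k hjk))
  refine ⟨w, ψ, hψ, hw, fun ε hε => ?_⟩
  obtain ⟨k, hk⟩ := exists_pow_lt_of_lt_one (show 0 < ε / 3 by positivity)
    (show (1 / 2 : ℝ) < 1 by norm_num)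
  refine ⟨N₀ k, fun N hN => ?_⟩
  exact ((hN₀ k N (n k) hN (hn' k k le_rfl)).trans (hlim k)).mono (by linarith)

end Monoid

section Diagrams

variable {G : Type*} [SemilatticeInf G]

/-! ### Isomorphisms of diagrams -/

/-- The diagram of one-point spaces. -/
def pointDiagram (G : Type*) [SemilatticeInf G] : G ⥤ FinProb := (Functor.const G).obj point

/-- Families of weight-preserving bijections that commute with the structure maps. -/
def homOfBijective {X Y : G ⥤ FinProb} (e : ∀ i, (X.obj i).carrier → (Y.obj i).carrier)
    (he : ∀ i, Function.Bijective (e i)) (hw : ∀ i a, (Y.obj i).weight (e i a) = (X.obj i).weight a)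
    (hn : ∀ i j (f : i ⟶ j) a, e j (Hom.toFun (X.map f) a) = Hom.toFun (Y.map f) (e i a)) :
    X ⟶ Y where
  app i := ⟨e i, IsMeasurePreserving.of_bijective (he i) (hw i)⟩
  naturality i j f := Hom.ext (funext fun a => hn i j f a)

section Fin
variable [Fintype G]

theorem kd_eq_zero_of_bijective {X Y : G ⥤ FinProb} (e : ∀ i, (X.obj i).carrier ≃ (Y.obj i).carrier)
    (hw : ∀ i a, (Y.obj i).weight (e i a) = (X.obj i).weight a)
    (hn : ∀ i j (f : i ⟶ j) a, e j (Hom.toFun (X.map f) a) = Hom.toFun (Y.map f) (e i a)) :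
    kd X Y = 0 :=
  kd_eq_zero_of_injective (homOfBijective (fun i => e i) (fun i => (e i).bijective) hw hn)
    fun i => (e i).injective

theorem kd_tensor_comm (X Y : G ⥤ FinProb) : kd (tensorDiagram X Y) (tensorDiagram Y X) = 0 :=
  kd_eq_zero_of_bijective (X := tensorDiagram X Y) (Y := tensorDiagram Y X)
    (fun i => Equiv.prodComm (X.obj i).carrier (Y.obj i).carrier)
    (fun i a => mul_comm ((Y.obj i).weight a.2) ((X.obj i).weight a.1)) (fun _ _ _ _ => rfl)

theorem kd_tensor_assoc (X Y Z : G ⥤ FinProb) :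
    kd (tensorDiagram (tensorDiagram X Y) Z) (tensorDiagram X (tensorDiagram Y Z)) = 0 :=
  kd_eq_zero_of_bijective (X := tensorDiagram (tensorDiagram X Y) Z)
    (Y := tensorDiagram X (tensorDiagram Y Z))
    (fun i => Equiv.prodAssoc (X.obj i).carrier (Y.obj i).carrier (Z.obj i).carrier)
    (fun i a => (mul_assoc ((X.obj i).weight a.1.1) ((Y.obj i).weight a.1.2)
      ((Z.obj i).weight a.2)).symm) (fun _ _ _ _ => rfl)

theorem kd_tensor_point (X : G ⥤ FinProb) : kd (tensorDiagram X (pointDiagram G)) X = 0 :=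
  kd_eq_zero_of_injective (tensorFst X (pointDiagram G))
    fun _ _ _ h => Prod.ext h rfl

end Fin

/-! ### Mixtures of diagrams -/

section Mixture

/-- The cost of replacing a diagram by a mixture. -/
def mixtureCost [Fintype G] (P : FinProb) (D : P.carrier → (G ⥤ FinProb)) (X : G ⥤ FinProb) : ℝ :=
  ∑ i, (2 * P.entropy + ∑ s, P.weight s * ((D s).obj i).entropy - (X.obj i).entropy)

/-- The cost of an exchange does not depend on the other factors present. This provides the
arbitrary summand `r` in the hypothesis of `near_conic_of_mixture`. -/
theorem mixtureCost_tensor [Fintype G] {P : FinProb} {D : P.carrier → (G ⥤ FinProb)}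
    {X : G ⥤ FinProb} (R : G ⥤ FinProb) :
    mixtureCost P (fun s => tensorDiagram (D s) R) (tensorDiagram X R) = mixtureCost P D X := by
  refine Finset.sum_congr rfl fun i _ => ?_
  simp only [entropy_tensorDiagram, mul_add, Finset.sum_add_distrib, ← Finset.sum_mul,
    P.sum_weight]
  ring

variable [OrderBot G]

/-- The diagram `X` is a mixture of the diagrams `D s` with the weights of `P`: there are maps
`D s → X` of diagrams of sets through which the distribution of the initial space of `X` is the
average of those of `D s`. -/
structure IsMixture (P : FinProb) (D : P.carrier → (G ⥤ FinProb)) (X : G ⥤ FinProb)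
    (ι : ∀ s i, ((D s).obj i).carrier → (X.obj i).carrier) : Prop where
  initial : ∀ s i c, fromInitial X i (ι s ⊥ c) = ι s i (fromInitial (D s) i c)
  average : ∀ φ : (X.obj ⊥).carrier → ℝ, ∑ b, (X.obj ⊥).weight b * φ b =
    ∑ s, P.weight s * ∑ c, ((D s).obj ⊥).weight c * φ (ι s ⊥ c)

theorem IsMixture.tensor {P : FinProb} {D : P.carrier → (G ⥤ FinProb)} {X : G ⥤ FinProb}
    {ι : ∀ s i, ((D s).obj i).carrier → (X.obj i).carrier} (h : IsMixture P D X ι)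
    (R : G ⥤ FinProb) :
    IsMixture P (fun s => tensorDiagram (D s) R) (tensorDiagram X R)
      (fun s i c => (ι s i c.1, c.2)) where
  initial s i c := Prod.ext (h.initial s i c.1) rfl
  average φ := by
    refine (sum_tensor fun a b => φ (a, b)).trans ?_
    rw [h.average]
    refine Finset.sum_congr rfl fun s _ => ?_
    congr 1
    exact (sum_tensor (X := (D s).obj ⊥) (Y := R.obj ⊥) fun a b => φ (ι s ⊥ a, b)).symm

/-- Nearly optimal fans from each `D s` to `Y` are mixed into one coupling of `X` and `Y`. Not
knowing `s` costs at most H(P) at each index, counted twice in `kd`. -/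
theorem IsMixture.kd_le [Fintype G] {P : FinProb} {D : P.carrier → (G ⥤ FinProb)} {X : G ⥤ FinProb}
    {ι : ∀ s i, ((D s).obj i).carrier → (X.obj i).carrier} (h : IsMixture P D X ι)
    (Y : G ⥤ FinProb) :
    kd X Y ≤ mixtureCost P D X + ∑ s, P.weight s * kd (D s) Y := by
  classical
  refine le_of_forall_pos_le_add fun η hη => ?_
  choose F f g hF using fun s => exists_fan_lt (D s) Y hη
  have hα : IsMeasurePreserving (mixture P fun s => (F s).obj ⊥) (X.obj ⊥)
      (fun a => ι a.1 ⊥ (Hom.toFun ((f a.1).app ⊥) a.2)) := by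
    intro b
    change FinProb.mass _ _ b = _
    rw [mass_mixture (D := fun s => (F s).obj ⊥)
      fun s a => ι s ⊥ (Hom.toFun ((f s).app ⊥) a)]
    have h1 := h.average fun b' => if b' = b then 1 else 0
    simp only [mul_ite, mul_one, mul_zero, Finset.sum_ite_eq', Finset.mem_univ, if_true] at h1
    rw [h1]
    refine Finset.sum_congr rfl fun s _ => ?_
    rw [(Hom.preserving ((f s).app ⊥)).mass_comp (fun c => ι s ⊥ c), mass_eq_sum_ite]
    simp
  have hβ : IsMeasurePreserving (mixture P fun s => (F s).obj ⊥) (Y.obj ⊥)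
      (fun a => Hom.toFun ((g a.1).app ⊥) a.2) := by
    intro b
    change FinProb.mass _ _ b = _
    rw [mass_mixture (D := fun s => (F s).obj ⊥) fun s a => Hom.toFun ((g s).app ⊥) a]
    rw [Finset.sum_congr rfl fun s _ => by
      rw [show ((F s).obj ⊥).mass (fun a => Hom.toFun ((g s).app ⊥) a) b = (Y.obj ⊥).weight b from
        Hom.preserving ((g s).app ⊥) b], ← Finset.sum_mul, P.sum_weight, one_mul]
  have key : ∀ i, (mixture P fun s => (F s).obj ⊥).ent (fun a =>
      (fromInitial X i (ι a.1 ⊥ (Hom.toFun ((f a.1).app ⊥) a.2)),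
        fromInitial Y i (Hom.toFun ((g a.1).app ⊥) a.2))) ≤
      P.entropy + ∑ s, P.weight s * ((F s).obj i).entropy := by
    intro i
    refine (ent_mixture_le (D := fun s => (F s).obj ⊥) fun s a =>
      (fromInitial X i (ι s ⊥ (Hom.toFun ((f s).app ⊥) a)),
        fromInitial Y i (Hom.toFun ((g s).app ⊥) a))).trans ?_
    refine add_le_add_right (Finset.sum_le_sum fun s _ =>
      mul_le_mul_of_nonneg_left ?_ (P.weight_pos s).le) _
    rw [← (isMeasurePreserving_fromInitial (F s) i).ent_eq]
    refine ent_mono fun a b hab => ?_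
    rw [h.initial, h.initial, fromInitial_app, fromInitial_app, fromInitial_app, fromInitial_app,
      hab]
  refine (kd_le_of_coupling hα hβ).trans ?_
  have h1 : ∀ i, 2 * (mixture P fun s => (F s).obj ⊥).ent (fun a =>
      (fromInitial X i (ι a.1 ⊥ (Hom.toFun ((f a.1).app ⊥) a.2)),
        fromInitial Y i (Hom.toFun ((g a.1).app ⊥) a.2))) - (X.obj i).entropy -
      (Y.obj i).entropy ≤
      (2 * P.entropy + ∑ s, P.weight s * ((D s).obj i).entropy - (X.obj i).entropy) +
      ∑ s, P.weight s *
        (2 * ((F s).obj i).entropy - ((D s).obj i).entropy - (Y.obj i).entropy) := by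
    intro i
    have h2 : ∑ s, P.weight s *
        (2 * ((F s).obj i).entropy - ((D s).obj i).entropy - (Y.obj i).entropy) =
        2 * ∑ s, P.weight s * ((F s).obj i).entropy - ∑ s, P.weight s * ((D s).obj i).entropy -
          (Y.obj i).entropy := by
      have e : (Y.obj i).entropy = ∑ s, P.weight s * (Y.obj i).entropy := by
        rw [← Finset.sum_mul, P.sum_weight, one_mul]
      conv_rhs => rw [e, Finset.mul_sum, ← Finset.sum_sub_distrib, ← Finset.sum_sub_distrib]
      exact Finset.sum_congr rfl fun s _ => by ring
    rw [h2]
    linarith [key i]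
  refine (Finset.sum_le_sum fun i _ => h1 i).trans ?_
  rw [Finset.sum_add_distrib, add_assoc]
  refine add_le_add_right ?_ _
  rw [Finset.sum_comm]
  have h3 : ∑ s, P.weight s * kd (D s) Y + η = ∑ s, P.weight s * (kd (D s) Y + η) := by
    simp only [mul_add, Finset.sum_add_distrib, ← Finset.sum_mul, P.sum_weight, one_mul]
  rw [h3]
  refine Finset.sum_le_sum fun s _ => ?_
  rw [← Finset.mul_sum]
  exact mul_le_mul_of_nonneg_left (hF s).le (P.weight_pos s).le

end Mixture

/-! ### The metric monoid of diagrams up to distance zero -/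

variable (G) in
/-- Diagrams up to intrinsic entropy distance zero. -/
def diagramSetoid [OrderBot G] [Finite G] : Setoid (G ⥤ FinProb) where
  r X Y := kd X Y = 0
  iseqv := by
    cases nonempty_fintype G
    refine ⟨kd_self, fun {X Y} h => by rw [kd_comm, h], fun {X Y Z} h h' => ?_⟩
    exact le_antisymm ((kd_triangle X Y Z).trans_eq (by rw [h, h', add_zero])) (kd_nonneg _ _)

variable (G) in
/-- The commutative monoid of diagrams up to intrinsic entropy distance zero. -/
def DiagramClass [OrderBot G] [Finite G] := Quotient (diagramSetoid G)

variable [OrderBot G]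

section Classes

variable [Finite G]

/-- The class of a diagram. -/
def cls (X : G ⥤ FinProb) : DiagramClass G := Quotient.mk (diagramSetoid G) X

theorem cls_eq {X Y : G ⥤ FinProb} (h : kd X Y = 0) : cls X = cls Y :=
  Quotient.sound (s := diagramSetoid G) h

theorem cls_surjective : Function.Surjective (cls (G := G)) := Quotient.exists_rep

namespace DiagramClass

instance : Zero (DiagramClass G) := ⟨cls (pointDiagram G)⟩

instance : Add (DiagramClass G) where
  add := Quotient.map₂ tensorDiagram (by
    cases nonempty_fintype G
    intro X X' h Y Y' h'
    refine le_antisymm ((kd_tensor_le X Y X' Y').trans_eq ?_) (kd_nonneg _ _)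
    rw [show kd X X' = 0 from h, show kd Y Y' = 0 from h', add_zero])

instance : AddCommMonoid (DiagramClass G) where
  nsmul := nsmulRec
  add_assoc := by
    cases nonempty_fintype G
    rintro ⟨X⟩ ⟨Y⟩ ⟨Z⟩
    exact cls_eq (kd_tensor_assoc X Y Z)
  add_comm := by
    cases nonempty_fintype G
    rintro ⟨X⟩ ⟨Y⟩
    exact cls_eq (kd_tensor_comm X Y)
  add_zero := by
    cases nonempty_fintype G
    rintro ⟨X⟩
    exact cls_eq (kd_tensor_point X)
  zero_add := by
    cases nonempty_fintype G
    rintro ⟨X⟩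
    exact cls_eq ((kd_eq_zero_of_injective (tensorSnd (pointDiagram G) X)
      fun _ _ _ h => Prod.ext rfl h))

instance : PseudoMetricSpace (DiagramClass G) where
  dist := Quotient.lift₂ kd (by
    cases nonempty_fintype G
    intro X Y X' Y' (h : kd X X' = 0) (h' : kd Y Y' = 0)
    have h1 := kd_triangle X X' Y
    have h2 := kd_triangle X' Y' Y
    have h3 := kd_triangle X' X Y'
    have h4 := kd_triangle X Y Y'
    rw [kd_comm Y' Y] at h2
    rw [kd_comm X' X] at h3
    linarith)
  dist_self := by
    cases nonempty_fintype G
    rintro ⟨X⟩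
    exact kd_self X
  dist_comm := by
    rintro ⟨X⟩ ⟨Y⟩
    exact kd_comm X Y
  dist_triangle := by
    cases nonempty_fintype G
    rintro ⟨X⟩ ⟨Y⟩ ⟨Z⟩
    exact kd_triangle X Y Z

end DiagramClass

theorem dist_cls (X Y : G ⥤ FinProb) : dist (cls X) (cls Y) = kd X Y := rfl

theorem cls_tensor (X Y : G ⥤ FinProb) : cls (tensorDiagram X Y) = cls X + cls Y := rfl

instance : NonexpansiveAdd (DiagramClass G) where
  dist_add_add_le := by
    cases nonempty_fintype G
    rintro ⟨X⟩ ⟨Y⟩ ⟨Z⟩ ⟨W⟩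
    exact kd_tensor_le X Y Z W

theorem cls_eq_zero_of_entropy {X : G ⥤ FinProb} (h : ∀ i, (X.obj i).entropy = 0) :
    cls X = 0 := by
  cases nonempty_fintype G
  let f : X ⟶ pointDiagram G :=
    { app := fun i => ⟨fun _ => (), isMeasurePreserving_point _⟩
      naturality := fun _ _ _ => rfl }
  refine cls_eq (le_antisymm ((kd_le_of_hom f).trans_eq ?_) (kd_nonneg _ _))
  refine Finset.sum_eq_zero fun i _ => ?_
  rw [h, show ((pointDiagram G).obj i).entropy = 0 from
    have : Subsingleton ((pointDiagram G).obj i).carrier := inferInstanceAs (Subsingleton Unit)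
    entropy_eq_zero_of_subsingleton, sub_self]

theorem cls_piDiagram {ι : Type} [Fintype ι] (X : ι → (G ⥤ FinProb)) :
    cls (piDiagram X) = ∑ k, cls (X k) := by
  cases nonempty_fintype G
  refine Fintype.induction_empty_option (P := fun ι _ => ∀ X : ι → (G ⥤ FinProb),
    cls (piDiagram X) = ∑ k, cls (X k)) ?_ ?_ ?_ ι X
  · intro α β _ e ih X
    let := Fintype.ofEquiv β e.symm
    rw [← e.sum_comp, ← ih fun k => X (e k)]
    refine cls_eq (kd_eq_zero_of_bijective (X := piDiagram X) (Y := piDiagram fun k => X (e k))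
      (fun i => (Equiv.piCongrLeft (fun b => ((X b).obj i).carrier) e).symm) ?_ ?_)
    · intro i a
      exact e.prod_comp fun k => ((X k).obj i).weight (a k)
    · intro i j f a
      rfl
  · intro X
    rw [Finset.univ_eq_empty, Finset.sum_empty]
    refine cls_eq_zero_of_entropy fun i => ?_
    have : Subsingleton ((piDiagram X).obj i).carrier :=
      inferInstanceAs (Subsingleton (∀ k : PEmpty, ((X k).obj i).carrier))
    exact entropy_eq_zero_of_subsingleton
  · intro α _ ih X
    rw [Fintype.sum_option, ← ih fun k => X (some k), ← cls_tensor]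
    refine cls_eq (kd_eq_zero_of_bijective (X := piDiagram X)
      (Y := tensorDiagram (X none) (piDiagram fun k => X (some k)))
      (fun i => Equiv.piOptionEquivProd (β := fun k => ((X k).obj i).carrier)) ?_ ?_)
    · intro i a
      exact (Fintype.prod_option fun k => ((X k).obj i).weight (a k)).symm
    · intro i j f a
      rfl

/-- This is the passage from tensor products of diagrams to the abstract monoid, where the limit
theorems were proved. -/
theorem cls_conicCombination {S : Type} [Fintype S] (c : S → ℝ) (D : S → (G ⥤ FinProb)) (m : ℕ) :
    cls (conicCombination c D m) = conic c (fun s => cls (D s)) m := by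
  rw [conicCombination, cls_piDiagram, Fintype.sum_sigma]
  simp [conic]

end Classes

theorem IsMixture.near [Fintype G] {P : FinProb} {D : P.carrier → (G ⥤ FinProb)} {X : G ⥤ FinProb}
    {ι : ∀ s i, ((D s).obj i).carrier → (X.obj i).carrier} (h : IsMixture P D X ι) :
    Near (fun m => m • cls X) (conic P.weight fun s => cls (D s)) (mixtureCost P D X) := by
  refine near_conic_of_mixture (fun s => (P.weight_pos s).le) P.sum_weight fun r y => ?_
  obtain ⟨R, rfl⟩ := cls_surjective r
  obtain ⟨Y, rfl⟩ := cls_surjective y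
  have := (h.tensor R).kd_le Y
  rw [mixtureCost_tensor] at this
  exact this

end Diagrams

/-- A negative slope would eventually force a negative distance. Applied to mixtures, this gives the
sign of the cost, which `comp_floor` needs, without any entropy computation. -/
theorem Near.nonneg {E : Type*} [PseudoMetricSpace E] {x y : ℕ → E} {δ : ℝ} (h : Near x y δ) :
    0 ≤ δ := by
  by_contra hδ
  push Not at hδ
  obtain ⟨C, hC⟩ := h (-δ / 2) (by linarith)
  obtain ⟨m, hm⟩ := exists_nat_gt (C / (-δ / 2))
  rw [div_lt_iff₀ (by linarith)] at hm
  linarith [hC m, dist_nonneg (x := x m) (y := y m)]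

/-! ### Fibres of measure-preserving maps -/

namespace FinProb

section
variable {X Y : FinProb} {g : X.carrier → Y.carrier}

theorem IsMeasurePreserving.condition_weight (hg : IsMeasurePreserving X Y g) (y : Y.carrier)
    (hs : {x | g x = y}.Nonempty) (a : (X.condition {x | g x = y} hs).carrier) :
    (X.condition {x | g x = y} hs).weight a = X.weight a.1 / Y.weight y := by
  classical
  rw [← hg y]
  change X.weight a.1 / _ = _
  congr 1

theorem sum_sum_condition (hs : ∀ y, {x | g x = y}.Nonempty) {M : Type*} [AddCommMonoid M]
    (F : X.carrier → M) :
    ∑ y, ∑ a : (X.condition {x | g x = y} (hs y)).carrier, F a.1 = ∑ x, F x := by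
  classical
  rw [← Finset.sum_fiberwise (s := Finset.univ) (g := g) (f := F)]
  refine Finset.sum_congr rfl fun y _ => ?_
  let : Fintype {x | g x = y} := Fintype.ofFinite _
  change ∑ a : {x | g x = y}, F a.1 = _
  exact (Finset.sum_subtype _ (by simp) F).symm

theorem IsMeasurePreserving.weight_le (hg : IsMeasurePreserving X Y g) (a : X.carrier) :
    X.weight a ≤ Y.weight (g a) := by
  classical
  rw [← hg (g a)]
  exact Finset.single_le_sum (f := X.weight) (fun a _ => (X.weight_pos a).le)
    (Finset.mem_filter.2 ⟨Finset.mem_univ _, rfl⟩)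

theorem IsMeasurePreserving.surjective (hg : IsMeasurePreserving X Y g) :
    Function.Surjective g := by
  classical
  intro b
  by_contra h
  have h1 := hg b
  rw [Finset.sum_eq_zero] at h1
  · exact absurd h1 (Y.weight_pos b).ne
  · intro a ha
    exact absurd ⟨a, (Finset.mem_filter.1 ha).2⟩ h

end

end FinProb

section Diagrams

variable {G : Type*} [SemilatticeInf G] [OrderBot G]

/-! ### Conditional diagrams -/

theorem sum_condDiagram (Z : G ⥤ FinProb) (u i : G) (a : (Z.obj u).carrier)
    (φ : (Z.obj i).carrier → ℝ) :
    (Z.obj u).weight a * ∑ b : ((condDiagram Z u a).obj i).carrier,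
        ((condDiagram Z u a).obj i).weight b * φ b.1 =
      ∑ z, open Classical in if fromInitial Z u z = a then
        (Z.obj ⊥).weight z * φ (fromInitial Z i z) else 0 := by
  classical
  rw [← (isMeasurePreserving_fromInitial Z u).sum_condition a (fromInitial_surjective Z u a)
    fun z => φ (fromInitial Z i z)]
  congr 1
  exact ((isMeasurePreserving_toImage (X := condInitial Z u a)
    fun z : {z | fromInitial Z u z = a} => fromInitial Z i z.1).sum_comp fun b => φ b.1).symm

theorem sum_entropy_condDiagram (Z : G ⥤ FinProb) (u i : G) :
    ∑ a, (Z.obj u).weight a * ((condDiagram Z u a).obj i).entropy =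
      jointEntropy Z i u - (Z.obj u).entropy := by
  rw [jointEntropy_eq, ← (isMeasurePreserving_fromInitial Z u).sum_ent_condition
    (fun a => fromInitial_surjective Z u a)]
  refine Finset.sum_congr rfl fun a _ => ?_
  congr 1
  exact entropy_image (X := condInitial Z u a)
    fun z : {z | fromInitial Z u z = a} => fromInitial Z i z.1

/-- The distribution of the preimages of `a` in the space of `W` with index `u`. -/
def fiberDistribution {W Z : G ⥤ FinProb} (f : W ⟶ Z) (u : G) (a : (Z.obj u).carrier) : FinProb :=
  (W.obj u).condition {v | Hom.toFun (f.app u) v = a} ((Hom.preserving (f.app u)).surjective a)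

/-- The map of conditional diagrams induced by a morphism. -/
def condMap {W Z : G ⥤ FinProb} (f : W ⟶ Z) (u : G) (v : (W.obj u).carrier)
    (a : (Z.obj u).carrier) (h : Hom.toFun (f.app u) v = a) (i : G)
    (c : ((condDiagram W u v).obj i).carrier) : ((condDiagram Z u a).obj i).carrier :=
  ⟨Hom.toFun (f.app i) c.1, by
    obtain ⟨⟨w, hw⟩, hc⟩ := c.2
    have hw' : fromInitial W u w = v := hw
    refine ⟨⟨Hom.toFun (f.app ⊥) w, ?_⟩, ?_⟩
    · change fromInitial Z u _ = a
      rw [fromInitial_app, hw', h]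
    · rw [← hc]
      exact fromInitial_app f i w⟩

variable (x : G)

/-- If `f : W → Z`, then `⌈x⌉` of `Z`, conditioned on `a`, is a mixture of the diagrams `⌈x⌉` of
`W`, conditioned on the preimages of `a`. -/
theorem isMixture_condDiagram {W Z : G ⥤ FinProb} (f : W ⟶ Z) (u : G) (a : (Z.obj u).carrier) :
    IsMixture (fiberDistribution f u a)
      (fun v : {v | Hom.toFun (f.app u) v = a} => restrictDiagram x (condDiagram W u v.1))
      (restrictDiagram x (condDiagram Z u a))
      (fun v i c => condMap f u v.1 a v.2 i.1 c) where
  initial v i c := Subtype.ext (naturality_toFun f (homOfLE i.2 : x ⟶ i.1) c.1)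
  average φ := by
    classical
    -- Only some atoms of the space at `x` occur once `a` is given; extending the test function by
    -- zero lets all sums run over unconditioned spaces.
    obtain ⟨ψ, hψ⟩ : ∃ ψ : (Z.obj x).carrier → ℝ,
        ∀ b : ((condDiagram Z u a).obj x).carrier, φ b = ψ b.1 := by
      exact ⟨Function.extend (fun b : ((condDiagram Z u a).obj x).carrier => b.1) φ 0,
        fun b => (Function.Injective.extend_apply Subtype.val_injective φ 0 b).symm⟩
    have hp := (Z.obj u).weight_pos a
    refine mul_left_cancel₀ hp.ne' ?_
    have h1 : (Z.obj u).weight a * ∑ b : ((condDiagram Z u a).obj x).carrier,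
        ((condDiagram Z u a).obj x).weight b * φ b =
        ∑ z, if fromInitial Z u z = a then
          (Z.obj ⊥).weight z * ψ (fromInitial Z x z) else 0 := by
      rw [← sum_condDiagram]
      simp only [hψ]
    have h2 : (Z.obj u).weight a * ∑ v : (fiberDistribution f u a).carrier,
        (fiberDistribution f u a).weight v * ∑ c : ((condDiagram W u v.1).obj x).carrier,
          ((condDiagram W u v.1).obj x).weight c * ψ (Hom.toFun (f.app x) c.1) =
        ∑ v, if Hom.toFun (f.app u) v = a then (W.obj u).weight v *
          ∑ c : ((condDiagram W u v).obj x).carrier,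
          ((condDiagram W u v).obj x).weight c * ψ (Hom.toFun (f.app x) c.1) else 0 :=
      (Hom.preserving (f.app u)).sum_condition a ((Hom.preserving (f.app u)).surjective a) fun v =>
        ∑ c : ((condDiagram W u v).obj x).carrier,
          ((condDiagram W u v).obj x).weight c * ψ (Hom.toFun (f.app x) c.1)
    refine (h1.trans ?_).trans (h2.symm.trans ?_)
    · simp only [sum_condDiagram W u x _ fun c => ψ (Hom.toFun (f.app x) c)]
      have h3 := (Hom.preserving (f.app ⊥)).sum_comp fun z => if fromInitial Z u z = a then
          ψ (fromInitial Z x z) else 0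
      simp only [mul_ite, mul_zero, fromInitial_app] at h3
      rw [← h3]
      simp only [← Finset.sum_filter]
      rw [← Finset.sum_fiberwise_of_maps_to
        (s := Finset.univ.filter fun w => Hom.toFun (f.app u) (fromInitial W u w) = a)
        (t := Finset.univ.filter fun v => Hom.toFun (f.app u) v = a) (g := fromInitial W u)
        (by simp)]
      refine Finset.sum_congr rfl fun v hv => Finset.sum_congr ?_ fun _ _ => rfl
      ext w
      simp only [Finset.mem_filter, Finset.mem_univ, true_and] at hv ⊢
      exact ⟨fun h => h.2, fun h => ⟨by rw [h, hv], h⟩⟩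
    · congr 1
      refine Finset.sum_congr rfl fun v _ => ?_
      congr 1
      refine Finset.sum_congr rfl fun c _ => ?_
      congr 1
      exact (hψ (condMap f u v.1 a v.2 x c)).symm

/-- By the chain rule, the average cost at an index i is the loss H(W_u) - H(Z_u) plus the loss of
joint entropy at (i, u). The latter is at most the losses at i and at u together, so three single
losses bound the cost at each descendant of `x`. -/
theorem sum_mixtureCost_le [Fintype G] [Fintype (Set.Ici x)] {W Z : G ⥤ FinProb} (f : W ⟶ Z)
    (u : G) :
    ∑ a, (Z.obj u).weight a * mixtureCost (fiberDistribution f u a)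
      (fun v : {v | Hom.toFun (f.app u) v = a} => restrictDiagram x (condDiagram W u v.1))
      (restrictDiagram x (condDiagram Z u a)) ≤
    3 * Fintype.card (Set.Ici x) * ∑ i, ((W.obj i).entropy - (Z.obj i).entropy) := by
  classical
  have hp := Hom.preserving (f.app u)
  have h1 : ∑ a, (Z.obj u).weight a * (fiberDistribution f u a).entropy =
      (W.obj u).entropy - (Z.obj u).entropy :=
    hp.sum_entropy_condition fun a => hp.surjective a
  have h2 : ∀ i : G, ∑ a, (Z.obj u).weight a * ∑ v : (fiberDistribution f u a).carrier,
      (fiberDistribution f u a).weight v * ((condDiagram W u v.1).obj i).entropy =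
      jointEntropy W i u - (W.obj u).entropy := by
    intro i
    have h3 : ∀ a, (Z.obj u).weight a * ∑ v : (fiberDistribution f u a).carrier,
        (fiberDistribution f u a).weight v * ((condDiagram W u v.1).obj i).entropy =
        ∑ v, if Hom.toFun (f.app u) v = a then (W.obj u).weight v *
          ((condDiagram W u v).obj i).entropy else 0 := fun a =>
      hp.sum_condition a (hp.surjective a) fun v => ((condDiagram W u v).obj i).entropy
    rw [Finset.sum_congr rfl fun a _ => h3 a, Finset.sum_comm, ← sum_entropy_condDiagram]
    simp
  have hnn : ∀ i, 0 ≤ (W.obj i).entropy - (Z.obj i).entropy := fun i =>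
    sub_nonneg.2 (Hom.preserving (f.app i)).entropy_le
  have hle : ∀ i, (W.obj i).entropy - (Z.obj i).entropy ≤
      ∑ i, ((W.obj i).entropy - (Z.obj i).entropy) := fun i =>
    Finset.single_le_sum (fun i _ => hnn i) (Finset.mem_univ i)
  have h4 : ∀ i : Set.Ici x, ∑ a, (Z.obj u).weight a * (2 * (fiberDistribution f u a).entropy +
      ∑ v : (fiberDistribution f u a).carrier, (fiberDistribution f u a).weight v *
        ((condDiagram W u v.1).obj i.1).entropy - ((condDiagram Z u a).obj i.1).entropy) ≤
      3 * ∑ i, ((W.obj i).entropy - (Z.obj i).entropy) := by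
    intro i
    have e : ∑ a, (Z.obj u).weight a * (2 * (fiberDistribution f u a).entropy +
      ∑ v : (fiberDistribution f u a).carrier, (fiberDistribution f u a).weight v *
        ((condDiagram W u v.1).obj i.1).entropy - ((condDiagram Z u a).obj i.1).entropy) =
      2 * ∑ a, (Z.obj u).weight a * (fiberDistribution f u a).entropy +
      ∑ a, (Z.obj u).weight a * ∑ v : (fiberDistribution f u a).carrier,
        (fiberDistribution f u a).weight v * ((condDiagram W u v.1).obj i.1).entropy -
      ∑ a, (Z.obj u).weight a * ((condDiagram Z u a).obj i.1).entropy := by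
      rw [Finset.mul_sum, ← Finset.sum_add_distrib, ← Finset.sum_sub_distrib]
      exact Finset.sum_congr rfl fun a _ => by ring
    rw [e, h1, h2, sum_entropy_condDiagram]
    linarith [jointEntropy_le_of_hom f i.1 u, hle i.1, hle u]
  have h5 := Finset.sum_le_sum fun i (_ : i ∈ Finset.univ) => h4 i
  rw [Finset.sum_const, Finset.card_univ, nsmul_eq_mul] at h5
  refine le_trans (le_of_eq ?_) (h5.trans_eq (by ring))
  rw [Finset.sum_comm]
  exact Finset.sum_congr rfl fun a _ => Finset.mul_sum _ _ _

section Classes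

variable [Finite G]

/-- The class of `⌈x⌉`, conditioned on the atom `a`. -/
def condClass (u : G) (Z : G ⥤ FinProb) (a : (Z.obj u).carrier) : DiagramClass (Set.Ici x) :=
  cls (restrictDiagram x (condDiagram Z u a))

/-- The sequence which represents the conditioned diagram `∫ [⌈x⌉ | a] dp(a)`. -/
def condConic (u : G) (Z : G ⥤ FinProb) : ℕ → DiagramClass (Set.Ici x) :=
  conic (Z.obj u).weight (condClass x u Z)

end Classes

theorem near_condConic_of_hom [Fintype G] [Fintype (Set.Ici x)] (u : G) {W Z : G ⥤ FinProb}
    (f : W ⟶ Z) : Near (condConic x u Z) (condConic x u W)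
      (3 * Fintype.card (Set.Ici x) * ∑ i, ((W.obj i).entropy - (Z.obj i).entropy)) := by
  have hp := Hom.preserving (f.app u)
  have h1 := fun a => (isMixture_condDiagram x f u a).near
  -- The law of large numbers is applied to each atom `a` of `U`, run at speed p(a), so that the
  -- costs add up to their average.
  have h2 := Near.sum Finset.univ fun a (_ : a ∈ Finset.univ) =>
    (h1 a).comp_floor (h1 a).nonneg ((Z.obj u).weight_pos a).le
  have h3 := h2.mono (sum_mixtureCost_le x f u)
  have e1 : (∑ a, fun m : ℕ => ⌊(Z.obj u).weight a * m⌋₊ •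
      cls (restrictDiagram x (condDiagram Z u a))) = condConic x u Z := by
    funext m
    rw [Finset.sum_apply]
    rfl
  rw [e1] at h3
  have h4 := h3.trans (z := condConic x u W) (δ' := 0) ?_
  · rwa [add_zero] at h4
  -- What remains is rounding: a nested floor against a single one, three floors in all.
  refine Near.of_bounded (C := 3 * ∑ v, dist (condClass x u W v) 0) fun m => ?_
  rw [Finset.sum_apply]
  have e2 : (∑ a, conic (fiberDistribution f u a).weight
      (fun v : {v | Hom.toFun (f.app u) v = a} => cls (restrictDiagram x (condDiagram W u v.1)))
      ⌊(Z.obj u).weight a * m⌋₊) =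
      ∑ v, ⌊(W.obj u).weight v / (Z.obj u).weight (Hom.toFun (f.app u) v) *
        ⌊(Z.obj u).weight (Hom.toFun (f.app u) v) * m⌋₊⌋₊ • condClass x u W v := by
    rw [← sum_sum_condition (g := Hom.toFun (f.app u)) fun a => hp.surjective a]
    refine Finset.sum_congr rfl fun a _ => Finset.sum_congr rfl fun v _ => ?_
    have hv : Hom.toFun (f.app u) v.1 = a := v.2
    have hw : (fiberDistribution f u a).weight v = (W.obj u).weight v.1 / (Z.obj u).weight a :=
      hp.condition_weight a _ v
    rw [hw, hv]
    rfl
  refine (congrArg (fun t => dist t (condConic x u W m)) e2).le.trans ?_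
  refine dist_sum_nsmul_le_of_abs_le (fun v => ?_) _
  set q := (W.obj u).weight v
  set p := (Z.obj u).weight (Hom.toFun (f.app u) v)
  have hq : 0 < q := (W.obj u).weight_pos v
  have hp0 : 0 < p := (Z.obj u).weight_pos _
  have hqp : q / p ≤ 1 := (div_le_one hp0).2 (hp.weight_le v)
  have hqp0 : 0 ≤ q / p := by positivity
  have h5 := abs_le.1 (abs_floor_sub_le (t := p * m) (by positivity))
  have h6 := abs_le.1 (abs_floor_sub_le (t := q * m) (by positivity))
  have h7 := abs_le.1 (abs_floor_sub_le (t := q / p * ⌊p * m⌋₊) (by positivity))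
  have h8 : q * m = q / p * (p * m) := by field_simp
  have h9 := mul_le_mul_of_nonneg_left h5.1 hqp0
  have h10 := mul_le_mul_of_nonneg_left h5.2 hqp0
  rw [mul_sub, ← h8] at h9 h10
  rw [abs_le]
  constructor <;> linarith

/-- Conditioning is Lipschitz. -/
theorem near_condConic [Fintype G] [Fintype (Set.Ici x)] (u : G) (Y Z : G ⥤ FinProb) :
    Near (condConic x u Y) (condConic x u Z) (3 * Fintype.card (Set.Ici x) * kd Y Z) := by
  refine Near.of_forall_pos fun η hη => ?_
  set L : ℝ := 3 * Fintype.card (Set.Ici x) with hL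
  have hL0 : 0 ≤ L := by positivity
  obtain ⟨W, f, g, hW⟩ := exists_fan_lt Y Z (η := η / (L + 1)) (by positivity)
  refine ((near_condConic_of_hom x u f).trans (near_condConic_of_hom x u g).symm).mono ?_
  rw [← hL, ← mul_add, ← Finset.sum_add_distrib]
  have e : ∀ i, (W.obj i).entropy - (Y.obj i).entropy + ((W.obj i).entropy - (Z.obj i).entropy) =
      2 * (W.obj i).entropy - (Y.obj i).entropy - (Z.obj i).entropy := fun i => by ring
  simp only [e]
  have h1 := mul_le_mul_of_nonneg_left hW.le hL0
  have h2 : L * (η / (L + 1)) ≤ η := by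
    rw [mul_div_assoc', div_le_iff₀ (by positivity)]
    nlinarith
  linarith

section Classes

variable [Finite G]

/-- The conditioning event of a tensor product is a product event, and the conditional law on it is
the product of the conditional laws. -/
theorem condClass_tensor (u : G) (Z Y : G ⥤ FinProb) (a : (Z.obj u).carrier)
    (b : (Y.obj u).carrier) :
    condClass x u (tensorDiagram Z Y) (a, b) = condClass x u Z a + condClass x u Y b := by
  cases nonempty_fintype G
  let := Fintype.ofFinite (Set.Ici x)
  let e : (condInitial (tensorDiagram Z Y) u (a, b)).carrier →
      ((condInitial Z u a).tensor (condInitial Y u b)).carrier :=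
    fun c => (⟨c.1.1, congrArg Prod.fst c.2⟩, ⟨c.1.2, congrArg Prod.snd c.2⟩)
  have he : IsMeasurePreserving (condInitial (tensorDiagram Z Y) u (a, b))
      ((condInitial Z u a).tensor (condInitial Y u b)) e := by
    refine IsMeasurePreserving.of_bijective ⟨?_, ?_⟩ ?_
    · intro c d h
      exact Subtype.ext (Prod.ext (congrArg (fun p => p.1.1) h) (congrArg (fun p => p.2.1) h))
    · rintro ⟨c, d⟩
      exact ⟨⟨(c.1, d.1), Prod.ext c.2 d.2⟩, rfl⟩
    · intro c
      refine Eq.trans ?_ ((isMeasurePreserving_fromInitial (tensorDiagram Z Y) u).condition_weight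
        (a, b) _ c).symm
      refine (congrArg₂ (· * ·) ((isMeasurePreserving_fromInitial Z u).condition_weight a _ _)
        ((isMeasurePreserving_fromInitial Y u).condition_weight b _ _)).trans ?_
      exact div_mul_div_comm _ _ _ _
  let f : restrictDiagram x (condDiagram (tensorDiagram Z Y) u (a, b)) ⟶
      tensorDiagram (restrictDiagram x (condDiagram Z u a))
        (restrictDiagram x (condDiagram Y u b)) :=
    { app := fun i => ⟨fun c => (⟨c.1.1, by
          obtain ⟨z, hz⟩ := c.2
          exact ⟨(e z).1, congrArg Prod.fst hz⟩⟩, ⟨c.1.2, by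
          obtain ⟨z, hz⟩ := c.2
          exact ⟨(e z).2, congrArg Prod.snd hz⟩⟩),
        (isMeasurePreserving_toImage (X := condInitial (tensorDiagram Z Y) u (a, b)) _).of_comp
          (he.comp ((isMeasurePreserving_toImage (X := condInitial Z u a)
            fun z : {z | fromInitial Z u z = a} => fromInitial Z i.1 z.1).tensor
            (isMeasurePreserving_toImage (X := condInitial Y u b)
            fun z : {z | fromInitial Y u z = b} => fromInitial Y i.1 z.1)))⟩
      naturality := fun _ _ _ => rfl }
  refine cls_eq (kd_eq_zero_of_injective f fun i c d h => ?_)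
  exact Subtype.ext (Prod.ext (congrArg (fun p => p.1.1) h) (congrArg (fun p => p.2.1) h))

theorem near_condConic_tensor (u : G) (Z Y : G ⥤ FinProb) :
    Near (condConic x u (tensorDiagram Z Y)) (condConic x u Z + condConic x u Y) 0 := by
  have h := near_conic_prod (fun a => ((Z.obj u).weight_pos a).le) (Z.obj u).sum_weight
    (fun a => ((Y.obj u).weight_pos a).le) (Y.obj u).sum_weight
    (condClass x u Z) (condClass x u Y)
  have e : condConic x u (tensorDiagram Z Y) =
      conic (fun a : (Z.obj u).carrier × (Y.obj u).carrier =>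
        (Z.obj u).weight a.1 * (Y.obj u).weight a.2)
        (fun a => condClass x u Z a.1 + condClass x u Y a.2) := by
    funext m
    exact Finset.sum_congr rfl fun a _ => congrArg _ (condClass_tensor x u Z Y a.1 a.2)
  rw [e]
  exact h

theorem condConic_eq_zero (u : G) {J : G ⥤ FinProb}
    (hJ : ∀ i, x ≤ i → Subsingleton (J.obj i).carrier) : condConic x u J = 0 := by
  have : condClass x u J = fun _ => 0 := by
    funext b
    refine cls_eq_zero_of_entropy fun i => ?_
    have := hJ i.1 i.2
    have : Subsingleton ((restrictDiagram x (condDiagram J u b)).obj i).carrier :=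
      inferInstanceAs (Subsingleton (Set.range _ : Set (J.obj i.1).carrier))
    exact entropy_eq_zero_of_subsingleton
  rw [condConic, this, conic_zero]

end Classes

end Diagrams

/-! ### Spaces of prescribed entropy -/

/-- One atom of weight `1 - t k / (k + 1)` and `k` atoms of weight `t / (k + 1)`. -/
def FinProb.spread (k : ℕ) (t : ℝ) (h0 : 0 < t) (h1 : t ≤ 1) : FinProb where
  carrier := Option (Fin k)
  weight a := a.elim (1 - t * k / (k + 1)) fun _ => t / (k + 1)
  weight_pos a := by
    have hk : (0 : ℝ) < k + 1 := by positivity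
    cases a with
    | none =>
      have : t * k / (k + 1) < 1 := by
        rw [div_lt_one hk]
        nlinarith [Nat.cast_nonneg (α := ℝ) k]
      simpa using this
    | some a => exact div_pos h0 hk
  sum_weight := by
    rw [Fintype.sum_option]
    simp
    ring

/-- The intermediate value theorem is applied to the family `spread`, whose entropy formula runs
from 0 at t = 0 to log (k + 1) > r at t = 1. As r > 0, the solution has t > 0 and the weights are
positive. -/
theorem FinProb.exists_entropy_eq {r : ℝ} (hr : 0 < r) : ∃ W : FinProb, W.entropy = r := by
  obtain ⟨k, hk⟩ := exists_nat_gt (Real.exp r)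
  have hk0 : (0 : ℝ) < k + 1 := by positivity
  set h : ℝ → ℝ := fun t => Real.negMulLog (1 - t * k / (k + 1)) +
    k * Real.negMulLog (t / (k + 1)) with hh
  have hc : Continuous h := by
    have h1 : Continuous fun t : ℝ => Real.negMulLog (1 - t * k / (k + 1)) :=
      Real.continuous_negMulLog.comp (by fun_prop)
    have h2 : Continuous fun t : ℝ => Real.negMulLog (t / (k + 1)) :=
      Real.continuous_negMulLog.comp (by fun_prop)
    exact h1.add (h2.const_mul _ |>.congr fun t => rfl)
  have e0 : h 0 = 0 := by simp [hh]
  have e1 : h 1 = Real.log (k + 1) := by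
    have : (1 : ℝ) - 1 * k / (k + 1) = 1 / (k + 1) := by field_simp; ring
    simp only [hh, this, Real.negMulLog, one_div, Real.log_inv]
    field_simp
    ring
  have hle : r ≤ h 1 := by
    rw [e1, Real.le_log_iff_exp_le hk0]
    linarith
  obtain ⟨t, ht, htr⟩ := intermediate_value_Icc zero_le_one hc.continuousOn
    (show r ∈ Set.Icc (h 0) (h 1) from ⟨by rw [e0]; exact hr.le, hle⟩)
  have ht0 : 0 < t := lt_of_le_of_ne ht.1 fun h' => by rw [← h', e0] at htr; exact hr.ne htr
  refine ⟨spread k t ht0 ht.2, ?_⟩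
  rw [← htr]
  change ∑ a : Option (Fin k), _ = _
  rw [Fintype.sum_option]
  simp [spread, hh]

section Diagrams

variable {G : Type*} [SemilatticeInf G]

/-! ### Asymptotic distance -/

theorem tendsto_kd_of_aikd [Finite G] {X Y : ℕ → (G ⥤ FinProb)} (h : aikd X Y = 0) :
    Tendsto (fun n : ℕ => kd (X n) (Y n) / n) atTop (𝓝 0) := by
  have h1 : Tendsto (fun n : ℕ => ikd (X n) (Y n) / (n : ℝ≥0∞)) atTop (𝓝 0) :=
    tendsto_of_le_liminf_of_limsup_le bot_le h.le
  have h2 := (ENNReal.tendsto_toReal ENNReal.zero_ne_top).comp h1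
  simpa [Function.comp_def, ENNReal.toReal_div, kd] using h2

theorem aikd_eq_zero_of_kd [Finite G] {X Y : ℕ → (G ⥤ FinProb)} (h : ∀ n, kd (X n) (Y n) = 0) :
    aikd X Y = 0 := by
  have : (fun n : ℕ => ikd (X n) (Y n) / (n : ℝ≥0∞)) = fun _ => 0 := by
    funext n
    rw [ikd_eq_ofReal, h, ENNReal.ofReal_zero, ENNReal.zero_div]
  rw [aikd, this, limsup_const]

/-! ### Diagrams supported off the descendants of a space -/

/-- The tensor powers of a diagram. -/
def powDiagram (J : G ⥤ FinProb) : ℕ → (G ⥤ FinProb)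
  | 0 => pointDiagram G
  | n + 1 => tensorDiagram (powDiagram J n) J

theorem entropy_pointDiagram (i : G) : ((pointDiagram G).obj i).entropy = 0 :=
  have : Subsingleton ((pointDiagram G).obj i).carrier := inferInstanceAs (Subsingleton Unit)
  entropy_eq_zero_of_subsingleton

theorem entropy_powDiagram (J : G ⥤ FinProb) (n : ℕ) (i : G) :
    ((powDiagram J n).obj i).entropy = n * (J.obj i).entropy := by
  induction n with
  | zero => rw [powDiagram, entropy_pointDiagram, Nat.cast_zero, zero_mul]
  | succ n ih => rw [powDiagram, entropy_tensorDiagram, ih, Nat.cast_succ]; ring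

theorem subsingleton_powDiagram {J : G ⥤ FinProb} {i : G} (h : Subsingleton (J.obj i).carrier)
    (n : ℕ) : Subsingleton ((powDiagram J n).obj i).carrier := by
  induction n with
  | zero => exact inferInstanceAs (Subsingleton Unit)
  | succ n ih =>
    exact inferInstanceAs (Subsingleton (((powDiagram J n).obj i).carrier × (J.obj i).carrier))

open Classical in
/-- The diagram with the space `W` at all indices which are not descendants of `x`, and one-point
spaces at the descendants of `x`. -/
def offDiagram (x : G) (W : FinProb) : G ⥤ FinProb :=
  ofMaps W (S := fun _ => Option W.carrier) (fun i w => if x ≤ i then none else some w) (by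
    intro i j hij a b h
    by_cases hj : x ≤ j
    · simp [hj]
    · have hi : ¬ x ≤ i := fun hi => hj (hi.trans hij)
      simpa [hi, hj] using h)

theorem subsingleton_offDiagram {x i : G} (W : FinProb) (h : x ≤ i) :
    Subsingleton ((offDiagram x W).obj i).carrier := by
  refine ⟨?_⟩
  rintro ⟨_, a, rfl⟩ ⟨_, b, rfl⟩
  exact Subtype.ext (by simp [h])

theorem entropy_offDiagram {x i : G} (W : FinProb) (h : ¬ x ≤ i) :
    ((offDiagram x W).obj i).entropy = W.entropy := by
  classical
  refine (entropy_image _).trans (ent_eq_entropy_of_injective fun a b hab => ?_)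
  simpa [h] using hab

variable [OrderBot G]

/-! ### Independence of representatives and existence of conditioned diagrams -/

section Classes

variable [Finite G]

theorem aikd_le_of_near {X Y : ℕ → (G ⥤ FinProb)} {δ : ℝ}
    (h : Near (fun n => cls (X n)) (fun n => cls (Y n)) δ) {ε : ℝ} (hε : δ < ε) :
    aikd X Y ≤ ENNReal.ofReal ε := by
  obtain ⟨C, hC⟩ := h ((ε - δ) / 2) (by linarith)
  obtain ⟨N, hN⟩ := exists_nat_gt (C / ((ε - δ) / 2))
  rw [div_lt_iff₀ (by linarith)] at hN
  refine limsup_le_of_le (h := eventually_atTop.2 ⟨N + 1, fun n hn => ?_⟩)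
  have hn0 : (0 : ℝ) < n := by exact_mod_cast (show 0 < n by omega)
  have hnN : (N : ℝ) ≤ n := by exact_mod_cast (show N ≤ n by omega)
  rw [ikd_eq_ofReal, ← ENNReal.ofReal_natCast, ← ENNReal.ofReal_div_of_pos hn0]
  refine ENNReal.ofReal_le_ofReal ((div_le_iff₀ hn0).2 ((hC n).trans ?_))
  nlinarith

theorem near_of_tendsto_kd {X Y : ℕ → (G ⥤ FinProb)}
    (h : Tendsto (fun n : ℕ => kd (X n) (Y n) / n) atTop (𝓝 0)) :
    Near (fun n => cls (X n)) (fun n => cls (Y n)) 0 := by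
  intro η hη
  obtain ⟨N, hN⟩ := eventually_atTop.1 (h.eventually (gt_mem_nhds hη))
  refine ⟨∑ n ∈ Finset.range (N + 1), kd (X n) (Y n), fun m => ?_⟩
  have h0 : 0 ≤ ∑ n ∈ Finset.range (N + 1), kd (X n) (Y n) :=
    Finset.sum_nonneg fun n _ => kd_nonneg _ _
  rw [dist_cls, zero_add]
  rcases lt_or_ge m (N + 1) with hm | hm
  · have := Finset.single_le_sum (f := fun n => kd (X n) (Y n)) (fun n _ => kd_nonneg _ _)
      (Finset.mem_range.2 hm)
    have := mul_nonneg hη.le (Nat.cast_nonneg (α := ℝ) m)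
    linarith
  · have hm0 : (0 : ℝ) < m := by exact_mod_cast (show 0 < m by omega)
    have := (div_lt_iff₀ hm0).1 (hN m (by omega))
    linarith

/-- Any two representatives of a tropical diagram are asymptotically equivalent. -/
theorem Represents.tendsto_kd {X Y : QLSeq G} {T : TropDiagram G} (hX : Represents X T)
    (hY : Represents Y T) : Tendsto (fun n : ℕ => kd (X.1 n) (Y.1 n) / n) atTop (𝓝 0) := by
  cases nonempty_fintype G
  have h := Quot.eqvGen_exact (hX.trans hY.symm)
  clear hX hY
  induction h with
  | rel X Y h => exact tendsto_kd_of_aikd h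
  | refl X => simp [kd_self]
  | symm X Y _ ih =>
    simp only [kd_comm (Y.1 _) (X.1 _)]
    exact ih
  | trans X Y Z _ _ ih1 ih2 =>
    refine squeeze_zero (fun n => div_nonneg (kd_nonneg _ _) (Nat.cast_nonneg n)) (fun n => ?_)
      (by simpa using ih1.add ih2)
    rw [← add_div]
    exact div_le_div_of_nonneg_right (kd_triangle _ _ _) (Nat.cast_nonneg n)

/-- Asymptotic invariants that are Lipschitz do not depend on the representative. -/
theorem Represents.tendsto_of_lipschitz {X Y : QLSeq G} {T : TropDiagram G} (hX : Represents X T)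
    (hY : Represents Y T) {F : (G ⥤ FinProb) → ℝ} {c : ℝ}
    (hF : ∀ X Y, |F X - F Y| ≤ c * kd X Y) {l : ℝ}
    (h : Tendsto (fun n : ℕ => F (X.1 n) / n) atTop (𝓝 l)) :
    Tendsto (fun n : ℕ => F (Y.1 n) / n) atTop (𝓝 l) := by
  have h1 : Tendsto (fun n : ℕ => F (Y.1 n) / n - F (X.1 n) / n) atTop (𝓝 0) := by
    refine squeeze_zero_norm (fun n => ?_)
      (by simpa using (hY.tendsto_kd hX).const_mul c)
    rw [Real.norm_eq_abs, ← sub_div, abs_div, Nat.abs_cast, ← mul_div_assoc]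
    exact div_le_div_of_nonneg_right (hF _ _) (Nat.cast_nonneg n)
  simpa using h1.add h

theorem Represents.hasCondEntropy {X : QLSeq G} {T : TropDiagram G} (hX : Represents X T)
    {i j : G} {r : ℝ}
    (h : Tendsto (fun n : ℕ => (((X.1 n).obj i).entropy - ((X.1 n).obj j).entropy) / (n : ℝ))
      atTop (𝓝 r)) : HasCondEntropy T i j r := by
  cases nonempty_fintype G
  intro Y hY
  refine hX.tendsto_of_lipschitz hY (F := fun X => (X.obj i).entropy - (X.obj j).entropy) (c := 2)
    (fun X Y => ?_) h
  have h1 := abs_le.1 (abs_entropy_sub_le X Y i)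
  have h2 := abs_le.1 (abs_entropy_sub_le X Y j)
  rw [abs_le]
  constructor <;> linarith

theorem Represents.isMinimalFan {X : QLSeq G} {T : TropDiagram G} (hX : Represents X T)
    {x u : G}
    (h : Tendsto (fun n : ℕ => (((X.1 n).obj ⊥).entropy - jointEntropy (X.1 n) x u) / (n : ℝ))
      atTop (𝓝 0)) : IsMinimalFan T x u := by
  cases nonempty_fintype G
  intro Y hY
  refine hX.tendsto_of_lipschitz hY (F := fun X => (X.obj ⊥).entropy - jointEntropy X x u) (c := 3)
    (fun X Y => ?_) h
  have h1 := abs_le.1 (abs_entropy_sub_le X Y ⊥)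
  have h2 := abs_le.1 (abs_jointEntropy_sub_le X Y x u)
  rw [abs_le]
  constructor <;> linarith

/-- It is enough to check convergence of the conditioned diagrams for one representative. -/
theorem Represents.isConditioned {X : QLSeq G} {T : TropDiagram G} (hX : Represents X T)
    {x u : G} {C : TropDiagram (Set.Ici x)} {D : QLSeq (Set.Ici x)} (hD : Represents D C)
    (h : ∀ ε : ℝ, 0 < ε → ∃ N₀ : ℕ, ∀ N, N₀ ≤ N →
      Near (conic (fun a => ((X.1 N).obj u).weight a / N) (condClass x u (X.1 N)))
        (fun m => cls (D.1 m)) ε) :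
    IsConditioned T x u C := by
  cases nonempty_fintype G
  let := Fintype.ofFinite (Set.Ici x)
  intro Z hZ D' hD'
  rw [ENNReal.tendsto_nhds_zero]
  intro ε hε
  obtain ⟨r, hr0, hr⟩ := ENNReal.lt_iff_exists_real_btwn.1 hε
  have hr' : 0 < r := ENNReal.ofReal_pos.1 hr.1
  set L : ℝ := 3 * Fintype.card (Set.Ici x) with hL
  have hL0 : 0 ≤ L := by positivity
  have h1 := ((hZ.tendsto_kd hX).const_mul L).eventually
    (gt_mem_nhds (show L * 0 < r / 3 by rw [mul_zero]; positivity))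
  obtain ⟨N₀, hN₀⟩ := h (r / 3) (by positivity)
  filter_upwards [h1, eventually_ge_atTop (N₀ + 1)] with n hn1 hn2
  have hn0 : 0 < n := by omega
  -- By the Lipschitz bound, changing the representative moves the normalized combination by L kd /
  -- n, which tends to 0.
  have h2 := (near_condConic x u (Z.1 n) (X.1 n)).conic_div
    (fun a => (((Z.1 n).obj u).weight_pos a).le) (fun a => (((X.1 n).obj u).weight_pos a).le)
    (mul_nonneg hL0 (kd_nonneg _ _)) hn0
  rw [mul_div_assoc] at h2
  have h3 := (h2.trans (hN₀ n (by omega))).trans (near_of_tendsto_kd (hD.tendsto_kd hD'))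
  refine le_trans (aikd_le_of_near (δ := 2 * r / 3) ?_ (show 2 * r / 3 < r by linarith)) hr.2.le
  simp only [cls_conicCombination]
  exact h3.mono (by linarith)

/-- Every conditioned diagram is well defined. -/
theorem exists_near_condClass (X : QLSeq G) (x u : G) : ∃ D : QLSeq (Set.Ici x),
    ∀ ε : ℝ, 0 < ε → ∃ N₀ : ℕ, ∀ N, N₀ ≤ N →
      Near (conic (fun a => ((X.1 N).obj u).weight a / N) (condClass x u (X.1 N)))
        (fun m => cls (D.1 m)) ε := by
  cases nonempty_fintype G
  let := Fintype.ofFinite (Set.Ici x)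
  obtain ⟨φ, hφ, h⟩ := X.2
  obtain ⟨w, ψ, hψ, hw, hlim⟩ := exists_conic_limit
    (fun n => ((X.1 n).obj u).weight) (fun n a => (((X.1 n).obj u).weight_pos a).le)
    (fun n => condClass x u (X.1 n)) hφ (L := 3 * Fintype.card (Set.Ici x)) (by positivity)
    (fun a b ha hb => by
      have h1 := (near_condConic x u (X.1 (a + b)) (tensorDiagram (X.1 a) (X.1 b))).trans
        (near_condConic_tensor x u (X.1 a) (X.1 b))
      refine h1.mono ?_
      rw [add_zero]
      exact mul_le_mul_of_nonneg_left ((ikd_le_ofReal_iff (hφ.nonneg _)).1 (h a b ha hb))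
        (by positivity))
  -- The limit consists of classes; any lift to diagrams will do, as almost additivity depends only
  -- on the distance.
  choose D hD using fun m => cls_surjective (w m)
  obtain rfl : (fun m => cls (D m)) = w := funext hD
  exact ⟨⟨D, ψ, hψ, fun m n _ _ => (ikd_le_ofReal_iff (hψ.nonneg _)).2 (hw m n)⟩, hlim⟩

end Classes

/-! ### Joint entropy of tensor powers -/

theorem cls_powDiagram [Finite G] (J : G ⥤ FinProb) (n : ℕ) :
    cls (powDiagram J n) = n • cls J := by
  induction n with
  | zero => rw [zero_nsmul]; rfl
  | succ n ih => rw [powDiagram, cls_tensor, ih, succ_nsmul]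

theorem jointEntropy_tensorDiagram (X Y : G ⥤ FinProb) (x u : G) :
    jointEntropy (tensorDiagram X Y) x u = jointEntropy X x u + jointEntropy Y x u := by
  rw [jointEntropy_eq, jointEntropy_eq, jointEntropy_eq]
  refine Eq.trans (ent_congr fun a b => ?_) (ent_tensor
    (fun z => (fromInitial X x z, fromInitial X u z))
    (fun z => (fromInitial Y x z, fromInitial Y u z)))
  change ((fromInitial X x a.1, fromInitial Y x a.2), (fromInitial X u a.1, fromInitial Y u a.2)) =
    ((fromInitial X x b.1, fromInitial Y x b.2), (fromInitial X u b.1, fromInitial Y u b.2)) ↔ _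
  simp only [Prod.mk.injEq]
  tauto

theorem jointEntropy_le (X : G ⥤ FinProb) (x u : G) :
    jointEntropy X x u ≤ (X.obj ⊥).entropy := by
  rw [jointEntropy_eq]
  exact ent_le_entropy _

theorem entropy_le_jointEntropy (X : G ⥤ FinProb) (x u : G) :
    (X.obj u).entropy ≤ jointEntropy X x u := by
  rw [jointEntropy_eq, ← (isMeasurePreserving_fromInitial X u).ent_eq]
  exact ent_mono fun a b h => (Prod.mk.inj h).2

theorem jointEntropy_powDiagram (J : G ⥤ FinProb) (n : ℕ) (x u : G) :
    jointEntropy (powDiagram J n) x u = n * jointEntropy J x u := by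
  induction n with
  | zero =>
    rw [Nat.cast_zero, zero_mul]
    refine le_antisymm ((jointEntropy_le _ x u).trans_eq (entropy_pointDiagram ⊥)) ?_
    rw [jointEntropy_eq]
    exact ent_nonneg _
  | succ n ih => rw [powDiagram, jointEntropy_tensorDiagram, ih, Nat.cast_succ]; ring

end Diagrams

end

/-! ### The arrow expansion theorem -/

theorem theoremp {G : Type*} [Finite G] [SemilatticeInf G] [OrderBot G]
    (Z' : TropDiagram G) (x u : G)
    (hadm : IsAdmissibleFan Z' x u) (hred : IsReducedFan Z' x)
    (lam : ℝ) (hlam : 0 < lam) :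
    ∃ Z : TropDiagram G,
      TropDiagram.restrict x Z = TropDiagram.restrict x Z' ∧
      IsAdmissibleFan Z x u ∧
      HasCondEntropy Z ⊥ x lam ∧
      ∃ C : TropDiagram (Set.Ici x), IsConditioned Z x u C ∧ IsConditioned Z' x u C := by
  obtain ⟨X, rfl⟩ := Quot.exists_rep Z'
  obtain ⟨W, hW⟩ := FinProb.exists_entropy_eq hlam
  have hx : ¬ x ≤ ⊥ := fun h => hadm.disjoint (h.trans bot_le)
  let J := offDiagram x W
  have hJx : (J.obj x).entropy = 0 :=
    have := subsingleton_offDiagram W (le_refl x)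
    FinProb.entropy_eq_zero_of_subsingleton
  have hJbot : (J.obj ⊥).entropy = lam := (entropy_offDiagram W hx).trans hW
  have hJu : (J.obj u).entropy = lam := (entropy_offDiagram W hadm.disjoint).trans hW
  -- The joint entropy lies between the entropies at `u` and at the initial index, which agree
  -- because neither index is a descendant of `x`.
  have hJxu : jointEntropy J x u = lam :=
    le_antisymm (hJbot ▸ jointEntropy_le J x u) (hJu ▸ entropy_le_jointEntropy J x u)
  have hsub : ∀ n i, x ≤ i → Subsingleton ((powDiagram J n).obj i).carrier := fun n i hi =>
    subsingleton_powDiagram (subsingleton_offDiagram W hi) n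
  -- The tensor powers of `J` are exactly additive, so the bound φ of the given sequence still
  -- serves.
  let E : QLSeq G := ⟨fun n => tensorDiagram (X.1 n) (powDiagram J n), by
    obtain ⟨φ, hφ, h⟩ := X.2
    refine ⟨φ, hφ, fun m n hm hn => ?_⟩
    rw [ikd_le_ofReal_iff (hφ.nonneg _), ← dist_cls]
    have h1 := (ikd_le_ofReal_iff (hφ.nonneg _)).1 (h m n hm hn)
    rw [← dist_cls, cls_tensor] at h1
    simp only [cls_tensor, cls_powDiagram]
    rw [add_add_add_comm (cls (X.1 m)), ← add_nsmul]
    refine (dist_add_le _ _ _ _).trans ?_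
    rw [dist_self, add_zero]
    exact h1⟩
  have hE : Represents E (Quot.mk _ E) := rfl
  have hX : Represents X (Quot.mk _ X) := rfl
  refine ⟨Quot.mk _ E, Quot.sound (aikd_eq_zero_of_kd fun n => ?_), ⟨?_, hadm.cover, hadm.disjoint⟩,
    ?_, ?_⟩
  · rw [← dist_cls]
    have h0 : cls (restrictDiagram x (powDiagram J n)) = 0 := cls_eq_zero_of_entropy fun i =>
      have : Subsingleton ((restrictDiagram x (powDiagram J n)).obj i).carrier := hsub n i.1 i.2
      FinProb.entropy_eq_zero_of_subsingleton
    change dist (cls (tensorDiagram (restrictDiagram x (X.1 n))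
      (restrictDiagram x (powDiagram J n)))) (cls (restrictDiagram x (X.1 n))) = 0
    rw [cls_tensor, h0, add_zero, dist_self]
  · refine hE.isMinimalFan ((hadm.minimal X hX).congr fun n => ?_)
    simp only [E, entropy_tensorDiagram, jointEntropy_tensorDiagram, entropy_powDiagram,
      jointEntropy_powDiagram, hJbot, hJxu]
    ring
  · refine hE.hasCondEntropy ?_
    have h1 := (hred X hX).add_const lam
    rw [zero_add] at h1
    refine h1.congr' ?_
    -- At n = 0 division by zero gives 0 instead of λ.
    filter_upwards [eventually_ge_atTop 1] with n hn
    have hn0 : (0 : ℝ) < n := by exact_mod_cast hn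
    simp only [E, entropy_tensorDiagram, entropy_powDiagram, hJbot, hJx]
    field_simp
    ring
  · obtain ⟨D, hD⟩ := exists_near_condClass X x u
    have hDC : Represents D (Quot.mk _ D) := rfl
    refine ⟨Quot.mk _ D, hE.isConditioned hDC fun ε hε => ?_, hX.isConditioned hDC hD⟩
    obtain ⟨N₀, hN₀⟩ := hD ε hε
    refine ⟨N₀ + 1, fun N hN => ?_⟩
    -- The noise contributes the zero class below `x`, so the old limit `D` also serves the expanded
    -- diagram.
    have h1 := near_condConic_tensor x u (X.1 N) (powDiagram J N)
    rw [condConic_eq_zero x u (hsub N), add_zero] at h1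
    have h2 := (h1.conic_div (fun a => (((E.1 N).obj u).weight_pos a).le)
      (fun a => (((X.1 N).obj u).weight_pos a).le) le_rfl (show 0 < N by omega)).trans
      (hN₀ N (by omega))
    exact h2.mono (by simp)
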